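/- **Setting.** Let $d\ge 1$ and let $\Omega\subset\mathbb R^d$ be compact and convex, with non-empty interior and smooth boundary. Let $\mathcal M(\Omega)$ be the space of finite signed Borel measures on $\Omega$, $\mathcal M_+(\Omega)$ its cone of positive measures, $\mathcal M(\Omega)^d$ the space of $\mathbb R^d$-valued measures, $\|\cdot\|$ the total variation norm, and $\langle\cdot,\cdot\rangle$ the duality with continuous functions (resp. vector fields). Put $$A(\rho,\mathbf m)=\sup\Big\{\langle\rho,a\rangle+\langle\mathbf m,\mathbf b\rangle:\ a\in C(\Omega),\ \mathbf b\in C(\Omega,\mathbb R^d),\ a+\tfrac12|\mathbf b|^2\le 0\Big\},\qquad A^\star(\rho,\mathbf b)=\tfrac12\langle\rho,|\mathbf b|^2\rangle .$$ Let $\Sigma\subset(0,\infty)$ have $0$ as an accumulation point; below, $\sigma$ ranges over $\Sigma$. **Meshes.** For each $\sigma$ let $\mathcal T^\sigma$ be a finite partition of $\Omega$ into Borel convex cells, and for each $K\in\mathcal T^\sigma$ let $x_K$ be a point in the interior of $K$. Write $|K|$ for the volume of $K$, $(K|L)=\bar K\cap\bar L$ for $K\ne L$, and $|(K|L)|$ for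 its $(d-1)$-dimensional Hausdorff measure (normalized to agree with Lebesgue measure on hyperplanes); write $K\sim L$ if $K\neq L$ and $|(K|L)|>0$, $\mathcal E^\sigma=\{(K,L):K\sim L\}$, $d_{KL}=|x_K-x_L|$ and $\mathbf n_{KL}=(x_L-x_K)/d_{KL}$. Assume: * (admissibility) if $K\sim L$ then $x_L-x_K$ is orthogonal to $(K|L)$; * (uniform regularity) there is $c>0$ such that for all $\sigma$, every $K\in\mathcal T^\sigma$ has diameter at most $c^{-1}\sigma$ and contains the ball of centre $x_K$ and radius $c\sigma$, and $|(K|L)|\ge c\,\sigma^{d-1}$ whenever $K\sim L$; * (isotropy) there are $\varepsilon_\sigma\to0$ as $\sigma\to0$ with $\frac1{2|K|}\sum_{L\sim K}|(K|L)|\,d_{KL}\,(v\cdot\mathbf n_{KL})^2\le(1+\varepsilon_\sigma)|v|^2$ for all $\sigma$, all $K\in\mathcal T^\sigma$ and all $v\in\mathbb R^d$. **Mean.** Let $\theta:[0,\infty)^2\to[0,\infty)$ be continuous, smooth on $(0,\infty)^2$, positively $1$-homogeneous, symmetric, jointly concave, with $\theta(1,1)=1$. **Model.** $\mathcal X_\sigma=\mathbb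 R^{\mathcal T^\sigma}$, $\mathcal X_{\sigma,+}=[0,\infty)^{\mathcal T^\sigma}$, $\mathcal Y_\sigma=\{M\in\mathbb R^{\mathcal E^\sigma}:M_{KL}=-M_{LK}\}$, $$(\mathrm{Div}_\sigma M)_K=\sum_{L\sim K}\frac{|(K|L)|}{|K|}M_{KL},\qquad A_\sigma(P,M)=\sum_{(K,L)\in\mathcal E^\sigma}\frac{M_{KL}^2}{4\,\theta(P_K,P_L)}\,|(K|L)|\,d_{KL}\quad(P\in\mathcal X_{\sigma,+}),$$ with $0/0=0$ and $t/0=+\infty$ for $t>0$, and $A_\sigma(P,M)=+\infty$ if $P\notin\mathcal X_{\sigma,+}$. For a linear form $B$ on $\mathcal Y_\sigma$ let $A_\sigma^\star(P,B)=\sup_{M\in\mathcal Y_\sigma}\big(B(M)-A_\sigma(P,M)\big)$. **Operators.** For $P\in\mathcal X_\sigma$, $M\in\mathcal Y_\sigma$, $\rho\in\mathcal M(\Omega)$ and $\mathbf m\in C(\Omega,\mathbb R^d)$ (identified with the measure of density $\mathbf m$), $$R^{\mathcal{CE}}_\sigma P=\sum_KP_K|K|\,\delta_{x_K},\qquad R^A_\sigma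 P=\sum_KP_K\mathbf 1_K\,dx,\qquad R_\sigma M=\frac12\sum_{(K,L)\in\mathcal E^\sigma}M_{KL}\,d_{KL}\,\mathbf n_{KL}\,\mathcal H^{d-1}|_{(K|L)},$$ $$(S_\sigma\rho)_K=\frac{\rho(K)}{|K|},\qquad (\mathbf S_\sigma\mathbf m)_{KL}=\frac1{|(K|L)|}\int_{(K|L)}\mathbf m\cdot\mathbf n_{KL}\,d\mathcal H^{d-1},$$ and $R_\sigma^\top\mathbf b$ is the linear form $M\mapsto\langle R_\sigma M,\mathbf b\rangle$ on $\mathcal Y_\sigma$. **Proposition.** For every $\sigma$, $\mathcal X_\sigma$ and $\mathcal Y_\sigma$ are finite dimensional, $A_\sigma:\mathcal X_\sigma\times\mathcal Y_\sigma\to[0,+\infty]$ is proper and convex, $A_\sigma(rP,M)=r^{-1}A_\sigma(P,M)$ for $r>0$, $A_\sigma(P,rM)=r^2A_\sigma(P,M)$ for $r\ne0$, $A_\sigma(P,0)=0$ for $P\in\mathcal X_{\sigma,+}$, $A_\sigma(P_1+P_2,M)\le A_\sigma(P_1,M)$ for $P_1,P_2$ in the cone $\mathcal X_{\sigma,+}$,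 and $\mathrm{Div}_\sigma$ is linear. The operators above are linear; $R^{\mathcal{CE}}_\sigma$ and $R^A_\sigma$ map $\mathcal X_{\sigma,+}$ into $\mathcal M_+(\Omega)$, and $S_\sigma$ maps $\mathcal M_+(\Omega)$ into $\mathcal X_{\sigma,+}$. Moreover: * (A1) for every $\rho\in\mathcal M_+(\Omega)$, $R^{\mathcal{CE}}_\sigma S_\sigma\rho\to\rho$ weakly as $\sigma\to0$. * (A2) For every bounded $\mathcal B\subset C^1(\Omega)$ there are $\varepsilon_\sigma\to0$ with $\langle(R^{\mathcal{CE}}_\sigma-R^A_\sigma)P,\phi\rangle\le\varepsilon_\sigma\|R^{\mathcal{CE}}_\sigma P\|$ for all $\sigma$, $\phi\in\mathcal B$, $P\in\mathcal X_\sigma$. * (A3) For every bounded $\mathcal B\subset C^2(\Omega)$ there are $\varepsilon_\sigma\to0$ with $|\langle R^{\mathcal{CE}}_\sigma\mathrm{Div}_\sigma M,\phi\rangle+\langle R_\sigma M,\nabla\phi\rangle|\le\varepsilon_\sigma\|R_\sigma M\|$ for all $\sigma$, $M\in\mathcal Y_\sigma$, $\phi\in\mathcal B$. * (A4) For every $\mathbf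 m\in C^1(\Omega,\mathbb R^d)$ with $\mathbf m\cdot\mathbf n_{\partial\Omega}=0$ on $\partial\Omega$ and every $\sigma$, $S_\sigma(\nabla\cdot\mathbf m)=\mathrm{Div}_\sigma\mathbf S_\sigma\mathbf m$. * (A5) For every bounded $\mathcal B\subset C^1(\Omega,\mathbb R^d)$ there are $\varepsilon_\sigma\to0$ with $A^\star_\sigma(P,R_\sigma^\top\mathbf b)\le A^\star(R^A_\sigma P,\mathbf b)+\varepsilon_\sigma\|R^A_\sigma P\|$ for all $\mathbf b\in\mathcal B$, $\sigma$, $P\in\mathcal X_\sigma$; and there is $C\ge1$ with $A_\sigma^\star(P,R_\sigma^\top\mathbf b)\le\frac C2\|R^A_\sigma P\|\,(\sup_\Omega|\mathbf b|)^2$ for all $\mathbf b\in C(\Omega,\mathbb R^d)$, $\sigma$, $P\in\mathcal X_\sigma$. * (A6) For every bounded $\mathcal B\subset C^1(\Omega)$ whose elements are bounded from below by a common positive constant and every bounded $\mathcal B'\subset C^1(\Omega,\mathbb R^d)$ there are $\varepsilon_\sigma\to0$ with $A_\sigma(S_\sigma\rho,\mathbf S_\sigma\mathbf m)\le A(\rho,\mathbf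 m)+\varepsilon_\sigma$ for all $\sigma$ and all measures $\rho$, $\mathbf m$ with densities in $\mathcal B$, $\mathcal B'$. * (A7) There are $\varepsilon_\sigma\to0$ and a continuous function $\omega$ with $\omega(0)=0$ such that for all $x,y\in\Omega$ and all $\sigma$ there are $\hat P\in\mathcal X_{\sigma,+}$ and $\hat M_1,\hat M_2\in\mathcal Y_\sigma$ with $\mathrm{Div}_\sigma\hat M_1=\hat P-S_\sigma\delta_x$, $\mathrm{Div}_\sigma\hat M_2=\hat P-S_\sigma\delta_y$ and $A_\sigma(\hat P,\hat M_i)\le\omega(|x-y|)+\varepsilon_\sigma$ for $i=1,2$. That is, the finite volume discretization is a family of finite dimensional models of dynamical optimal transport which is adapted to $\Omega$, with these reconstruction and sampling operators. -/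

import Mathlib

open MeasureTheory Set Filter Topology
open scoped ContDiff RealInnerProductSpace

noncomputable section

namespace OptimalTransport

/-- Euclidean space `ℝ^d`. -/
abbrev Rd (d : ℕ) : Type := EuclideanSpace ℝ (Fin d)

/-! ### The domain and the test functions -/

/-- The boundary of `Ω` is smooth: near each of its boundary points, `Ω` is a sublevel set
`{g ≤ 0}` of a smooth function `g` whose differential does not vanish at that point. -/
def HasSmoothBoundary {d : ℕ} (Ω : Set (Rd d)) : Prop :=
  ∀ x ∈ frontier Ω, ∃ g : Rd d → ℝ,
    ContDiff ℝ ∞ g ∧ fderiv ℝ g x ≠ 0 ∧ ∀ᶠ y in 𝓝 x, (y ∈ Ω ↔ g y ≤ 0)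

/-- `n` is the outward unit normal at the boundary point `x` of the convex set `Ω` (it is unique
if the boundary is smooth). -/
def IsOutwardNormal {d : ℕ} (Ω : Set (Rd d)) (x n : Rd d) : Prop :=
  ‖n‖ = 1 ∧ ∀ y ∈ Ω, ⟪n, y - x⟫ ≤ 0

/-- `B` is a bounded set of `C^q(Ω, F)`. Functions are given on the whole space, but only their
values on `Ω` matter; derivatives are taken within `Ω`, up to the boundary. -/
def IsBoundedInC {d : ℕ} {F : Type*} [NormedAddCommGroup F] [NormedSpace ℝ F]
    (q : ℕ) (Ω : Set (Rd d)) (B : Set (Rd d → F)) : Prop :=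
  (∀ f ∈ B, ContDiffOn ℝ q f Ω) ∧
    ∃ C : ℝ, ∀ f ∈ B, ∀ k ≤ q, ∀ x ∈ Ω, ‖iteratedFDerivWithin ℝ k f Ω x‖ ≤ C

/-- The divergence `∑ i, ∂ᵢ mᵢ` of a vector field on `Ω`. -/
def divergenceWithin {d : ℕ} (Ω : Set (Rd d)) (m : Rd d → Rd d) (x : Rd d) : ℝ :=
  ∑ i, fderivWithin ℝ m Ω x (EuclideanSpace.single i 1) i

/-- The restriction to `Ω` of a function which is continuous on `Ω`. -/
def restrictC {d : ℕ} {Ω : Set (Rd d)} {F : Type*} [TopologicalSpace F] (f : Rd d → F)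
    (hf : ContinuousOn f Ω) : C(Ω, F) :=
  ⟨Ω.domRestrict f, hf.domRestrict⟩

/-! ### Measures on the domain: `𝓜(Ω)` is `SignedMeasure Ω`, and the space of vector valued
measures `𝓜(Ω)^d` is `VectorMeasure Ω (Rd d)`. -/

/-- The duality pairing of `𝓜(Ω)` with functions. -/
def pair {d : ℕ} {Ω : Set (Rd d)} (ρ : SignedMeasure Ω) (φ : Ω → ℝ) : ℝ :=
  ρ.integral φ (ContinuousLinearMap.mul ℝ ℝ)

/-- The duality pairing of `𝓜(Ω)^d` with vector fields. -/
def pairV {d : ℕ} {Ω : Set (Rd d)} (m : VectorMeasure Ω (Rd d)) (b : Ω → Rd d) : ℝ :=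
  m.integral b (innerSL ℝ)

/-- The total variation norm of a signed or vector valued measure. -/
def tvNorm {d : ℕ} {Ω : Set (Rd d)} {F : Type*} [NormedAddCommGroup F]
    (μ : VectorMeasure Ω F) : ℝ :=
  (μ.variation univ).toReal

/-- Lebesgue measure on `Ω`. -/
def lebesgueOn {d : ℕ} (Ω : Set (Rd d)) : Measure Ω :=
  (volume : Measure (Rd d)).comap Subtype.val

/-- The signed or vector valued measure with density `f` with respect to Lebesgue measure. -/
def ofDensity {d : ℕ} (Ω : Set (Rd d)) {F : Type*} [NormedAddCommGroup F] [NormedSpace ℝ F]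
    (f : Rd d → F) : VectorMeasure Ω F :=
  (lebesgueOn Ω).withDensityᵥ (fun x => f x)

/-- The action `A(ρ, m)`, by the Benamou-Brenier formula. -/
def action {d : ℕ} {Ω : Set (Rd d)} (ρ : SignedMeasure Ω) (m : VectorMeasure Ω (Rd d)) : EReal :=
  ⨆ (a : C(Ω, ℝ)) (b : C(Ω, Rd d)) (_ : ∀ x, a x + ‖b x‖ ^ 2 / 2 ≤ 0),
    ((pair ρ a + pairV m b : ℝ) : EReal)

/-- `A⋆(ρ, b) = ½ ⟨ρ, |b|²⟩`. -/
def actionStar {d : ℕ} {Ω : Set (Rd d)} (ρ : SignedMeasure Ω) (b : Ω → Rd d) : ℝ :=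
  1 / 2 * pair ρ (fun x => ‖b x‖ ^ 2)

/-! ### Finite dimensional models of dynamical optimal transport -/

/-- The data of a model: the spaces for the density and for the momentum, the cone of
nonnegative densities, the action and the derivation. Their laws are in `Lawful`. -/
structure Model where
  X : Type
  Y : Type
  [acgX : AddCommGroup X]
  [modX : Module ℝ X]
  [acgY : AddCommGroup Y]
  [modY : Module ℝ Y]
  pos : Set X
  A : X → Y → ENNReal
  Div : Y →ₗ[ℝ] X

attribute [instance] Model.acgX Model.modX Model.acgY Model.modY

/-- The laws of a finite dimensional model of dynamical optimal transport. -/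
structure Model.Lawful (𝒟 : Model) : Prop where
  finiteDimensional_X : FiniteDimensional ℝ 𝒟.X
  finiteDimensional_Y : FiniteDimensional ℝ 𝒟.Y
  cone : ∀ P ∈ 𝒟.pos, ∀ r : ℝ, 0 < r → r • P ∈ 𝒟.pos
  proper : ∃ P M, 𝒟.A P M ≠ ⊤
  convex : ∀ (P₁ P₂ : 𝒟.X) (M₁ M₂ : 𝒟.Y) (s t : ℝ), 0 ≤ s → 0 ≤ t → s + t = 1 →
    𝒟.A (s • P₁ + t • P₂) (s • M₁ + t • M₂) ≤
      ENNReal.ofReal s * 𝒟.A P₁ M₁ + ENNReal.ofReal t * 𝒟.A P₂ M₂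
  homogeneous_left : ∀ (P : 𝒟.X) (M : 𝒟.Y) (r : ℝ), 0 < r →
    𝒟.A (r • P) M = ENNReal.ofReal r⁻¹ * 𝒟.A P M
  homogeneous_right : ∀ (P : 𝒟.X) (M : 𝒟.Y) (r : ℝ), r ≠ 0 →
    𝒟.A P (r • M) = ENNReal.ofReal (r ^ 2) * 𝒟.A P M
  zero_right : ∀ P ∈ 𝒟.pos, 𝒟.A P 0 = 0
  antitone : ∀ P₁ ∈ 𝒟.pos, ∀ P₂ ∈ 𝒟.pos, ∀ M : 𝒟.Y, 𝒟.A (P₁ + P₂) M ≤ 𝒟.A P₁ M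

/-- The Legendre transform of the action with respect to its second variable. -/
def Model.AStar (𝒟 : Model) (P : 𝒟.X) (B : 𝒟.Y → ℝ) : EReal :=
  ⨆ M : 𝒟.Y, ((B M : ℝ) : EReal) - ((𝒟.A P M : ENNReal) : EReal)

/-- The data of the reconstruction and sampling operators between a model and the measures on
`Ω`. The sampling operator `SY` for momenta is defined on the measures with a continuous density,
and such a measure is identified with its density. -/
structure Operators {d : ℕ} (Ω : Set (Rd d)) (𝒟 : Model) where
  RCE : 𝒟.X →ₗ[ℝ] SignedMeasure Ω
  RA : 𝒟.X →ₗ[ℝ] SignedMeasure Ω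
  RY : 𝒟.Y →ₗ[ℝ] VectorMeasure Ω (Rd d)
  SX : SignedMeasure Ω →ₗ[ℝ] 𝒟.X
  SY : C(Ω, Rd d) →ₗ[ℝ] 𝒟.Y

/-- The adjoint `RYᵀ b`, a linear form on the space of momenta: `M ↦ ⟨RY M, b⟩`. -/
def Operators.RYAdjoint {d : ℕ} {Ω : Set (Rd d)} {𝒟 : Model} (O : Operators Ω 𝒟)
    (b : Ω → Rd d) : 𝒟.Y → ℝ :=
  fun M => pairV (O.RY M) b

/-- The step size `σ ∈ S` tends to `0`. -/
def stepToZero (S : Set ℝ) : Filter S := comap (fun σ : S => (σ : ℝ)) (𝓝 0)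

/-- The family of models `𝒟 σ`, indexed by the step sizes `σ ∈ S`, is adapted to the compact
convex domain `Ω`, with the reconstruction and sampling operators `O σ`. -/
structure IsAdaptedWith {d : ℕ} (Ω : Set (Rd d)) {S : Set ℝ} (𝒟 : S → Model)
    (O : ∀ σ, Operators Ω (𝒟 σ)) : Prop where
  RCE_nonneg : ∀ σ, ∀ P ∈ (𝒟 σ).pos, 0 ≤ (O σ).RCE P
  RA_nonneg : ∀ σ, ∀ P ∈ (𝒟 σ).pos, 0 ≤ (O σ).RA P
  SX_nonneg : ∀ σ, ∀ ρ : SignedMeasure Ω, 0 ≤ ρ → (O σ).SX ρ ∈ (𝒟 σ).pos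
  /-- reconstruction is asymptotically the inverse of sampling, weakly -/
  reconstruction_sampling : ∀ ρ : SignedMeasure Ω, 0 ≤ ρ → ∀ φ : C(Ω, ℝ),
    Tendsto (fun σ => pair ((O σ).RCE ((O σ).SX ρ)) φ) (stepToZero S) (𝓝 (pair ρ φ))
  /-- the reconstructions of the density are asymptotically equivalent -/
  reconstructions_equivalent : ∀ B : Set (Rd d → ℝ), IsBoundedInC 1 Ω B →
    ∃ ε : S → ℝ, Tendsto ε (stepToZero S) (𝓝 0) ∧ ∀ σ, ∀ φ ∈ B, ∀ P : (𝒟 σ).X,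
      pair ((O σ).RCE P - (O σ).RA P) (fun x => φ x) ≤ ε σ * tvNorm ((O σ).RCE P)
  /-- asymptotic commutation of reconstruction and derivation -/
  reconstruction_derivation : ∀ B : Set (Rd d → ℝ), IsBoundedInC 2 Ω B →
    ∃ ε : S → ℝ, Tendsto ε (stepToZero S) (𝓝 0) ∧ ∀ σ, ∀ M : (𝒟 σ).Y, ∀ φ ∈ B,
      |pair ((O σ).RCE ((𝒟 σ).Div M)) (fun x => φ x) +
          pairV ((O σ).RY M) (fun x => gradientWithin φ Ω x)| ≤ ε σ * tvNorm ((O σ).RY M)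
  /-- exact commutation of sampling and derivation, for no-flux `C¹` momenta -/
  sampling_derivation : ∀ (m : Rd d → Rd d) (hm : ContDiffOn ℝ 1 m Ω),
    (∀ x ∈ frontier Ω, ∀ n, IsOutwardNormal Ω x n → ⟪m x, n⟫ = 0) →
    ∀ σ, (O σ).SX (ofDensity Ω (divergenceWithin Ω m)) =
      (𝒟 σ).Div ((O σ).SY (restrictC m hm.continuousOn))
  /-- one-sided estimates for the Legendre transform of the action, first part -/
  actionStar_le : ∀ B : Set (Rd d → Rd d), IsBoundedInC 1 Ω B →
    ∃ ε : S → ℝ, Tendsto ε (stepToZero S) (𝓝 0) ∧ ∀ b ∈ B, ∀ σ, ∀ P : (𝒟 σ).X,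
      (𝒟 σ).AStar P ((O σ).RYAdjoint (fun x => b x)) ≤
        ((actionStar ((O σ).RA P) (fun x => b x) + ε σ * tvNorm ((O σ).RA P) : ℝ) : EReal)
  /-- one-sided estimates for the Legendre transform of the action, second part -/
  actionStar_le_sup : ∃ C : ℝ, 1 ≤ C ∧ ∀ (b : C(Ω, Rd d)) (σ : S) (P : (𝒟 σ).X),
    (𝒟 σ).AStar P ((O σ).RYAdjoint b) ≤
      ((C / 2 * tvNorm ((O σ).RA P) * (⨆ x, ‖b x‖) ^ 2 : ℝ) : EReal)
  /-- asymptotic one-sided estimate for the action on smooth densities -/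
  action_sampling_le : ∀ (B : Set (Rd d → ℝ)) (B' : Set (Rd d → Rd d)),
    IsBoundedInC 1 Ω B → (∃ δ : ℝ, 0 < δ ∧ ∀ ρ ∈ B, ∀ x ∈ Ω, δ ≤ ρ x) → IsBoundedInC 1 Ω B' →
    ∃ ε : S → ℝ, Tendsto ε (stepToZero S) (𝓝 0) ∧
      ∀ ρ ∈ B, ∀ m ∈ B', ∀ (hm : ContinuousOn m Ω) (σ : S),
        (((𝒟 σ).A ((O σ).SX (ofDensity Ω ρ)) ((O σ).SY (restrictC m hm)) : ENNReal) : EReal) ≤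
          action (ofDensity Ω ρ) (ofDensity Ω m) + ((ε σ : ℝ) : EReal)
  /-- controllability -/
  controllability : ∃ (ε : S → ℝ) (w : ℝ → ℝ), Tendsto ε (stepToZero S) (𝓝 0) ∧
    Continuous w ∧ w 0 = 0 ∧ ∀ (x y : Ω) (σ : S), ∃ P ∈ (𝒟 σ).pos, ∃ M₁ M₂ : (𝒟 σ).Y,
      (𝒟 σ).Div M₁ = P - (O σ).SX (VectorMeasure.dirac x 1) ∧
      (𝒟 σ).Div M₂ = P - (O σ).SX (VectorMeasure.dirac y 1) ∧
      (((𝒟 σ).A P M₁ : ENNReal) : EReal) ≤ ((w (dist x y) + ε σ : ℝ) : EReal) ∧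
      (((𝒟 σ).A P M₂ : ENNReal) : EReal) ≤ ((w (dist x y) + ε σ : ℝ) : EReal)

/-! ### Meshes -/

/-- The interface `(K|L)` of two cells. -/
def interface {d : ℕ} (K L : Set (Rd d)) : Set (Rd d) := closure K ∩ closure L

/-- Two distinct cells are neighbours if their interface has positive `(d-1)`-dimensional
Hausdorff measure, normalized so that it is the Lebesgue measure on hyperplanes. -/
def Neighbours {d : ℕ} (K L : Set (Rd d)) : Prop := K ≠ L ∧ 0 < μHE[d - 1] (interface K L)

/-- An admissible mesh of `Ω`: a finite partition into (Borel) convex cells, with a point in the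
interior of each cell, such that the segment that joins the points of two neighbouring cells is
orthogonal to their interface. Interfaces are automatically convex and contained in hyperplanes. -/
structure Mesh {d : ℕ} (Ω : Set (Rd d)) where
  ι : Type
  [fintype : Fintype ι]
  cell : ι → Set (Rd d)
  center : ι → Rd d
  iUnion_cell : ⋃ K, cell K = Ω
  disjoint_cell : Pairwise fun K L => Disjoint (cell K) (cell L)
  convex_cell : ∀ K, Convex ℝ (cell K)
  measurableSet_cell : ∀ K, MeasurableSet (cell K)
  center_mem : ∀ K, center K ∈ interior (cell K)
  orthogonal : ∀ K L, Neighbours (cell K) (cell L) →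
    ∀ p ∈ interface (cell K) (cell L), ∀ q ∈ interface (cell K) (cell L),
      ⟪center L - center K, p - q⟫ = 0

attribute [instance] Mesh.fintype

namespace Mesh

variable {d : ℕ} {Ω : Set (Rd d)} (𝒯 : Mesh Ω)

/-- The volume `|K|` of a cell. -/
def vol (K : 𝒯.ι) : ℝ := (volume : Measure (Rd d)).real (𝒯.cell K)

/-- The interface `(K|L)`. -/
def face (K L : 𝒯.ι) : Set (Rd d) := interface (𝒯.cell K) (𝒯.cell L)

/-- The area `|(K|L)|` of an interface. -/
def area (K L : 𝒯.ι) : ℝ := (μHE[d - 1] : Measure (Rd d)).real (𝒯.face K L)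

/-- `K ∼ L`. -/
def Adj (K L : 𝒯.ι) : Prop := Neighbours (𝒯.cell K) (𝒯.cell L)

/-- The distance `d_{KL}` between the points of two cells. -/
def gap (K L : 𝒯.ι) : ℝ := dist (𝒯.center K) (𝒯.center L)

/-- The unit vector `n_{KL}` from the point of `K` to the point of `L`. -/
def normal (K L : 𝒯.ι) : Rd d := (𝒯.gap K L)⁻¹ • (𝒯.center L - 𝒯.center K)

open scoped Classical in
/-- The neighbours of a cell. -/
def nbrs (K : 𝒯.ι) : Finset 𝒯.ι := {L | 𝒯.Adj K L}

lemma face_comm (K L : 𝒯.ι) : 𝒯.face K L = 𝒯.face L K := inter_comm _ _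

lemma adj_comm (K L : 𝒯.ι) : 𝒯.Adj K L ↔ 𝒯.Adj L K := by
  unfold Adj Neighbours interface
  rw [inter_comm, ne_comm]

lemma normal_swap (K L : 𝒯.ι) : 𝒯.normal L K = -𝒯.normal K L := by
  unfold normal gap
  rw [dist_comm, ← smul_neg, neg_sub]

lemma center_mem_domain (K : 𝒯.ι) : 𝒯.center K ∈ Ω := by
  exact 𝒯.iUnion_cell.subset (mem_iUnion.2 ⟨K, interior_subset (𝒯.center_mem K)⟩)

/-- The `(d-1)`-dimensional Hausdorff measure of the interface `(K|L)`, as a measure on `Ω`. -/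
def faceMeasure (K L : 𝒯.ι) : Measure Ω :=
  ((μHE[d - 1] : Measure (Rd d)).comap Subtype.val).restrict (Subtype.val ⁻¹' 𝒯.face K L)

/-- Momenta: families `(M_{KL})` on the edges with `M_{KL} = - M_{LK}`, extended by zero to all
pairs of cells. -/
def momenta : Submodule ℝ (𝒯.ι → 𝒯.ι → ℝ) where
  carrier := {M | (∀ K L, M K L = -M L K) ∧ ∀ K L, ¬ 𝒯.Adj K L → M K L = 0}
  zero_mem' := by simp
  add_mem' := by
    rintro M N ⟨h1, h2⟩ ⟨h3, h4⟩
    refine ⟨fun K L => ?_, fun K L h => ?_⟩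
    · simp only [Pi.add_apply]; rw [h1, h3]; ring
    · simp [h2 K L h, h4 K L h]
  smul_mem' := by
    rintro c M ⟨h1, h2⟩
    refine ⟨fun K L => ?_, fun K L h => ?_⟩
    · simp only [Pi.smul_apply, smul_eq_mul]; rw [h1]; ring
    · simp [h2 K L h]

/-- The discrete divergence. -/
def discreteDiv : 𝒯.momenta →ₗ[ℝ] (𝒯.ι → ℝ) where
  toFun M := fun K => ∑ L ∈ 𝒯.nbrs K, 𝒯.area K L / 𝒯.vol K * M.1 K L
  map_add' M N := by
    ext K
    simp [mul_add, Finset.sum_add_distrib]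
  map_smul' c M := by
    ext K
    simp only [Submodule.coe_smul, Pi.smul_apply, smul_eq_mul, RingHom.id_apply, Finset.mul_sum]
    exact Finset.sum_congr rfl fun L _ => by ring

open scoped Classical in
/-- The discrete action: the sum over the edges of `M_{KL}² / (4 θ(P_K, P_L)) |(K|L)| d_{KL}` if
`P` is nonnegative, and `+∞` otherwise. By the conventions for division in `[0, ∞]`, the quotient
is `0` if `M_{KL} = θ(P_K, P_L) = 0`, and `+∞` if only `θ(P_K, P_L) = 0`. -/
def discreteAction (θ : ℝ → ℝ → ℝ) (P : 𝒯.ι → ℝ) (M : 𝒯.momenta) : ENNReal :=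
  if ∀ K, 0 ≤ P K then
    ∑ K, ∑ L ∈ 𝒯.nbrs K,
      ENNReal.ofReal (M.1 K L ^ 2) / ENNReal.ofReal (4 * θ (P K) (P L)) *
        ENNReal.ofReal (𝒯.area K L * 𝒯.gap K L)
  else ⊤

/-- The finite volume model of dynamical optimal transport on the mesh, for the mean `θ`. -/
def model (θ : ℝ → ℝ → ℝ) : Model where
  X := 𝒯.ι → ℝ
  Y := 𝒯.momenta
  pos := {P | ∀ K, 0 ≤ P K}
  A := 𝒯.discreteAction θ
  Div := 𝒯.discreteDiv

/-- `∑ K, P_K |K| δ_{x_K}`. -/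
def RCE : (𝒯.ι → ℝ) →ₗ[ℝ] SignedMeasure Ω where
  toFun P := ∑ K, (P K * 𝒯.vol K) •
    VectorMeasure.dirac (⟨𝒯.center K, 𝒯.center_mem_domain K⟩ : Ω) (1 : ℝ)
  map_add' P Q := by simp [add_mul, add_smul, Finset.sum_add_distrib]
  map_smul' c P := by simp [Finset.smul_sum, smul_smul, mul_assoc]

/-- `∑ K, P_K 1_K`, as a density with respect to Lebesgue measure. -/
def RA : (𝒯.ι → ℝ) →ₗ[ℝ] SignedMeasure Ω where
  toFun P := ∑ K, P K •
    ((lebesgueOn Ω).restrict (Subtype.val ⁻¹' 𝒯.cell K)).withDensityᵥ (fun _ => (1 : ℝ))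
  map_add' P Q := by simp [add_smul, Finset.sum_add_distrib]
  map_smul' c P := by simp [Finset.smul_sum, smul_smul]

/-- `½ ∑_{(K,L)} M_{KL} d_{KL} n_{KL} 1_{(K|L)}`, as a `(d-1)`-dimensional measure. -/
def RY : 𝒯.momenta →ₗ[ℝ] VectorMeasure Ω (Rd d) where
  toFun M := ∑ K, ∑ L ∈ 𝒯.nbrs K, (1 / 2 * M.1 K L * 𝒯.gap K L) •
    (𝒯.faceMeasure K L).withDensityᵥ (fun _ => 𝒯.normal K L)
  map_add' M N := by simp [mul_add, add_mul, add_smul, Finset.sum_add_distrib]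
  map_smul' c M := by
    simp only [Finset.smul_sum, smul_smul, Submodule.coe_smul, Pi.smul_apply, smul_eq_mul,
      RingHom.id_apply]
    refine Finset.sum_congr rfl fun K _ => Finset.sum_congr rfl fun L _ => ?_
    congr 1
    ring

/-- `(SX ρ)_K = ρ(K) / |K|`. -/
def SX : SignedMeasure Ω →ₗ[ℝ] (𝒯.ι → ℝ) where
  toFun ρ := fun K => ρ (Subtype.val ⁻¹' 𝒯.cell K) / 𝒯.vol K
  map_add' ρ μ := by
    ext K
    simp [add_div]
  map_smul' c ρ := by
    ext K
    simp [mul_div_assoc]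

open scoped Classical in
/-- The mean flux of a continuous vector field through the interfaces. -/
def flux (m : C(Ω, Rd d)) (K L : 𝒯.ι) : ℝ :=
  if 𝒯.Adj K L then ⨍ x, ⟪m x, 𝒯.normal K L⟫ ∂(𝒯.faceMeasure K L) else 0

lemma faceMeasure_comm (K L : 𝒯.ι) : 𝒯.faceMeasure K L = 𝒯.faceMeasure L K := by
  unfold faceMeasure
  rw [𝒯.face_comm]

lemma flux_mem (m : C(Ω, Rd d)) : 𝒯.flux m ∈ 𝒯.momenta := by
  refine ⟨fun K L => ?_, fun K L h => by simp [flux, h]⟩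
  unfold flux
  rw [𝒯.adj_comm L K, 𝒯.faceMeasure_comm L K, 𝒯.normal_swap K L]
  split_ifs
  · simp only [inner_neg_right, average_eq, integral_neg, smul_neg, neg_neg]
  · simp

lemma average_inner_add (m m' : C(Ω, Rd d)) (hΩ : IsCompact Ω) (K L : 𝒯.ι) (n : Rd d) :
    ⨍ x, ⟪(m + m') x, n⟫ ∂(𝒯.faceMeasure K L) =
      ⨍ x, ⟪m x, n⟫ ∂(𝒯.faceMeasure K L) + ⨍ x, ⟪m' x, n⟫ ∂(𝒯.faceMeasure K L) := by
  have : CompactSpace Ω := isCompact_iff_compactSpace.1 hΩ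
  simp only [average_eq]
  by_cases h : 𝒯.faceMeasure K L univ = ⊤
  · simp [Measure.real, h]
  · have : IsFiniteMeasure (𝒯.faceMeasure K L) := ⟨lt_top_iff_ne_top.2 h⟩
    have hint : ∀ f : C(Ω, Rd d), Integrable (fun x => ⟪f x, n⟫) (𝒯.faceMeasure K L) := fun f =>
      (f.continuous.inner continuous_const).integrable_of_hasCompactSupport
        (HasCompactSupport.of_compactSpace _)
    rw [← smul_add, ← integral_add (hint m) (hint m')]
    simp [inner_add_left]

/-- `(SY m)_{KL}` is the mean of `m · n_{KL}` over the interface `(K|L)`. -/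
def SY (hΩ : IsCompact Ω) : C(Ω, Rd d) →ₗ[ℝ] 𝒯.momenta where
  toFun m := ⟨𝒯.flux m, 𝒯.flux_mem m⟩
  map_add' m m' := by
    ext K L
    by_cases h : 𝒯.Adj K L
    · simpa [flux, h] using 𝒯.average_inner_add m m' hΩ K L (𝒯.normal K L)
    · simp [flux, h]
  map_smul' c m := by
    ext K L
    by_cases h : 𝒯.Adj K L
    · simp only [flux, h, if_true, average_eq, ContinuousMap.smul_apply, real_inner_smul_left,
        integral_const_mul, smul_eq_mul, RingHom.id_apply, Submodule.coe_smul, Pi.smul_apply]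
      ring
    · simp [flux, h]

/-- The reconstruction and sampling operators of the finite volume discretization. -/
def operators (hΩ : IsCompact Ω) (θ : ℝ → ℝ → ℝ) : Operators Ω (𝒯.model θ) where
  RCE := 𝒯.RCE
  RA := 𝒯.RA
  RY := 𝒯.RY
  SX := 𝒯.SX
  SY := 𝒯.SY hΩ

end Mesh

/-- Uniform regularity of a family of meshes, indexed by the step sizes `σ ∈ S`. -/
def UniformlyRegular {d : ℕ} {Ω : Set (Rd d)} {S : Set ℝ} (𝒯 : S → Mesh Ω) : Prop :=
  ∃ c : ℝ, 0 < c ∧ ∀ σ : S,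
    (∀ K, Metric.diam ((𝒯 σ).cell K) ≤ c⁻¹ * σ) ∧
    (∀ K, Metric.ball ((𝒯 σ).center K) (c * σ) ⊆ (𝒯 σ).cell K) ∧
    ∀ K L, (𝒯 σ).Adj K L → c * (σ : ℝ) ^ (d - 1) ≤ (𝒯 σ).area K L

/-- The isotropy condition for a family of meshes. -/
def Isotropic {d : ℕ} {Ω : Set (Rd d)} {S : Set ℝ} (𝒯 : S → Mesh Ω) : Prop :=
  ∃ ε : S → ℝ, Tendsto ε (stepToZero S) (𝓝 0) ∧ ∀ (σ : S) (K : (𝒯 σ).ι) (v : Rd d),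
    1 / (2 * (𝒯 σ).vol K) *
        ∑ L ∈ (𝒯 σ).nbrs K, (𝒯 σ).area K L * (𝒯 σ).gap K L * ⟪v, (𝒯 σ).normal K L⟫ ^ 2 ≤
      (1 + ε σ) * ‖v‖ ^ 2

/-- `θ` is an admissible symmetric mean on `[0, ∞) × [0, ∞)`; smoothness is required in the
interior of the quadrant and continuity up to its boundary. -/
structure IsAdmissibleMean (θ : ℝ → ℝ → ℝ) : Prop where
  nonneg : ∀ a b, 0 ≤ a → 0 ≤ b → 0 ≤ θ a b
  continuousOn : ContinuousOn (fun p : ℝ × ℝ => θ p.1 p.2) (Ici 0 ×ˢ Ici 0)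
  smooth : ContDiffOn ℝ ∞ (fun p : ℝ × ℝ => θ p.1 p.2) (Ioi 0 ×ˢ Ioi 0)
  homogeneous : ∀ r a b, 0 < r → 0 ≤ a → 0 ≤ b → θ (r * a) (r * b) = r * θ a b
  symmetric : ∀ a b, 0 ≤ a → 0 ≤ b → θ a b = θ b a
  concave : ConcaveOn ℝ (Ici 0 ×ˢ Ici 0) (fun p : ℝ × ℝ => θ p.1 p.2)
  one_one : θ 1 1 = 1

end OptimalTransport

end

/-! Apart from the divergence identity and controllability, every estimate is a sum over cells or
ordered edges of an elementary local inequality, and uniform regularity makes the local errors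
`O(σ)`. Disjoint balls of radius `cσ` inside the cells bound the number of neighbours, whence `∑_L
|(K|L)| d_KL ≤ const · |K|` (`sum_area_mul_gap_le`). The total variation norms on the right-hand
sides are bounded below by testing the measures on disjoint sets: the cells for densities
(`sum_abs_le_tvNorm_RCE`, `sum_abs_le_tvNorm_RA`), and the interfaces stripped of all third cells
for momenta (`sum_abs_le_tvNorm_RY`).

Means. A concave 1-homogeneous function is superadditive. Together with nonnegativity and symmetry
this makes `θ` monotone and at most the arithmetic mean, and it makes `m² / θ` jointly convex, which
gives the laws of the model.

Consistency. Sampling and reconstructing densities moves mass only inside cells, by `O(σ)`. For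
momenta, summation by parts reduces the claim to comparing `φ(x_L) - φ(x_K)` with `d_KL ∇φ · n_KL`
on the interface, that is, to Taylor's formula.

Actions. Maximizing over each `M_KL` separately bounds the discrete Legendre transform by `∑ θ(P_K,
P_L) β_KL² |(K|L)| d_KL / 4`, with `β_KL` the mean normal component of the field (`AStar_le`).
Replacing `θ` by the arithmetic mean and freezing the field at `x_K` leaves exactly the quadratic
form that isotropy controls. For smooth densities bounded below the same freezing applies to the
primal action, and the continuous action is bounded below by testing its supremum at `b = m / ρ`.

Exact divergence. A closed cell is a convex body whose boundary is made of flat interfaces and of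
points of `∂Ω`, where the field is tangential. The divergence theorem for such a body
(`integral_lineDivergence`) comes from integrating by parts against a cutoff built from the gauge of
the body. The gradient of the cutoff lives in a thin layer; over a flat face the layer is a
truncated cone on which the gradient of the gauge is constant, and over the rest the integrand is
small by tangency. Admissibility enters only here, to identify `n_KL` with the normal of the
interface (`normal_eq`).

Controllability. Since a generic segment avoids null sets of dimension `d - 1`, the cells near the
segment from `x` to `y` are connected through interfaces of positive area (`reachable_cellGraph`). A
path through them has `n` cells with `nσ = O(|x - y| + σ)` by packing. Spreading either end mass
uniformly over the path costs `O((nσ)²)` (`exists_momentum_of_isPath`), and both ends can be spread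
to the same density. -/

namespace OptimalTransport

/-! ### Means -/

namespace IsAdmissibleMean

variable {θ : ℝ → ℝ → ℝ} (hθ : IsAdmissibleMean θ)

include hθ

/-- Concavity at the midpoint, with the factor `1/2` removed by homogeneity. The other inequalities
for the mean follow from this one. -/
lemma add_le {a b a' b' : ℝ} (ha : 0 ≤ a) (hb : 0 ≤ b) (ha' : 0 ≤ a') (hb' : 0 ≤ b') :
    θ a b + θ a' b' ≤ θ (a + a') (b + b') := by
  have h := hθ.concave.2 (mk_mem_prod (mem_Ici.2 ha) (mem_Ici.2 hb))
    (mk_mem_prod (mem_Ici.2 ha') (mem_Ici.2 hb')) (show (0 : ℝ) ≤ 1 / 2 by norm_num)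
    (show (0 : ℝ) ≤ 1 / 2 by norm_num) (by norm_num)
  have h2 := hθ.homogeneous (1 / 2) (a + a') (b + b') (by norm_num) (by positivity) (by positivity)
  simp only [Prod.smul_mk, Prod.mk_add_mk, smul_eq_mul, ← mul_add, h2] at h
  linarith

lemma apply_self {t : ℝ} (ht : 0 ≤ t) : θ t t = t := by
  rcases ht.eq_or_lt with rfl | ht
  · have := hθ.homogeneous 2 0 0 (by norm_num) le_rfl le_rfl
    simp only [mul_zero] at this
    linarith
  · simpa [hθ.one_one] using hθ.homogeneous t 1 1 ht zero_le_one zero_le_one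

lemma mono_add {a b a' b' : ℝ} (ha : 0 ≤ a) (hb : 0 ≤ b) (ha' : 0 ≤ a') (hb' : 0 ≤ b') :
    θ a b ≤ θ (a + a') (b + b') :=
  (le_add_of_nonneg_right (hθ.nonneg a' b' ha' hb')).trans (hθ.add_le ha hb ha' hb')

lemma le_of_le {a b r : ℝ} (hr : 0 ≤ r) (ha : r ≤ a) (hb : r ≤ b) : r ≤ θ a b := by
  have := hθ.mono_add hr hr (sub_nonneg.2 ha) (sub_nonneg.2 hb)
  rwa [hθ.apply_self hr, add_sub_cancel, add_sub_cancel] at this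

/-- Superadditivity applied to `(a, b)` and its reflection `(b, a)`, whose sum lies on the diagonal.
-/
lemma le_half_add {a b : ℝ} (ha : 0 ≤ a) (hb : 0 ≤ b) : θ a b ≤ (a + b) / 2 := by
  have := hθ.add_le ha hb hb ha
  rw [add_comm b a, hθ.apply_self (add_nonneg ha hb), hθ.symmetric b a hb ha] at this
  linarith

end IsAdmissibleMean

/-- This is the Cauchy-Schwarz inequality behind the convexity of `m² / r`, with `q` in the role of
`m² / r`. Writing it with products keeps the case `r = 0` inside the statement. -/
lemma sq_convex_comb_le {s t m₁ m₂ q₁ q₂ r₁ r₂ : ℝ} (hs : 0 ≤ s) (ht : 0 ≤ t) (hq₁ : 0 ≤ q₁)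
    (hq₂ : 0 ≤ q₂) (hr₁ : 0 ≤ r₁) (hr₂ : 0 ≤ r₂) (h₁ : m₁ ^ 2 = q₁ * r₁)
    (h₂ : m₂ ^ 2 = q₂ * r₂) :
    (s * m₁ + t * m₂) ^ 2 ≤ (s * q₁ + t * q₂) * (s * r₁ + t * r₂) := by
  have key : 2 * (m₁ * m₂) ≤ q₁ * r₂ + q₂ * r₁ := by
    refine le_of_abs_le (abs_le_of_sq_le_sq ?_ (by positivity))
    have : (2 * (m₁ * m₂)) ^ 2 = 4 * ((q₁ * r₁) * (q₂ * r₂)) := by rw [← h₁, ← h₂]; ring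
    rw [this]
    nlinarith [sq_nonneg (q₁ * r₂ - q₂ * r₁)]
  have := mul_le_mul_of_nonneg_left key (mul_nonneg hs ht)
  calc (s * m₁ + t * m₂) ^ 2 = s ^ 2 * m₁ ^ 2 + t ^ 2 * m₂ ^ 2 + s * t * (2 * (m₁ * m₂)) := by ring
    _ ≤ s ^ 2 * (q₁ * r₁) + t ^ 2 * (q₂ * r₂) + s * t * (q₁ * r₂ + q₂ * r₁) := by
      rw [h₁, h₂]; gcongr
    _ = (s * q₁ + t * q₂) * (s * r₁ + t * r₂) := by ring

lemma ofReal_sq_div_ofReal {m r : ℝ} (hr : 0 ≤ r) (h : r = 0 → m = 0) :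
    ENNReal.ofReal (m ^ 2) / ENNReal.ofReal r = ENNReal.ofReal (m ^ 2 / r) := by
  rcases hr.eq_or_lt with rfl | hr
  · simp [h rfl]
  · rw [ENNReal.ofReal_div_of_pos hr]

/-- Where both quotients on the right are finite this is the joint convexity of `m² / r`, combined
with monotonicity in `r`. An infinite quotient makes the right side infinite because `s` and `t` are
positive; with a zero weight, `0 * ⊤ = 0` would spoil the argument. -/
lemma ofReal_sq_div_ofReal_convex {s t m₁ m₂ r r₁ r₂ : ℝ} (hs : 0 < s) (ht : 0 < t)
    (hr₁ : 0 ≤ r₁) (hr₂ : 0 ≤ r₂) (hr : s * r₁ + t * r₂ ≤ r) :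
    ENNReal.ofReal ((s * m₁ + t * m₂) ^ 2) / ENNReal.ofReal r ≤
      ENNReal.ofReal s * (ENNReal.ofReal (m₁ ^ 2) / ENNReal.ofReal r₁) +
        ENNReal.ofReal t * (ENNReal.ofReal (m₂ ^ 2) / ENNReal.ofReal r₂) := by
  by_cases h₁ : r₁ = 0 → m₁ = 0
  swap
  · push Not at h₁
    have : ENNReal.ofReal (m₁ ^ 2) ≠ 0 := by simpa using h₁.2
    simp [h₁.1, ENNReal.div_zero this, hs, ENNReal.mul_top]
  by_cases h₂ : r₂ = 0 → m₂ = 0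
  swap
  · push Not at h₂
    have : ENNReal.ofReal (m₂ ^ 2) ≠ 0 := by simpa using h₂.2
    simp [h₂.1, ENNReal.div_zero this, ht, ENNReal.mul_top]
  have hr0 : 0 ≤ s * r₁ + t * r₂ := by positivity
  rw [ofReal_sq_div_ofReal hr₁ h₁, ofReal_sq_div_ofReal hr₂ h₂, ofReal_sq_div_ofReal (hr0.trans hr),
    ← ENNReal.ofReal_mul hs.le, ← ENNReal.ofReal_mul ht.le,
    ← ENNReal.ofReal_add (by positivity) (by positivity)]
  · refine ENNReal.ofReal_le_ofReal (div_le_of_le_mul₀ (hr0.trans hr) (by positivity) ?_)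
    refine (sq_convex_comb_le hs.le ht.le (by positivity) (by positivity) hr₁ hr₂ ?_ ?_).trans
      (mul_le_mul_of_nonneg_left hr (by positivity))
    · rcases eq_or_ne r₁ 0 with h | h
      · simp [h, h₁ h]
      · field_simp
    · rcases eq_or_ne r₂ 0 with h | h
      · simp [h, h₂ h]
      · field_simp
  · intro h
    have e₁ : r₁ = 0 := by nlinarith [mul_nonneg hs.le hr₁, mul_nonneg ht.le hr₂]
    have e₂ : r₂ = 0 := by nlinarith [mul_nonneg hs.le hr₁, mul_nonneg ht.le hr₂]
    simp [h₁ e₁, h₂ e₂]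

/-! ### The laws of the discrete model -/

namespace Mesh

variable {d : ℕ} {Ω : Set (Rd d)} (𝒯 : Mesh Ω) {θ : ℝ → ℝ → ℝ}

lemma discreteAction_of_nonneg {P : 𝒯.ι → ℝ} (hP : ∀ K, 0 ≤ P K) (M : 𝒯.momenta) :
    𝒯.discreteAction θ P M = ∑ K, ∑ L ∈ 𝒯.nbrs K,
      ENNReal.ofReal (M.1 K L ^ 2) / ENNReal.ofReal (4 * θ (P K) (P L)) *
        ENNReal.ofReal (𝒯.area K L * 𝒯.gap K L) := by
  simp only [discreteAction, if_pos hP]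

lemma discreteAction_of_not_nonneg {P : 𝒯.ι → ℝ} (hP : ¬ ∀ K, 0 ≤ P K) (M : 𝒯.momenta) :
    𝒯.discreteAction θ P M = ⊤ := by
  simp only [discreteAction, if_neg hP]

lemma discreteAction_zero {P : 𝒯.ι → ℝ} (hP : ∀ K, 0 ≤ P K) : 𝒯.discreteAction θ P 0 = 0 := by
  simp [discreteAction_of_nonneg 𝒯 hP]

lemma discreteAction_convex (hθ : IsAdmissibleMean θ) (P₁ P₂ : 𝒯.ι → ℝ) (M₁ M₂ : 𝒯.momenta)
    (s t : ℝ) (hs : 0 ≤ s) (ht : 0 ≤ t) (hst : s + t = 1) :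
    𝒯.discreteAction θ (s • P₁ + t • P₂) (s • M₁ + t • M₂) ≤
      ENNReal.ofReal s * 𝒯.discreteAction θ P₁ M₁ +
        ENNReal.ofReal t * 𝒯.discreteAction θ P₂ M₂ := by
  rcases hs.eq_or_lt with rfl | hs
  · obtain rfl : t = 1 := by linarith
    simp
  rcases ht.eq_or_lt with rfl | ht
  · obtain rfl : s = 1 := by linarith
    simp
  by_cases h₁ : ∀ K, 0 ≤ P₁ K
  swap
  · simp [discreteAction_of_not_nonneg 𝒯 h₁, hs, ENNReal.mul_top]
  by_cases h₂ : ∀ K, 0 ≤ P₂ K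
  swap
  · simp [discreteAction_of_not_nonneg 𝒯 h₂, ht, ENNReal.mul_top]
  have h : ∀ K, 0 ≤ (s • P₁ + t • P₂) K := fun K =>
    add_nonneg (mul_nonneg hs.le (h₁ K)) (mul_nonneg ht.le (h₂ K))
  simp only [discreteAction_of_nonneg 𝒯 h₁, discreteAction_of_nonneg 𝒯 h₂,
    discreteAction_of_nonneg 𝒯 h, Finset.mul_sum, ← Finset.sum_add_distrib]
  refine Finset.sum_le_sum fun K _ => Finset.sum_le_sum fun L _ => ?_
  rw [← mul_assoc, ← mul_assoc, ← add_mul]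
  gcongr
  refine ofReal_sq_div_ofReal_convex (m₁ := M₁.1 K L) (m₂ := M₂.1 K L) hs ht
    (mul_nonneg (by norm_num) (hθ.nonneg _ _ (h₁ K) (h₁ L)))
    (mul_nonneg (by norm_num) (hθ.nonneg _ _ (h₂ K) (h₂ L))) ?_
  have := hθ.add_le (mul_nonneg hs.le (h₁ K)) (mul_nonneg hs.le (h₁ L))
    (mul_nonneg ht.le (h₂ K)) (mul_nonneg ht.le (h₂ L))
  rw [hθ.homogeneous s _ _ hs (h₁ K) (h₁ L), hθ.homogeneous t _ _ ht (h₂ K) (h₂ L)] at this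
  simp only [Pi.add_apply, Pi.smul_apply, smul_eq_mul]
  linarith

lemma discreteAction_smul_left (hθ : IsAdmissibleMean θ) (P : 𝒯.ι → ℝ) (M : 𝒯.momenta)
    {r : ℝ} (hr : 0 < r) :
    𝒯.discreteAction θ (r • P) M = ENNReal.ofReal r⁻¹ * 𝒯.discreteAction θ P M := by
  have hiff : (∀ K, 0 ≤ (r • P) K) ↔ ∀ K, 0 ≤ P K :=
    forall_congr' fun K => by simp [hr]
  by_cases h : ∀ K, 0 ≤ P K
  · simp only [discreteAction_of_nonneg 𝒯 h, discreteAction_of_nonneg 𝒯 (hiff.2 h), Finset.mul_sum]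
    refine Finset.sum_congr rfl fun K _ => Finset.sum_congr rfl fun L _ => ?_
    rw [← mul_assoc, Pi.smul_apply, Pi.smul_apply, smul_eq_mul, smul_eq_mul,
      hθ.homogeneous r _ _ hr (h K) (h L), mul_left_comm, ENNReal.ofReal_mul hr.le,
      ENNReal.ofReal_inv_of_pos hr, div_eq_mul_inv, div_eq_mul_inv,
      ENNReal.mul_inv (Or.inl (by simpa using hr)) (Or.inl ENNReal.ofReal_ne_top)]
    ring
  · simp [discreteAction_of_not_nonneg 𝒯 h, discreteAction_of_not_nonneg 𝒯 (hiff.not.2 h), hr,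
      ENNReal.mul_top]

lemma discreteAction_smul_right (P : 𝒯.ι → ℝ) (M : 𝒯.momenta) {r : ℝ} (hr : r ≠ 0) :
    𝒯.discreteAction θ P (r • M) = ENNReal.ofReal (r ^ 2) * 𝒯.discreteAction θ P M := by
  by_cases h : ∀ K, 0 ≤ P K
  · simp only [discreteAction_of_nonneg 𝒯 h, Finset.mul_sum]
    refine Finset.sum_congr rfl fun K _ => Finset.sum_congr rfl fun L _ => ?_
    simp only [Submodule.coe_smul, Pi.smul_apply, smul_eq_mul, mul_pow,
      ENNReal.ofReal_mul (sq_nonneg r), div_eq_mul_inv, mul_assoc]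
  · have : ENNReal.ofReal (r ^ 2) ≠ 0 := by simpa using hr
    rw [discreteAction_of_not_nonneg 𝒯 h, discreteAction_of_not_nonneg 𝒯 h, ENNReal.mul_top this]

lemma discreteAction_add_le (hθ : IsAdmissibleMean θ) {P₁ P₂ : 𝒯.ι → ℝ} (h₁ : ∀ K, 0 ≤ P₁ K)
    (h₂ : ∀ K, 0 ≤ P₂ K) (M : 𝒯.momenta) :
    𝒯.discreteAction θ (P₁ + P₂) M ≤ 𝒯.discreteAction θ P₁ M := by
  rw [discreteAction_of_nonneg 𝒯 h₁,
    discreteAction_of_nonneg 𝒯 (P := P₁ + P₂) fun K => add_nonneg (h₁ K) (h₂ K)]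
  refine Finset.sum_le_sum fun K _ => Finset.sum_le_sum fun L _ => ?_
  gcongr
  exact hθ.mono_add (h₁ K) (h₁ L) (h₂ K) (h₂ L)

lemma model_lawful (hθ : IsAdmissibleMean θ) : (𝒯.model θ).Lawful where
  finiteDimensional_X := inferInstanceAs (FiniteDimensional ℝ (𝒯.ι → ℝ))
  finiteDimensional_Y := inferInstanceAs (FiniteDimensional ℝ 𝒯.momenta)
  cone _ hP _ hr K := mul_nonneg hr.le (hP K)
  proper := ⟨(0 : 𝒯.ι → ℝ), (0 : 𝒯.momenta), by
    simp [model, 𝒯.discreteAction_zero (P := 0) fun _ => le_rfl]⟩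
  convex := 𝒯.discreteAction_convex hθ
  homogeneous_left P M _ hr := 𝒯.discreteAction_smul_left hθ P M hr
  homogeneous_right P M _ hr := 𝒯.discreteAction_smul_right P M hr
  zero_right _ hP := 𝒯.discreteAction_zero hP
  antitone _ h₁ _ h₂ M := 𝒯.discreteAction_add_le hθ h₁ h₂ M

end Mesh

/-! ### Integration against vector measures with a density -/

section WithDensity

variable {X E F G : Type*} {mX : MeasurableSpace X} [NormedAddCommGroup E] [NormedSpace ℝ E]
  [NormedAddCommGroup F] [NormedSpace ℝ F] [NormedAddCommGroup G] [NormedSpace ℝ G]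
  {μ : Measure X} {g : X → F}

omit [NormedSpace ℝ F] in
lemma ae_withDensity_enorm_iff (hg : Integrable g μ) {p : X → Prop} :
    (∀ᵐ x ∂(μ.withDensity fun x => ‖g x‖ₑ), p x) ↔ ∀ᵐ x ∂μ, g x ≠ 0 → p x := by
  rw [ae_withDensity_iff' hg.1.enorm]
  simp

omit [NormedSpace ℝ F] in
lemma integral_withDensity_enorm (hg : Integrable g μ) (f : X → ℝ) :
    ∫ x, f x ∂(μ.withDensity fun x => ‖g x‖ₑ) = ∫ x, ‖g x‖ * f x ∂μ := by
  rw [integral_withDensity_eq_integral_toReal_smul₀ hg.1.enorm (by simp)]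
  simp

/-- Measurability of `f` is known only up to null sets of `‖g‖ μ`, so nothing is known where `g =
0`. There the integrand vanishes, and elsewhere `f` may be replaced by its measurable modification.
-/
lemma integrable_apply_apply (hg : Integrable g μ) (B : E →L[ℝ] F →L[ℝ] G) {f : X → E}
    (hf : Integrable f (μ.withDensity fun x => ‖g x‖ₑ)) :
    Integrable (fun x => B (f x) (g x)) μ := by
  have hfn : Integrable (fun x => ‖g x‖ * ‖f x‖) μ := by
    have := (integrable_withDensity_iff_integrable_smul₀' hg.1.enorm (by simp)).1 hf.norm
    simpa using this
  refine (hfn.const_mul ‖B‖).mono' ?_ (Eventually.of_forall fun x => ?_)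
  · have hae : (fun x => B (f x) (g x)) =ᵐ[μ] fun x => B (hf.1.mk f x) (g x) := by
      filter_upwards [(ae_withDensity_enorm_iff hg).1 hf.1.ae_eq_mk] with x hx
      rcases eq_or_ne (g x) 0 with h | h
      · simp [h]
      · rw [hx h]
    refine AEStronglyMeasurable.congr ?_ hae.symm
    exact B.aestronglyMeasurable_comp₂ hf.1.stronglyMeasurable_mk.aestronglyMeasurable hg.1
  · calc ‖B (f x) (g x)‖ ≤ ‖B‖ * ‖f x‖ * ‖g x‖ := B.le_opNorm₂ _ _
      _ = ‖B‖ * (‖g x‖ * ‖f x‖) := by ring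

/-- The integral with respect to a vector measure with density `g`. -/
theorem integral_withDensityᵥ [CompleteSpace F] [CompleteSpace G] (hg : Integrable g μ)
    (B : E →L[ℝ] F →L[ℝ] G) {f : X → E} (hf : (μ.withDensityᵥ g).Integrable f) :
    (μ.withDensityᵥ g).integral f B = ∫ x, B (f x) (g x) ∂μ := by
  have hvar : (μ.withDensityᵥ g).variation = μ.withDensity fun x => ‖g x‖ₑ :=
    Measure.variation_withDensityᵥ hg
  have hfin : IsFiniteMeasure (μ.withDensityᵥ g).variation := by
    rw [hvar]
    exact isFiniteMeasure_withDensity hg.2.ne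
  have hI : ∀ f : X → E, Integrable f (μ.withDensityᵥ g).variation →
      Integrable (fun x => B (f x) (g x)) μ := fun f hf =>
    integrable_apply_apply hg B (by rwa [hvar] at hf)
  -- Both sides are additive and continuous in `f` for the `L¹` norm of the variation, which is `‖g‖
  -- μ`, so it suffices to treat constants on measurable sets.
  refine Integrable.induction (μ := (μ.withDensityᵥ g).variation)
    (fun f => (μ.withDensityᵥ g).integral f B = ∫ x, B (f x) (g x) ∂μ) ?_ ?_ ?_ ?_ hf
  · intro c s hs _
    rw [VectorMeasure.integral_indicator_const _ hs, withDensityᵥ_apply hg hs,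
      ← ContinuousLinearMap.integral_comp_comm _ hg.integrableOn, ← integral_indicator hs]
    refine integral_congr_ae (Eventually.of_forall fun x => ?_)
    by_cases hx : x ∈ s <;> simp [hx]
  · intro f f' _ hf hf' h h'
    rw [VectorMeasure.integral_add hf hf', h, h', ← integral_add (hI f hf) (hI f' hf')]
    simp
  · refine isClosed_eq VectorMeasure.continuous_integral ?_
    refine (LipschitzWith.of_dist_le_mul (K := ‖B‖₊) fun f f' => ?_).continuous
    have hdist : dist f f' = ∫ x, ‖g x‖ * dist (f x) (f' x) ∂μ := by
      rw [L1.dist_eq_integral_dist, ← integral_withDensity_enorm hg]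
      exact congrArg (fun ν => ∫ x, dist (f x) (f' x) ∂ν) hvar
    rw [dist_eq_norm,
      ← integral_sub (hI f (L1.integrable_coeFn f)) (hI f' (L1.integrable_coeFn f')),
      hdist, coe_nnnorm, ← integral_const_mul]
    have hd : Integrable (fun x => ‖B‖ * (‖g x‖ * dist (f x) (f' x))) μ := by
      have : Integrable (fun x => ‖f x - f' x‖) (μ.withDensity fun x => ‖g x‖ₑ) :=
        hvar ▸ ((L1.integrable_coeFn f).sub (L1.integrable_coeFn f')).norm
      have := (integrable_withDensity_iff_integrable_smul₀' hg.1.enorm (by simp)).1 this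
      simpa [dist_eq_norm] using this.const_mul ‖B‖
    refine norm_integral_le_of_norm_le hd (Eventually.of_forall fun x => ?_)
    rw [← _root_.sub_apply, ← map_sub, dist_eq_norm]
    calc ‖B (f x - f' x) (g x)‖ ≤ ‖B‖ * ‖f x - f' x‖ * ‖g x‖ := B.le_opNorm₂ _ _
      _ = ‖B‖ * (‖g x‖ * ‖f x - f' x‖) := by ring
  · intro f f' hff' _ h
    rw [← VectorMeasure.integral_congr_ae hff', h]
    rw [hvar] at hff'
    refine integral_congr_ae ?_
    filter_upwards [(ae_withDensity_enorm_iff hg).1 hff'] with x hx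
    rcases eq_or_ne (g x) 0 with h | h
    · simp [h]
    · rw [hx h]

omit [NormedSpace ℝ E] in
lemma integrable_withDensityᵥ_of_bound [CompleteSpace F] (hg : Integrable g μ) {f : X → E}
    (hf : AEStronglyMeasurable f μ) {C : ℝ} (hC : ∀ x, ‖f x‖ ≤ C) :
    (μ.withDensityᵥ g).Integrable f := by
  have hfin : IsFiniteMeasure (μ.withDensity fun x => ‖g x‖ₑ) :=
    isFiniteMeasure_withDensity hg.2.ne
  rw [VectorMeasure.Integrable, Measure.variation_withDensityᵥ hg]
  exact Integrable.of_bound (hf.mono_ac (withDensity_absolutelyContinuous _ _)) C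
    (Eventually.of_forall hC)

lemma isFiniteMeasure_variation_withDensityᵥ [CompleteSpace F] (hg : Integrable g μ) :
    IsFiniteMeasure (μ.withDensityᵥ g).variation := by
  rw [Measure.variation_withDensityᵥ hg]
  exact isFiniteMeasure_withDensity hg.2.ne

end WithDensity

/-! ### Pairings and total variation norms -/

lemma isFiniteMeasure_variation {X : Type*} [MeasurableSpace X] (ρ : SignedMeasure X) :
    IsFiniteMeasure ρ.variation := by
  rw [← SignedMeasure.totalVariation_eq_variation]
  infer_instance

lemma dirac_apply_of_measurableSet {X : Type*} [MeasurableSpace X] {A : Set X}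
    (hA : MeasurableSet A) (x : X) (v : ℝ) [Decidable (x ∈ A)] :
    VectorMeasure.dirac x v A = if x ∈ A then v else 0 := by
  split_ifs with h
  · exact VectorMeasure.dirac_apply_of_mem hA h
  · exact VectorMeasure.dirac_apply_of_notMem h

section Pairing

variable {d : ℕ} {Ω : Set (Rd d)}

/-- The norms of the values of a measure on a disjoint family sum up to at most its total
variation norm. -/
lemma sum_norm_le_tvNorm {F : Type*} [NormedAddCommGroup F] (μ : VectorMeasure Ω F)
    (hμ : μ.variation univ ≠ ⊤) {κ : Type*} (s : Finset κ) (A : κ → Set Ω)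
    (hA : ∀ i ∈ s, MeasurableSet (A i)) (hd : (s : Set κ).PairwiseDisjoint A) :
    ∑ i ∈ s, ‖μ (A i)‖ ≤ tvNorm μ := by
  have h1 : ∑ i ∈ s, ‖μ (A i)‖ₑ ≤ μ.variation univ :=
    calc ∑ i ∈ s, ‖μ (A i)‖ₑ ≤ ∑ i ∈ s, μ.variation (A i) :=
          Finset.sum_le_sum fun i _ => μ.enorm_measure_le_variation _
      _ = μ.variation (⋃ i ∈ s, A i) := (measure_biUnion_finset hd hA).symm
      _ ≤ μ.variation univ := measure_mono (subset_univ _)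
  have h2 := ENNReal.toReal_mono hμ h1
  rw [ENNReal.toReal_sum (by simp)] at h2
  simpa [tvNorm] using h2

lemma isFiniteMeasure_lebesgueOn (hΩ : IsCompact Ω) : IsFiniteMeasure (lebesgueOn Ω) := by
  constructor
  rw [lebesgueOn, comap_subtype_coe_apply hΩ.measurableSet, image_univ, Subtype.range_coe]
  exact hΩ.measure_lt_top

lemma integral_lebesgueOn (hΩ : IsCompact Ω) {F : Type*} [NormedAddCommGroup F] [NormedSpace ℝ F]
    (f : Rd d → F) : ∫ x, f x ∂(lebesgueOn Ω) = ∫ x in Ω, f x :=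
  integral_subtype_comap hΩ.measurableSet f

lemma setIntegral_lebesgueOn (hΩ : IsCompact Ω) {F : Type*} [NormedAddCommGroup F]
    [NormedSpace ℝ F] {A : Set (Rd d)} (hAΩ : A ⊆ Ω) (f : Rd d → F) :
    ∫ x in Subtype.val ⁻¹' A, f x ∂(lebesgueOn Ω) = ∫ x in A, f x := by
  rw [lebesgueOn, (MeasurableEmbedding.subtype_coe hΩ.measurableSet).restrict_comap,
    Subtype.image_preimage_coe, inter_eq_right.2 hAΩ,
    integral_subtype_comap hΩ.measurableSet, Measure.restrict_restrict hΩ.measurableSet,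
    inter_eq_right.2 hAΩ]

lemma integrable_of_continuousOn_lebesgueOn (hΩ : IsCompact Ω) {F : Type*} [NormedAddCommGroup F]
    {f : Rd d → F} (hf : ContinuousOn f Ω) :
    Integrable (fun x : Ω => f x) (lebesgueOn Ω) := by
  have := isCompact_iff_compactSpace.1 hΩ
  have := isFiniteMeasure_lebesgueOn hΩ
  exact hf.domRestrict.integrable_of_hasCompactSupport
    (HasCompactSupport.of_compactSpace _)

lemma exists_norm_le_of_continuous (hΩ : IsCompact Ω) {F : Type*} [NormedAddCommGroup F]
    {f : Ω → F} (hf : Continuous f) : ∃ C, ∀ x, ‖f x‖ ≤ C := by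
  have := isCompact_iff_compactSpace.1 hΩ
  obtain ⟨C, hC⟩ := (isCompact_univ (X := Ω)).exists_bound_of_continuousOn hf.continuousOn
  exact ⟨C, fun x => hC x (mem_univ x)⟩

lemma ofDensity_apply (hΩ : IsCompact Ω) {F : Type*} [NormedAddCommGroup F]
    [NormedSpace ℝ F] {f : Rd d → F} (hf : ContinuousOn f Ω) {A : Set (Rd d)}
    (hA : MeasurableSet A) (hAΩ : A ⊆ Ω) :
    ofDensity Ω f (Subtype.val ⁻¹' A) = ∫ x in A, f x := by
  rw [ofDensity, withDensityᵥ_apply (integrable_of_continuousOn_lebesgueOn hΩ hf)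
    (measurable_subtype_coe hA), setIntegral_lebesgueOn hΩ hAΩ]

lemma pair_ofDensity (hΩ : IsCompact Ω) {ρ φ : Rd d → ℝ} (hρ : ContinuousOn ρ Ω)
    (hφ : ContinuousOn φ Ω) :
    pair (ofDensity Ω ρ) (fun x => φ x) = ∫ x in Ω, φ x * ρ x := by
  have hφ' : Continuous fun x : Ω => φ x := hφ.domRestrict
  obtain ⟨C, hC⟩ := exists_norm_le_of_continuous hΩ hφ'
  have hg := integrable_of_continuousOn_lebesgueOn hΩ hρ
  rw [pair, ofDensity, integral_withDensityᵥ hg _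
    (integrable_withDensityᵥ_of_bound hg hφ'.aestronglyMeasurable hC)]
  exact integral_lebesgueOn hΩ fun x => φ x * ρ x

lemma pairV_ofDensity (hΩ : IsCompact Ω) {m b : Rd d → Rd d} (hm : ContinuousOn m Ω)
    (hb : ContinuousOn b Ω) :
    pairV (ofDensity Ω m) (fun x => b x) = ∫ x in Ω, ⟪b x, m x⟫ := by
  have hb' : Continuous fun x : Ω => b x := hb.domRestrict
  obtain ⟨C, hC⟩ := exists_norm_le_of_continuous hΩ hb'
  have hg := integrable_of_continuousOn_lebesgueOn hΩ hm
  rw [pairV, ofDensity, integral_withDensityᵥ hg _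
    (integrable_withDensityᵥ_of_bound hg hb'.aestronglyMeasurable hC)]
  exact integral_lebesgueOn hΩ fun x => ⟪b x, m x⟫

/-- A nonnegative signed measure is a measure. -/
lemma exists_measure_of_nonneg {X : Type*} [MeasurableSpace X] {ρ : SignedMeasure X} (hρ : 0 ≤ ρ) :
    ∃ (μ : Measure X) (_ : IsFiniteMeasure μ), ρ = μ.toSignedMeasure := by
  have h : 0 ≤[univ] ρ := by rwa [VectorMeasure.restrict_univ, VectorMeasure.restrict_univ]
  exact ⟨_, inferInstance, (ρ.toMeasureOfZeroLE_toSignedMeasure h).symm⟩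

lemma pair_toSignedMeasure (μ : Measure Ω) [IsFiniteMeasure μ] (φ : Ω → ℝ) :
    pair μ.toSignedMeasure φ = ∫ x, φ x ∂μ := by
  rw [← VectorMeasure.integral_toSignedMeasure, pair]
  congr 1
  ext
  simp

end Pairing

/-! ### Reconstructed and sampled densities, cell by cell -/

namespace Mesh

variable {d : ℕ} {Ω : Set (Rd d)} (𝒯 : Mesh Ω)

lemma cell_subset (K : 𝒯.ι) : 𝒯.cell K ⊆ Ω := by
  exact (subset_iUnion _ K).trans 𝒯.iUnion_cell.subset

lemma volume_cell_lt_top (hΩ : IsCompact Ω) (K : 𝒯.ι) : volume (𝒯.cell K) < ⊤ :=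
  (measure_mono (𝒯.cell_subset K)).trans_lt hΩ.measure_lt_top

lemma vol_pos (hΩ : IsCompact Ω) (K : 𝒯.ι) : 0 < 𝒯.vol K :=
  ENNReal.toReal_pos (Measure.measure_pos_of_nonempty_interior _ ⟨_, 𝒯.center_mem K⟩).ne'
    (𝒯.volume_cell_lt_top hΩ K).ne

lemma mem_nbrs {K L : 𝒯.ι} : L ∈ 𝒯.nbrs K ↔ 𝒯.Adj K L := by
  simp [nbrs]

/-- The cells as subsets of the domain. -/
def cellOn (K : 𝒯.ι) : Set Ω := Subtype.val ⁻¹' 𝒯.cell K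

lemma measurableSet_cellOn (K : 𝒯.ι) : MeasurableSet (𝒯.cellOn K) :=
  measurable_subtype_coe (𝒯.measurableSet_cell K)

lemma pairwise_disjoint_cellOn : Pairwise fun K L => Disjoint (𝒯.cellOn K) (𝒯.cellOn L) :=
  fun _ _ h => (𝒯.disjoint_cell h).preimage _

lemma iUnion_cellOn : ⋃ K, 𝒯.cellOn K = univ := by
  ext x
  have := 𝒯.iUnion_cell.symm.subset x.2
  simpa [cellOn] using this

lemma sum_setIntegral_cell (hΩ : IsCompact Ω) {F : Type*} [NormedAddCommGroup F] [NormedSpace ℝ F]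
    {f : Rd d → F} (hf : ContinuousOn f Ω) :
    ∑ K, ∫ x in 𝒯.cell K, f x = ∫ x in Ω, f x := by
  rw [← integral_iUnion_fintype 𝒯.measurableSet_cell 𝒯.disjoint_cell, 𝒯.iUnion_cell]
  exact fun K => (hf.integrableOn_compact hΩ).mono_set (𝒯.cell_subset K)

lemma integrable_smul_dirac (φ : Ω → ℝ) (x : Ω) (c : ℝ) :
    (c • VectorMeasure.dirac x (1 : ℝ)).Integrable φ := by
  refine VectorMeasure.Integrable.smul_vectorMeasure ?_ c
  rw [VectorMeasure.Integrable, VectorMeasure.variation_dirac]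
  exact (integrable_dirac (by simp)).smul_measure (by simp)

lemma pair_RCE (P : 𝒯.ι → ℝ) (φ : Ω → ℝ) :
    pair (𝒯.RCE P) φ = ∑ K, P K * 𝒯.vol K * φ ⟨𝒯.center K, 𝒯.center_mem_domain K⟩ := by
  change VectorMeasure.integral (∑ K, _) _ _ = _
  rw [VectorMeasure.integral_finsetSum_vectorMeasure fun K _ => integrable_smul_dirac _ _ _]
  simp [VectorMeasure.integral_smul_vectorMeasure]

lemma integrable_RA_summand (hΩ : IsCompact Ω) {φ : Ω → ℝ} (hφ : Continuous φ) (K : 𝒯.ι) (c : ℝ) :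
    (c • ((lebesgueOn Ω).restrict (Subtype.val ⁻¹' 𝒯.cell K)).withDensityᵥ
      (fun _ => (1 : ℝ))).Integrable φ := by
  have := isFiniteMeasure_lebesgueOn hΩ
  obtain ⟨C, hC⟩ := exists_norm_le_of_continuous hΩ hφ
  exact (integrable_withDensityᵥ_of_bound (integrable_const _) hφ.aestronglyMeasurable
    hC).smul_vectorMeasure c

lemma integrable_RCE (P : 𝒯.ι → ℝ) (φ : Ω → ℝ) : (𝒯.RCE P).Integrable φ :=
  VectorMeasure.Integrable.finsetSum_vectorMeasure fun _ _ => integrable_smul_dirac _ _ _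

lemma integrable_RA (hΩ : IsCompact Ω) (P : 𝒯.ι → ℝ) {φ : Ω → ℝ} (hφ : Continuous φ) :
    (𝒯.RA P).Integrable φ :=
  VectorMeasure.Integrable.finsetSum_vectorMeasure fun K _ => 𝒯.integrable_RA_summand hΩ hφ K _

lemma pair_RA (hΩ : IsCompact Ω) (P : 𝒯.ι → ℝ) {φ : Rd d → ℝ} (hφ : ContinuousOn φ Ω) :
    pair (𝒯.RA P) (fun x => φ x) = ∑ K, P K * ∫ x in 𝒯.cell K, φ x := by
  have := isFiniteMeasure_lebesgueOn hΩ
  have hφ' : Continuous fun x : Ω => φ x := hφ.domRestrict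
  obtain ⟨C, hC⟩ := exists_norm_le_of_continuous hΩ hφ'
  change VectorMeasure.integral (∑ K, _) _ _ = _
  rw [VectorMeasure.integral_finsetSum_vectorMeasure fun K _ =>
    𝒯.integrable_RA_summand hΩ hφ' K _]
  refine Finset.sum_congr rfl fun K _ => ?_
  rw [VectorMeasure.integral_smul_vectorMeasure, integral_withDensityᵥ (integrable_const _) _
    (integrable_withDensityᵥ_of_bound (integrable_const _) hφ'.aestronglyMeasurable hC),
    ← setIntegral_lebesgueOn hΩ (𝒯.cell_subset K) φ]
  simp

lemma pair_RCE_sub_RA (hΩ : IsCompact Ω) (P : 𝒯.ι → ℝ) {φ : Rd d → ℝ} (hφ : ContinuousOn φ Ω) :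
    pair (𝒯.RCE P - 𝒯.RA P) (fun x => φ x) =
      ∑ K, P K * (𝒯.vol K * φ (𝒯.center K) - ∫ x in 𝒯.cell K, φ x) := by
  rw [pair, VectorMeasure.integral_sub_vectorMeasure (𝒯.integrable_RCE P _)
    (𝒯.integrable_RA hΩ P (φ := fun x => φ x) hφ.domRestrict)]
  change pair _ _ - pair _ _ = _
  rw [𝒯.pair_RCE, 𝒯.pair_RA hΩ P hφ, ← Finset.sum_sub_distrib]
  exact Finset.sum_congr rfl fun K _ => by ring

/-- A centre lies in no cell but its own. Both reconstructions thus give the cell `K` the mass `P_K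
|K|`, and testing on cells bounds their total variation norms from below. -/
lemma RCE_apply_cellOn (P : 𝒯.ι → ℝ) (K : 𝒯.ι) : 𝒯.RCE P (𝒯.cellOn K) = P K * 𝒯.vol K := by
  classical
  have h : ∀ L, 𝒯.center L ∈ 𝒯.cell K ↔ L = K := fun L =>
    ⟨fun h => by_contra fun hne => (𝒯.disjoint_cell hne).le_bot
      ⟨interior_subset (𝒯.center_mem L), h⟩, fun h => h ▸ interior_subset (𝒯.center_mem L)⟩
  change (∑ L, _ : SignedMeasure Ω) (𝒯.cellOn K) = _
  rw [FunLike.coe_sum, Finset.sum_apply]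
  have hd : ∀ L, (VectorMeasure.dirac (⟨𝒯.center L, 𝒯.center_mem_domain L⟩ : Ω) (1 : ℝ))
      (𝒯.cellOn K) = if L = K then 1 else 0 := fun L => by
    rw [dirac_apply_of_measurableSet (𝒯.measurableSet_cellOn K)]
    simp [cellOn, h]
  simp [hd]

lemma RA_apply_cellOn (hΩ : IsCompact Ω) (P : 𝒯.ι → ℝ) (K : 𝒯.ι) :
    𝒯.RA P (𝒯.cellOn K) = P K * 𝒯.vol K := by
  classical
  have := isFiniteMeasure_lebesgueOn hΩ
  change (∑ L, _ : SignedMeasure Ω) (𝒯.cellOn K) = _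
  rw [FunLike.coe_sum, Finset.sum_apply]
  have h : ∀ L, ((lebesgueOn Ω).restrict (Subtype.val ⁻¹' 𝒯.cell L)).withDensityᵥ
      (fun _ => (1 : ℝ)) (𝒯.cellOn K) = if L = K then 𝒯.vol K else 0 := by
    intro L
    rw [withDensityᵥ_apply (integrable_const _) (𝒯.measurableSet_cellOn K),
      Measure.restrict_restrict (𝒯.measurableSet_cellOn K)]
    split_ifs with hL
    · subst hL
      change ∫ _ in _ ∩ 𝒯.cellOn L, _ ∂_ = _
      rw [inter_self]
      exact (setIntegral_lebesgueOn hΩ (𝒯.cell_subset L)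
        fun _ => (1 : ℝ)).trans (by simp [vol])
    · have : 𝒯.cellOn K ∩ Subtype.val ⁻¹' 𝒯.cell L = ∅ :=
        (𝒯.pairwise_disjoint_cellOn (Ne.symm hL)).inter_eq
      simp [this]
  simp [h]

lemma sum_abs_le_tvNorm_RCE (hΩ : IsCompact Ω) (P : 𝒯.ι → ℝ) :
    ∑ K, |P K| * 𝒯.vol K ≤ tvNorm (𝒯.RCE P) := by
  have := isFiniteMeasure_variation (𝒯.RCE P)
  have := sum_norm_le_tvNorm (𝒯.RCE P) (measure_ne_top _ _) Finset.univ 𝒯.cellOn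
    (fun K _ => 𝒯.measurableSet_cellOn K) (fun K _ L _ h => 𝒯.pairwise_disjoint_cellOn h)
  simpa [RCE_apply_cellOn, abs_mul, abs_of_pos (𝒯.vol_pos hΩ _)] using this

lemma sum_abs_le_tvNorm_RA (hΩ : IsCompact Ω) (P : 𝒯.ι → ℝ) :
    ∑ K, |P K| * 𝒯.vol K ≤ tvNorm (𝒯.RA P) := by
  have := isFiniteMeasure_variation (𝒯.RA P)
  have := sum_norm_le_tvNorm (𝒯.RA P) (measure_ne_top _ _) Finset.univ 𝒯.cellOn
    (fun K _ => 𝒯.measurableSet_cellOn K) (fun K _ L _ h => 𝒯.pairwise_disjoint_cellOn h)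
  simpa [RA_apply_cellOn 𝒯 hΩ, abs_mul, abs_of_pos (𝒯.vol_pos hΩ _)] using this

lemma RCE_nonneg (hΩ : IsCompact Ω) {P : 𝒯.ι → ℝ} (hP : ∀ K, 0 ≤ P K) : 0 ≤ 𝒯.RCE P := by
  classical
  rw [VectorMeasure.le_iff]
  intro i hi
  change _ ≤ (∑ L, _ : SignedMeasure Ω) i
  rw [FunLike.coe_sum, Finset.sum_apply]
  refine Finset.sum_nonneg fun L _ => mul_nonneg (mul_nonneg (hP L) (𝒯.vol_pos hΩ L).le) ?_
  rw [dirac_apply_of_measurableSet hi]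
  split_ifs <;> simp

lemma RA_nonneg (hΩ : IsCompact Ω) {P : 𝒯.ι → ℝ} (hP : ∀ K, 0 ≤ P K) : 0 ≤ 𝒯.RA P := by
  have := isFiniteMeasure_lebesgueOn hΩ
  rw [VectorMeasure.le_iff]
  intro i hi
  change _ ≤ (∑ L, _ : SignedMeasure Ω) i
  rw [FunLike.coe_sum, Finset.sum_apply]
  refine Finset.sum_nonneg fun L _ => mul_nonneg (hP L) ?_
  rw [withDensityᵥ_apply (integrable_const _) hi]
  exact integral_nonneg fun _ => zero_le_one

lemma SX_nonneg {ρ : SignedMeasure Ω} (hρ : 0 ≤ ρ) (K : 𝒯.ι) : 0 ≤ 𝒯.SX ρ K :=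
  div_nonneg (VectorMeasure.le_iff.1 hρ _ (𝒯.measurableSet_cellOn K)) measureReal_nonneg

lemma SX_ofDensity (hΩ : IsCompact Ω) {f : Rd d → ℝ} (hf : ContinuousOn f Ω) (K : 𝒯.ι) :
    𝒯.SX (ofDensity Ω f) K = (∫ x in 𝒯.cell K, f x) / 𝒯.vol K := by
  change ofDensity Ω f _ / _ = _
  rw [ofDensity_apply hΩ hf (𝒯.measurableSet_cell K) (𝒯.cell_subset K)]

lemma SX_dirac (x : Ω) (K : 𝒯.ι) [Decidable (x.1 ∈ 𝒯.cell K)] :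
    𝒯.SX (VectorMeasure.dirac x 1) K = if x.1 ∈ 𝒯.cell K then (𝒯.vol K)⁻¹ else 0 := by
  change (VectorMeasure.dirac x 1 : SignedMeasure Ω) (𝒯.cellOn K) / 𝒯.vol K = _
  classical
  rw [dirac_apply_of_measurableSet (𝒯.measurableSet_cellOn K)]
  simp [cellOn, ite_div]

end Mesh

/-! ### Hyperplanes -/

section Hyperplane

variable {d : ℕ}

/-- The hyperplane `{x | ν · x = c}`, parametrized by the orthogonal complement of `ν`. -/
def hyperplaneMap (ν : Rd d) (c : ℝ) (y : (ℝ ∙ ν)ᗮ) : Rd d := y + c • ν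

variable {ν : Rd d} (hν : ‖ν‖ = 1)

lemma inner_orthogonal (y : (ℝ ∙ ν)ᗮ) : ⟪ν, (y : Rd d)⟫ = 0 :=
  Submodule.mem_orthogonal_singleton_iff_inner_right.1 y.2

lemma isometry_hyperplaneMap (c : ℝ) : Isometry (hyperplaneMap ν c) :=
  (isometry_add_right (c • ν)).comp isometry_subtype_coe

lemma continuous_hyperplaneMap (c : ℝ) : Continuous (hyperplaneMap ν c) :=
  (isometry_hyperplaneMap c).continuous

lemma measurableEmbedding_hyperplaneMap (c : ℝ) : MeasurableEmbedding (hyperplaneMap ν c) :=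
  (isometry_hyperplaneMap c).isClosedEmbedding.measurableEmbedding

include hν

lemma inner_hyperplaneMap (c : ℝ) (y : (ℝ ∙ ν)ᗮ) : ⟪ν, hyperplaneMap ν c y⟫ = c := by
  rw [hyperplaneMap, inner_add_right, inner_orthogonal, real_inner_smul_right,
    real_inner_self_eq_norm_sq, hν]
  simp

lemma hyperplaneMap_orthogonalProjection {c : ℝ} {x : Rd d} (hx : ⟪ν, x⟫ = c) :
    hyperplaneMap ν c ((ℝ ∙ ν)ᗮ.orthogonalProjectionOnto x) = x := by
  have h : ((ℝ ∙ ν)ᗮ.orthogonalProjectionOnto x : Rd d) = x - c • ν := by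
    refine Submodule.eq_starProjection_of_mem_of_inner_eq_zero ?_ fun w hw => ?_
    · rw [Submodule.mem_orthogonal_singleton_iff_inner_right, inner_sub_right,
        real_inner_smul_right, real_inner_self_eq_norm_sq, hν, hx]
      simp
    · rw [sub_sub_cancel, real_inner_smul_left,
        Submodule.mem_orthogonal_singleton_iff_inner_right.1 hw, mul_zero]
  rw [hyperplaneMap, h, sub_add_cancel]

lemma range_hyperplaneMap (c : ℝ) : range (hyperplaneMap ν c) = {x | ⟪ν, x⟫ = c} := by
  ext x
  exact ⟨by rintro ⟨y, rfl⟩; exact inner_hyperplaneMap hν c y,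
    fun hx => ⟨_, hyperplaneMap_orthogonalProjection hν hx⟩⟩

lemma finrank_orthogonal_unit : Module.finrank ℝ (ℝ ∙ ν)ᗮ = d - 1 := by
  have h := (ℝ ∙ ν).finrank_add_finrank_orthogonal
  rw [finrank_span_singleton (by rintro rfl; simp at hν), finrank_euclideanSpace_fin] at h
  omega

/-- An isometry preserves the normalized Hausdorff measure, and on the orthogonal complement of `ν`,
of dimension `d - 1`, this measure is the volume. -/
lemma map_hyperplaneMap (c : ℝ) :
    (volume : Measure (ℝ ∙ ν)ᗮ).map (hyperplaneMap ν c) =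
      (μHE[d - 1] : Measure (Rd d)).restrict {x | ⟪ν, x⟫ = c} := by
  rw [← range_hyperplaneMap hν, ← (isometry_hyperplaneMap c).map_euclideanHausdorffMeasure,
    ← InnerProductSpace.euclideanHausdorffMeasure_eq_volume, finrank_orthogonal_unit hν]

/-- The area of a subset of a hyperplane. -/
lemma area_eq_volume_preimage {c : ℝ} {F : Set (Rd d)} (hF : ∀ x ∈ F, ⟪ν, x⟫ = c) :
    μHE[d - 1] F = volume (hyperplaneMap ν c ⁻¹' F) := by
  rw [← (measurableEmbedding_hyperplaneMap c).map_apply, map_hyperplaneMap hν,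
    Measure.restrict_eq_self _ (show F ⊆ {x | ⟪ν, x⟫ = c} from hF)]

lemma setIntegral_hyperplane {G : Type*} [NormedAddCommGroup G] [NormedSpace ℝ G] {c : ℝ}
    {F : Set (Rd d)} (hFm : MeasurableSet F) (hF : ∀ x ∈ F, ⟪ν, x⟫ = c) (f : Rd d → G) :
    ∫ x in F, f x ∂μHE[d - 1] =
      ∫ y in hyperplaneMap ν c ⁻¹' F, f (hyperplaneMap ν c y) := by
  rw [← (measurableEmbedding_hyperplaneMap c).setIntegral_map, map_hyperplaneMap hν,
    Measure.restrict_restrict hFm, inter_eq_left.2 (show F ⊆ {x | ⟪ν, x⟫ = c} from hF)]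

/-- Space is the product of a hyperplane and a line. -/
lemma measurePreserving_slab (c : ℝ) :
    MeasurePreserving (fun p : (ℝ ∙ ν)ᗮ × ℝ => hyperplaneMap ν c p.1 + p.2 • ν)
      (volume.prod volume) volume := by
  have h1 := ((ℝ ∙ ν).measurePreserving_measurableEquivProd (c • ν)).symm
  rw [InnerProductSpace.euclideanHausdorffMeasure_eq_volume] at h1
  have h2 := (LinearIsometryEquiv.toSpanUnitSingleton (𝕜 := ℝ) ν hν).measurePreserving
  have h3 := h1.comp ((h2.prod (MeasurePreserving.id (volume : Measure (ℝ ∙ ν)ᗮ))).comp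
    (Measure.measurePreserving_swap (μ := (volume : Measure (ℝ ∙ ν)ᗮ)) (ν := (volume : Measure ℝ))))
  have h : (fun p : (ℝ ∙ ν)ᗮ × ℝ => hyperplaneMap ν c p.1 + p.2 • ν) =
      ((ℝ ∙ ν).measurableEquivProd (c • ν)).symm ∘ Prod.map
        (LinearIsometryEquiv.toSpanUnitSingleton (𝕜 := ℝ) ν hν) id ∘ Prod.swap := by
    ext1 p
    simp [hyperplaneMap]
    abel
  rw [h]
  exact h3

lemma measurableEmbedding_slab (c : ℝ) :
    MeasurableEmbedding (fun p : (ℝ ∙ ν)ᗮ × ℝ => hyperplaneMap ν c p.1 + p.2 • ν) := by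
  have h : (fun p : (ℝ ∙ ν)ᗮ × ℝ => hyperplaneMap ν c p.1 + p.2 • ν) =
      ((ℝ ∙ ν).measurableEquivProd (c • ν)).symm ∘ Prod.map
        (LinearIsometryEquiv.toSpanUnitSingleton (𝕜 := ℝ) ν hν).toHomeomorph.toMeasurableEquiv id ∘
          Prod.swap := by
    ext1 p
    simp [hyperplaneMap]
    abel
  rw [h]
  refine (MeasurableEquiv.measurableEmbedding _).comp (MeasurableEmbedding.comp ?_
    MeasurableEquiv.prodComm.measurableEmbedding)
  exact (MeasurableEquiv.prodCongr (LinearIsometryEquiv.toSpanUnitSingleton (𝕜 := ℝ) ν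
    hν).toHomeomorph.toMeasurableEquiv (MeasurableEquiv.refl _)).measurableEmbedding

/-- The area of a bounded subset of a hyperplane is bounded in terms of its size. -/
lemma area_le_of_subset_closedBall {c : ℝ} {F : Set (Rd d)} (hF : ∀ x ∈ F, ⟪ν, x⟫ = c)
    {p : Rd d} {r : ℝ} (hr : 0 < r) (hFr : F ⊆ Metric.closedBall p r) :
    μHE[d - 1] F ≤
      ENNReal.ofReal (2 ^ d * r ^ (d - 1)) * volume (Metric.ball (0 : Rd d) 1) := by
  set Ψ := fun p : (ℝ ∙ ν)ᗮ × ℝ => hyperplaneMap ν c p.1 + p.2 • ν with hΨ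
  -- Thickening `F` by a segment of length `r` along the normal gives a set of volume `r` times the
  -- area of `F`, contained in a ball of radius `2r`; dividing by `r` gives the bound.
  have hsub : (hyperplaneMap ν c ⁻¹' F) ×ˢ Icc 0 r ⊆ Ψ ⁻¹' Metric.closedBall p (2 * r) := by
    rintro ⟨y, t⟩ ⟨hy, ht⟩
    have h1 := hFr hy
    rw [mem_preimage, mem_closedBall_iff_norm] at *
    calc ‖hyperplaneMap ν c y + t • ν - p‖ = ‖(hyperplaneMap ν c y - p) + t • ν‖ := by
          congr 1; abel
      _ ≤ ‖hyperplaneMap ν c y - p‖ + ‖t • ν‖ := norm_add_le _ _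
      _ ≤ r + r := add_le_add h1 (by
        rw [norm_smul, hν, mul_one, Real.norm_of_nonneg ht.1]; exact ht.2)
      _ = 2 * r := by ring
  have h := (measure_mono hsub).trans_eq
    ((measurePreserving_slab hν c).measure_preimage_emb (measurableEmbedding_slab hν c) _)
  rw [Measure.prod_prod, ← area_eq_volume_preimage hν hF, Real.volume_Icc, sub_zero,
    Measure.addHaar_closedBall _ _ (by positivity), finrank_euclideanSpace_fin] at h
  have hd : d ≠ 0 := by
    rintro rfl
    simp [Subsingleton.elim ν 0] at hν
  have hpow : (2 * r) ^ d = 2 ^ d * r ^ (d - 1) * r := by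
    rw [mul_pow, mul_assoc, ← pow_succ, Nat.sub_add_cancel (Nat.one_le_iff_ne_zero.2 hd)]
  rw [hpow, ENNReal.ofReal_mul (by positivity), mul_right_comm] at h
  exact (ENNReal.mul_le_mul_iff_left (by simpa using hr) ENNReal.ofReal_ne_top).1 h

/-- Almost every point of a convex subset of a hyperplane is in its relative interior. -/
lemma ae_relative_interior {c : ℝ} {F : Set (Rd d)} (hFc : Convex ℝ F)
    (hF : ∀ x ∈ F, ⟪ν, x⟫ = c) :
    μHE[d - 1] {y ∈ F | ¬ ∀ᶠ w in 𝓝 y, ⟪ν, w⟫ = c → w ∈ F} = 0 := by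
  rw [area_eq_volume_preimage hν fun x hx => hF x hx.1]
  have hconv : Convex ℝ (hyperplaneMap ν c ⁻¹' F) := by
    intro x hx y hy s t hs ht hst
    have := hFc hx hy hs ht hst
    rw [mem_preimage]
    convert this using 1
    simp only [hyperplaneMap, Submodule.coe_add, Submodule.coe_smul, smul_add]
    rw [add_add_add_comm, smul_smul, smul_smul, ← add_smul, ← add_mul, hst, one_mul]
  -- In the coordinates of the hyperplane the set is convex, so its frontier is a null set; every
  -- interior point there is a relative interior point of `F`.
  refine measure_mono_null ?_ (hconv.addHaar_frontier volume)
  rintro y ⟨hy, hny⟩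
  refine ⟨subset_closure hy, fun hi => hny ?_⟩
  have hproj : (ℝ ∙ ν)ᗮ.orthogonalProjectionOnto (hyperplaneMap ν c y) = y :=
    (isometry_hyperplaneMap c).injective
      (hyperplaneMap_orthogonalProjection hν (inner_hyperplaneMap hν c y))
  have hcont : ContinuousAt ((ℝ ∙ ν)ᗮ.orthogonalProjectionOnto) (hyperplaneMap ν c y) :=
    ((ℝ ∙ ν)ᗮ.orthogonalProjectionOnto).continuous.continuousAt
  have := hcont.eventually_mem (s := hyperplaneMap ν c ⁻¹' F)
    (by rw [hproj]; exact mem_interior_iff_mem_nhds.1 hi)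
  filter_upwards [this] with w hw hwc
  rwa [mem_preimage, hyperplaneMap_orthogonalProjection hν hwc] at hw

omit hν in
/-- A convex set which contains a relative neighbourhood of `y` in a hyperplane and a point below
the hyperplane contains a half ball around `y`. -/
lemma eventually_mem_of_lt {A : Set (Rd d)} (hA : Convex ℝ A) {x₀ y : Rd d} {c : ℝ}
    (hx₀ : x₀ ∈ A) (hlt : ⟪ν, x₀⟫ < c) (hy : ⟪ν, y⟫ = c)
    (hF : ∀ᶠ w in 𝓝 y, ⟪ν, w⟫ = c → w ∈ A) : ∀ᶠ z in 𝓝 y, ⟪ν, z⟫ < c → z ∈ A := by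
  -- The ray from `x₀` through `z` hits the hyperplane at `x₀ + l z • (z - x₀)`. As `z → y` the
  -- factor tends to `1`, so the hit point tends to `y` and eventually lies in `A`. Below the
  -- hyperplane `l z ≥ 1`, and `z` lies on the segment from `x₀` to the hit point.
  set l : Rd d → ℝ := fun z => (c - ⟪ν, x₀⟫) / (⟪ν, z⟫ - ⟪ν, x₀⟫) with hl
  have hin : ContinuousAt (fun z : Rd d => ⟪ν, z⟫) y := by fun_prop
  have hne : ⟪ν, y⟫ - ⟪ν, x₀⟫ ≠ 0 := by rw [hy]; linarith
  have hlc : ContinuousAt l y := continuousAt_const.div (hin.sub continuousAt_const) hne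
  have hly : l y = 1 := by rw [hl]; simp only; rw [hy] at *; exact div_self hne
  have hw : ContinuousAt (fun z => x₀ + l z • (z - x₀)) y := by fun_prop
  have hw' : Tendsto (fun z => x₀ + l z • (z - x₀)) (𝓝 y) (𝓝 y) := by
    have := hw.tendsto
    rwa [hly, one_smul, add_sub_cancel] at this
  have hgt : ∀ᶠ z in 𝓝 y, ⟪ν, x₀⟫ < ⟪ν, z⟫ := hin.eventually (lt_mem_nhds (hlt.trans_eq hy.symm))
  filter_upwards [hw'.eventually hF, hgt] with z hz hz1 hz2
  have hzpos : 0 < ⟪ν, z⟫ - ⟪ν, x₀⟫ := by linarith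
  have hlpos : 1 ≤ l z := by rw [hl, le_div_iff₀ hzpos]; linarith
  have hmem : x₀ + l z • (z - x₀) ∈ A := by
    refine hz ?_
    rw [inner_add_right, real_inner_smul_right, inner_sub_right, hl]
    simp only
    rw [div_mul_cancel₀ _ hzpos.ne']
    ring
  have := hA.add_smul_sub_mem hx₀ hmem (t := (l z)⁻¹) ⟨by positivity, inv_le_one_of_one_le₀ hlpos⟩
  rwa [add_sub_cancel_left, smul_smul, inv_mul_cancel₀ (by positivity), one_smul,
    add_sub_cancel] at this

end Hyperplane

/-! ### Separation of convex sets -/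

/-- The hyperplane `{x | ν · x = c}` separates the sets `K` and `L`, and strictly the points `p`
and `q`. -/
structure Separates {d : ℕ} (ν : Rd d) (c : ℝ) (K L : Set (Rd d)) (p q : Rd d) : Prop where
  norm_eq : ‖ν‖ = 1
  left : ∀ z ∈ closure K, ⟪ν, z⟫ ≤ c
  right : ∀ z ∈ closure L, c ≤ ⟪ν, z⟫
  left_lt : ⟪ν, p⟫ < c
  lt_right : c < ⟪ν, q⟫

/-- Hahn-Banach separates the interior of `K` from `L`. The bound passes to the closure of `K`,
which is the closure of its interior, and it is strict at `q` because `q` can be moved a little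
against the normal without leaving `L`. -/
lemma exists_separates {d : ℕ} {K L : Set (Rd d)} (hK : Convex ℝ K) (hL : Convex ℝ L)
    (hKL : Disjoint K L) {p q : Rd d} (hp : p ∈ interior K) (hq : q ∈ interior L) :
    ∃ ν c, Separates ν c K L p q := by
  obtain ⟨f, u, hf, hg⟩ := geometric_hahn_banach_open hK.interior isOpen_interior hL
    (hKL.mono_left interior_subset)
  set ν₀ : Rd d := (InnerProductSpace.toDual ℝ (Rd d)).symm f with hν₀
  have hf' : ∀ z, f z = ⟪ν₀, z⟫ := fun z => by rw [hν₀, InnerProductSpace.toDual_symm_apply]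
  simp only [hf'] at hf hg
  have hne : ν₀ ≠ 0 := by
    intro h
    have h1 := hf p hp
    have h2 := hg q (interior_subset hq)
    rw [h, inner_zero_left] at h1 h2
    linarith
  have hpos : 0 < ‖ν₀‖ := norm_pos_iff.2 hne
  have hlt : u < ⟪ν₀, q⟫ := by
    have hcont : ContinuousAt (fun t : ℝ => q - t • ν₀) 0 := by fun_prop
    have hev : ∀ᶠ t in 𝓝 (0 : ℝ), q - t • ν₀ ∈ L := by
      apply hcont.eventually_mem
      simpa using mem_interior_iff_mem_nhds.1 hq
    obtain ⟨t, ht, ht0⟩ := ((hev.filter_mono nhdsWithin_le_nhds).and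
      (self_mem_nhdsWithin (s := Ioi (0 : ℝ)))).exists
    have := hg _ ht
    rw [inner_sub_right, real_inner_smul_right, real_inner_self_eq_norm_sq] at this
    have : 0 < t * ‖ν₀‖ ^ 2 := mul_pos ht0 (by positivity)
    linarith
  have hinner : ∀ z, ⟪‖ν₀‖⁻¹ • ν₀, z⟫ = ‖ν₀‖⁻¹ * ⟪ν₀, z⟫ := fun z => real_inner_smul_left _ _ _
  refine ⟨‖ν₀‖⁻¹ • ν₀, ‖ν₀‖⁻¹ * u, ?_, ?_, ?_, ?_, ?_⟩
  · rw [norm_smul, norm_inv, norm_norm, inv_mul_cancel₀ hpos.ne']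
  · intro z hz
    rw [hinner]
    refine mul_le_mul_of_nonneg_left ?_ (by positivity)
    rw [← hK.closure_interior_eq_closure_of_nonempty_interior ⟨p, hp⟩] at hz
    have hcl : IsClosed {z | ⟪ν₀, z⟫ ≤ u} := isClosed_le (by fun_prop) continuous_const
    exact closure_minimal (fun z hz => (hf z hz).le) hcl hz
  · intro z hz
    rw [hinner]
    refine mul_le_mul_of_nonneg_left ?_ (by positivity)
    have hcl : IsClosed {z | u ≤ ⟪ν₀, z⟫} := isClosed_le continuous_const (by fun_prop)
    exact closure_minimal (fun z hz => hg z hz) hcl hz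
  · rw [hinner]
    exact mul_lt_mul_of_pos_left (hf p hp) (by positivity)
  · rw [hinner]
    exact mul_lt_mul_of_pos_left hlt (by positivity)

namespace Separates

variable {d : ℕ} {ν : Rd d} {c : ℝ} {K L : Set (Rd d)} {p q : Rd d} (h : Separates ν c K L p q)

include h

lemma inner_eq {x : Rd d} (hx : x ∈ interface K L) : ⟪ν, x⟫ = c :=
  le_antisymm (h.left x hx.1) (h.right x hx.2)

lemma eventually_mem_left (hK : Convex ℝ K) (hp : p ∈ K) {y : Rd d}
    (hy : y ∈ interface K L) (hF : ∀ᶠ w in 𝓝 y, ⟪ν, w⟫ = c → w ∈ interface K L) :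
    ∀ᶠ z in 𝓝 y, ⟪ν, z⟫ < c → z ∈ closure K :=
  eventually_mem_of_lt hK.closure (subset_closure hp) h.left_lt (h.inner_eq hy)
    (hF.mono fun _ hw hwc => (hw hwc).1)

lemma eventually_mem_right (hL : Convex ℝ L) (hq : q ∈ L) {y : Rd d}
    (hy : y ∈ interface K L) (hF : ∀ᶠ w in 𝓝 y, ⟪ν, w⟫ = c → w ∈ interface K L) :
    ∀ᶠ z in 𝓝 y, c < ⟪ν, z⟫ → z ∈ closure L := by
  have := eventually_mem_of_lt (ν := -ν) (c := -c) hL.closure (subset_closure hq)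
    (by rw [inner_neg_left]; exact neg_lt_neg h.lt_right)
    (by rw [inner_neg_left, h.inner_eq hy])
    (hF.mono fun w hw hwc => (hw (by rw [inner_neg_left] at hwc; linarith)).2)
  filter_upwards [this] with z hz hzc
  exact hz (by rw [inner_neg_left]; linarith)

/-- A relative interior point of the interface of two cells is not in the closure of a third
cell. -/
lemma notMem_closure (hK : Convex ℝ K) (hL : Convex ℝ L) (hp : p ∈ K) (hq : q ∈ L) {y : Rd d}
    (hy : y ∈ interface K L) (hF : ∀ᶠ w in 𝓝 y, ⟪ν, w⟫ = c → w ∈ interface K L)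
    {N : Set (Rd d)} (hN : Convex ℝ N) (hNi : (interior N).Nonempty) (hKN : Disjoint K N)
    (hLN : Disjoint L N) : y ∉ closure N := by
  intro hyN
  rw [← hN.closure_interior_eq_closure_of_nonempty_interior hNi] at hyN
  -- Near `y` the closures of `K` and `L` fill the two open sides of the hyperplane, while interior
  -- points of `N` come arbitrarily close to `y`. Such a point `z` is on one of the sides, or, if it
  -- is on the hyperplane, can be pushed along `ν` into the side of `L`; either way it contradicts
  -- disjointness.
  have hev := (h.eventually_mem_left hK hp hy hF).and (h.eventually_mem_right hL hq hy hF)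
  obtain ⟨z, hzi, hz⟩ :=
    (hev.eventually_nhds.and_frequently (mem_closure_iff_frequently.1 hyN)).exists.imp
      fun z hz => And.symm hz
  have hK' := (hKN.mono_right interior_subset).closure_left isOpen_interior
  have hL' := (hLN.mono_right interior_subset).closure_left isOpen_interior
  have hz' := hz.and (isOpen_interior.eventually_mem hzi)
  have hcont : Tendsto (fun t : ℝ => z + t • ν) (𝓝[>] 0) (𝓝 z) := by
    have : ContinuousAt (fun t : ℝ => z + t • ν) 0 := by fun_prop
    have := this.tendsto.mono_left (nhdsWithin_le_nhds (s := Ioi 0))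
    simpa using this
  obtain ⟨t, ⟨⟨h1, h2⟩, h3⟩, ht⟩ := ((hcont.eventually hz').and self_mem_nhdsWithin).exists
  obtain ⟨⟨h1', h2'⟩, h3'⟩ := hz'.self_of_nhds
  rcases lt_trichotomy ⟪ν, z⟫ c with hlt | heq | hgt
  · exact hK'.le_bot ⟨h1' hlt, h3'⟩
  · refine hL'.le_bot ⟨h2 ?_, h3⟩
    rw [inner_add_right, real_inner_smul_right, real_inner_self_eq_norm_sq, h.norm_eq, heq]
    have : (0 : ℝ) < t := ht
    linarith
  · exact hL'.le_bot ⟨h2' hgt, h3'⟩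

/-- If two points are on a line orthogonal to an interface with positive area, their difference
is normal to the interface. -/
lemma sub_eq_smul (hK : Convex ℝ K) (hL : Convex ℝ L) (harea : μHE[d - 1] (interface K L) ≠ 0)
    (horth : ∀ x ∈ interface K L, ∀ y ∈ interface K L, ⟪q - p, x - y⟫ = 0) :
    q - p = ⟪ν, q - p⟫ • ν := by
  obtain ⟨y, hy, hF⟩ : ∃ y ∈ interface K L, ∀ᶠ w in 𝓝 y, ⟪ν, w⟫ = c → w ∈ interface K L := by
    by_contra hcon
    refine harea (measure_mono_null (fun y hy => ?_) (ae_relative_interior h.norm_eq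
      (hK.closure.inter hL.closure) fun x hx => h.inner_eq hx))
    exact ⟨hy, fun hev => hcon ⟨y, hy, hev⟩⟩
  -- The vector `u` is the tangential part of `q - p`. Since `y` is a relative interior point, `y +
  -- t • u` stays in the interface for small `t`, and orthogonality to the interface forces `u = 0`.
  set u := q - p - ⟪ν, q - p⟫ • ν with hu
  have huν : ⟪ν, u⟫ = 0 := by
    rw [hu, inner_sub_right, real_inner_smul_right, real_inner_self_eq_norm_sq, h.norm_eq]
    ring
  have hcont : Tendsto (fun t : ℝ => y + t • u) (𝓝[>] 0) (𝓝 y) := by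
    have : ContinuousAt (fun t : ℝ => y + t • u) 0 := by fun_prop
    have := this.tendsto.mono_left (nhdsWithin_le_nhds (s := Ioi 0))
    simpa using this
  obtain ⟨t, h1, ht⟩ := ((hcont.eventually hF).and self_mem_nhdsWithin).exists
  have h2 := horth _ (h1 (by rw [inner_add_right, real_inner_smul_right, huν, h.inner_eq hy]; ring))
    y hy
  rw [add_sub_cancel_left, real_inner_smul_right] at h2
  have h3 : ⟪q - p, u⟫ = 0 := (mul_eq_zero.1 h2).resolve_left (ne_of_gt ht)
  have h4 : ⟪u, u⟫ = 0 := by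
    conv_lhs => rw [hu]
    rw [inner_sub_left, h3, real_inner_smul_left, huν]
    ring
  exact sub_eq_zero.1 (inner_self_eq_zero.1 h4)

end Separates

/-! ### Bounded sets of smooth functions -/

section BoundedInC

variable {d : ℕ} {Ω : Set (Rd d)} {F : Type*} [NormedAddCommGroup F] [NormedSpace ℝ F]

lemma lipschitz_of_norm_fderivWithin_le (hconv : Convex ℝ Ω) {f : Rd d → F}
    (hf : DifferentiableOn ℝ f Ω) {C : ℝ} (hC : ∀ x ∈ Ω, ‖fderivWithin ℝ f Ω x‖ ≤ C) {x y : Rd d}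
    (hx : x ∈ Ω) (hy : y ∈ Ω) : ‖f x - f y‖ ≤ C * ‖x - y‖ :=
  hconv.norm_image_sub_le_of_norm_fderivWithin_le hf hC hy hx

lemma IsBoundedInC.exists_bound (hconv : Convex ℝ Ω) (hint : (interior Ω).Nonempty)
    {B : Set (Rd d → F)} (hB : IsBoundedInC 1 Ω B) :
    ∃ C : ℝ, 0 ≤ C ∧ ∀ f ∈ B, ContinuousOn f Ω ∧ (∀ x ∈ Ω, ‖f x‖ ≤ C) ∧
      ∀ x ∈ Ω, ∀ y ∈ Ω, ‖f x - f y‖ ≤ C * ‖x - y‖ := by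
  obtain ⟨hsm, C, hC⟩ := hB
  have hu := uniqueDiffOn_convex hconv hint
  refine ⟨max C 0, le_max_right _ _, fun f hf => ⟨(hsm f hf).continuousOn, fun x hx => ?_,
    fun x hx y hy => ?_⟩⟩
  · have := hC f hf 0 zero_le_one x hx
    rw [norm_iteratedFDerivWithin_zero] at this
    exact this.trans (le_max_left _ _)
  · refine lipschitz_of_norm_fderivWithin_le hconv ((hsm f hf).differentiableOn (by norm_num))
      (fun z hz => ?_) hx hy
    have := hC f hf 1 le_rfl z hz
    rw [norm_iteratedFDerivWithin_one f (hu z hz)] at this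
    exact this.trans (le_max_left _ _)

/-- The expansion point `x` is allowed to differ from `a` and `b`: it will be a point of an
interface, and `a`, `b` the centres on its two sides. On the convex set `Ω ∩ closedBall x r` the
derivative differs from its value at `x` by at most `C r`, and the mean value inequality applies. -/
lemma IsBoundedInC.exists_taylor (hconv : Convex ℝ Ω) (hint : (interior Ω).Nonempty)
    {B : Set (Rd d → ℝ)} (hB : IsBoundedInC 2 Ω B) :
    ∃ C : ℝ, 0 ≤ C ∧ ∀ f ∈ B, ContinuousOn f Ω ∧ ContinuousOn (gradientWithin f Ω) Ω ∧
      ∀ x ∈ Ω, ∀ a ∈ Ω, ∀ b ∈ Ω, ∀ r : ℝ, dist a x ≤ r → dist b x ≤ r →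
        |f b - f a - ⟪gradientWithin f Ω x, b - a⟫| ≤ C * r * ‖b - a‖ := by
  obtain ⟨hsm, C, hC⟩ := hB
  have hu := uniqueDiffOn_convex hconv hint
  refine ⟨max C 0, le_max_right _ _, fun f hf => ?_⟩
  have hf2 := hsm f hf
  have hd : ContDiffOn ℝ 1 (fderivWithin ℝ f Ω) Ω := hf2.fderivWithin hu (by norm_num)
  have hlip : ∀ x ∈ Ω, ∀ y ∈ Ω,
      ‖fderivWithin ℝ f Ω x - fderivWithin ℝ f Ω y‖ ≤ max C 0 * ‖x - y‖ := fun x hx y hy => by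
    refine lipschitz_of_norm_fderivWithin_le hconv (hd.differentiableOn (by norm_num))
      (fun z hz => ?_) hx hy
    have := hC f hf 2 le_rfl z hz
    rw [← norm_iteratedFDerivWithin_fderivWithin hu hz, norm_iteratedFDerivWithin_one _ (hu z hz)]
      at this
    exact this.trans (le_max_left _ _)
  refine ⟨hf2.continuousOn, ?_, fun x hx a ha b hb r har hbr => ?_⟩
  · exact (InnerProductSpace.toDual ℝ (Rd d)).symm.continuous.comp_continuousOn hd.continuousOn
  · have hs : Convex ℝ (Ω ∩ Metric.closedBall x r) := hconv.inter (convex_closedBall x r)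
    have := Convex.norm_image_sub_le_of_norm_hasFDerivWithin_le' (f := f)
      (f' := fderivWithin ℝ f Ω) (φ := fderivWithin ℝ f Ω x) (C := max C 0 * r)
      (fun z hz => ((hf2.differentiableOn (by norm_num) z hz.1).hasFDerivWithinAt).mono
        inter_subset_left)
      (fun z hz => (hlip z hz.1 x hx).trans (mul_le_mul_of_nonneg_left
        (by rw [← dist_eq_norm]; exact hz.2) (le_max_right _ _))) hs
      (x := a) (y := b) ⟨ha, har⟩ ⟨hb, hbr⟩
    rwa [Real.norm_eq_abs, ← toDual_gradientWithin, InnerProductSpace.toDual_apply_apply] at this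

end BoundedInC

/-! ### Geometry of meshes -/

namespace Mesh

variable {d : ℕ} {Ω : Set (Rd d)} (𝒯 : Mesh Ω)

section Faces

lemma exists_separates {K L : 𝒯.ι} (h : K ≠ L) :
    ∃ ν c, Separates ν c (𝒯.cell K) (𝒯.cell L) (𝒯.center K) (𝒯.center L) :=
  OptimalTransport.exists_separates (𝒯.convex_cell K) (𝒯.convex_cell L) (𝒯.disjoint_cell h)
    (𝒯.center_mem K) (𝒯.center_mem L)

lemma center_mem_cell (K : 𝒯.ι) : 𝒯.center K ∈ 𝒯.cell K := interior_subset (𝒯.center_mem K)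

lemma isClosed_face (K L : 𝒯.ι) : IsClosed (𝒯.face K L) :=
  isClosed_closure.inter isClosed_closure

lemma convex_face (K L : 𝒯.ι) : Convex ℝ (𝒯.face K L) :=
  (𝒯.convex_cell K).closure.inter (𝒯.convex_cell L).closure

lemma closure_cell_subset (hΩ : IsCompact Ω) (K : 𝒯.ι) : closure (𝒯.cell K) ⊆ Ω :=
  closure_minimal (𝒯.cell_subset K) hΩ.isClosed

lemma face_subset (hΩ : IsCompact Ω) (K L : 𝒯.ι) : 𝒯.face K L ⊆ Ω :=
  inter_subset_left.trans (𝒯.closure_cell_subset hΩ K)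

lemma ae_relative_interior_face {K L : 𝒯.ι} {ν : Rd d} {c : ℝ}
    (h : Separates ν c (𝒯.cell K) (𝒯.cell L) (𝒯.center K) (𝒯.center L)) :
    μHE[d - 1] {y ∈ 𝒯.face K L | ¬ ∀ᶠ w in 𝓝 y, ⟪ν, w⟫ = c → w ∈ 𝒯.face K L} = 0 :=
  ae_relative_interior h.norm_eq (𝒯.convex_face K L) fun _ hx => h.inner_eq hx

/-- Interfaces are almost disjoint from third cells. -/
lemma face_inter_closure_null {K L N : 𝒯.ι} (hKL : K ≠ L) (hKN : K ≠ N) (hLN : L ≠ N) :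
    μHE[d - 1] (𝒯.face K L ∩ closure (𝒯.cell N)) = 0 := by
  obtain ⟨ν, c, h⟩ := 𝒯.exists_separates hKL
  refine measure_mono_null ?_ (𝒯.ae_relative_interior_face h)
  rintro y ⟨hy, hyN⟩
  exact ⟨hy, fun hF => h.notMem_closure (𝒯.convex_cell K) (𝒯.convex_cell L) (𝒯.center_mem_cell K)
    (𝒯.center_mem_cell L) hy hF (𝒯.convex_cell N) ⟨_, 𝒯.center_mem N⟩ (𝒯.disjoint_cell hKN)
    (𝒯.disjoint_cell hLN) hyN⟩

lemma gap_pos {K L : 𝒯.ι} (h : K ≠ L) : 0 < 𝒯.gap K L :=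
  dist_pos.2 fun heq => (𝒯.disjoint_cell h).le_bot
    ⟨𝒯.center_mem_cell K, heq ▸ 𝒯.center_mem_cell L⟩

lemma gap_comm (K L : 𝒯.ι) : 𝒯.gap K L = 𝒯.gap L K := dist_comm _ _

lemma area_comm (K L : 𝒯.ι) : 𝒯.area K L = 𝒯.area L K := by
  rw [area, face_comm, area]

lemma gap_smul_normal {K L : 𝒯.ι} (h : K ≠ L) :
    𝒯.gap K L • 𝒯.normal K L = 𝒯.center L - 𝒯.center K := by
  rw [normal, smul_smul, mul_inv_cancel₀ (𝒯.gap_pos h).ne', one_smul]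

lemma norm_normal {K L : 𝒯.ι} (h : K ≠ L) : ‖𝒯.normal K L‖ = 1 := by
  rw [normal, norm_smul, norm_inv, Real.norm_of_nonneg (𝒯.gap_pos h).le, gap, dist_comm,
    dist_eq_norm, inv_mul_cancel₀]
  rw [← dist_eq_norm, dist_comm]
  exact (𝒯.gap_pos h).ne'

/-- Admissibility makes `x_L - x_K` orthogonal to an interface of positive area, hence parallel to
the separating normal; strict separation of the centres fixes the sign. -/
lemma normal_eq {K L : 𝒯.ι} (hA : 𝒯.Adj K L) {ν : Rd d} {c : ℝ}
    (h : Separates ν c (𝒯.cell K) (𝒯.cell L) (𝒯.center K) (𝒯.center L)) :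
    𝒯.normal K L = ν := by
  have hs := h.sub_eq_smul (𝒯.convex_cell K) (𝒯.convex_cell L) hA.2.ne' (𝒯.orthogonal K L hA)
  have hpos : 0 < ⟪ν, 𝒯.center L - 𝒯.center K⟫ := by
    rw [inner_sub_right]
    linarith [h.left_lt, h.lt_right]
  have hg : 𝒯.gap K L = ⟪ν, 𝒯.center L - 𝒯.center K⟫ := by
    rw [gap, dist_comm, dist_eq_norm]
    conv_lhs => rw [hs]
    rw [norm_smul, h.norm_eq, mul_one, Real.norm_of_nonneg hpos.le]
  rw [normal, hg]
  conv_lhs => rw [hs]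
  rw [inner_smul_right, smul_smul, real_inner_self_eq_norm_sq, h.norm_eq]
  field_simp
  simp

lemma face_lt_top (hΩ : IsCompact Ω) {K L : 𝒯.ι} (hKL : K ≠ L) : μHE[d - 1] (𝒯.face K L) < ⊤ := by
  obtain ⟨ν, c, h⟩ := 𝒯.exists_separates hKL
  obtain ⟨r, hr0, hr⟩ := hΩ.isBounded.subset_closedBall_lt 0 0
  refine (area_le_of_subset_closedBall h.norm_eq (fun x hx => h.inner_eq hx) hr0
    ((𝒯.face_subset hΩ K L).trans hr)).trans_lt ?_
  exact ENNReal.mul_lt_top ENNReal.ofReal_lt_top measure_ball_lt_top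

lemma Adj.ne {𝒯 : Mesh Ω} {K L : 𝒯.ι} (h : 𝒯.Adj K L) : K ≠ L := by
  rintro rfl
  exact h.1 rfl

lemma area_pos (hΩ : IsCompact Ω) {K L : 𝒯.ι} (h : 𝒯.Adj K L) : 0 < 𝒯.area K L :=
  ENNReal.toReal_pos h.2.ne' (𝒯.face_lt_top hΩ h.ne).ne

lemma area_gap_nonneg (K L : 𝒯.ι) : 0 ≤ 𝒯.area K L * 𝒯.gap K L :=
  mul_nonneg measureReal_nonneg dist_nonneg

lemma cell_ne {K L : 𝒯.ι} (h : K ≠ L) : 𝒯.cell K ≠ 𝒯.cell L := fun heq =>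
  (𝒯.disjoint_cell h).le_bot ⟨𝒯.center_mem_cell K, heq ▸ 𝒯.center_mem_cell K⟩

lemma face_null_of_not_adj {K L : 𝒯.ι} (h : K ≠ L) (hA : ¬ 𝒯.Adj K L) :
    μHE[d - 1] (𝒯.face K L) = 0 := by
  by_contra hne
  exact hA ⟨𝒯.cell_ne h, pos_iff_ne_zero.2 hne⟩

lemma faceMeasure_eq_comap (hΩ : IsCompact Ω) (K L : 𝒯.ι) : 𝒯.faceMeasure K L =
    ((μHE[d - 1] : Measure (Rd d)).restrict (𝒯.face K L)).comap Subtype.val := by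
  rw [faceMeasure, (MeasurableEmbedding.subtype_coe hΩ.measurableSet).restrict_comap,
    Subtype.image_preimage_coe, inter_eq_right.2 (𝒯.face_subset hΩ K L)]

lemma faceMeasure_apply (hΩ : IsCompact Ω) (K L : 𝒯.ι) {A : Set (Rd d)} (hA : MeasurableSet A)
    (hAΩ : A ⊆ Ω) :
    𝒯.faceMeasure K L (Subtype.val ⁻¹' A) = μHE[d - 1] (A ∩ 𝒯.face K L) := by
  rw [faceMeasure_eq_comap 𝒯 hΩ, comap_subtype_coe_apply hΩ.measurableSet,
    Subtype.image_preimage_coe, inter_eq_right.2 hAΩ, Measure.restrict_apply hA]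

lemma faceMeasure_univ (hΩ : IsCompact Ω) (K L : 𝒯.ι) :
    𝒯.faceMeasure K L univ = μHE[d - 1] (𝒯.face K L) := by
  have := 𝒯.faceMeasure_apply hΩ K L hΩ.measurableSet Subset.rfl
  rwa [Subtype.coe_preimage_self, inter_eq_right.2 (𝒯.face_subset hΩ K L)] at this

lemma isFiniteMeasure_faceMeasure (hΩ : IsCompact Ω) {K L : 𝒯.ι} (h : K ≠ L) :
    IsFiniteMeasure (𝒯.faceMeasure K L) :=
  ⟨by rw [𝒯.faceMeasure_univ hΩ]; exact 𝒯.face_lt_top hΩ h⟩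

lemma integral_faceMeasure (hΩ : IsCompact Ω) (K L : 𝒯.ι) {F : Type*} [NormedAddCommGroup F]
    [NormedSpace ℝ F] (f : Rd d → F) :
    ∫ x, f x ∂(𝒯.faceMeasure K L) = ∫ x in 𝒯.face K L, f x ∂μHE[d - 1] := by
  rw [faceMeasure_eq_comap 𝒯 hΩ, integral_subtype_comap hΩ.measurableSet,
    Measure.restrict_restrict hΩ.measurableSet, inter_eq_right.2 (𝒯.face_subset hΩ K L)]

lemma integrable_face (hΩ : IsCompact Ω) {K L : 𝒯.ι} (h : K ≠ L) {F : Type*}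
    [NormedAddCommGroup F] {f : Rd d → F} (hf : ContinuousOn f Ω) :
    IntegrableOn f (𝒯.face K L) μHE[d - 1] :=
  (hf.mono (𝒯.face_subset hΩ K L)).integrableOn_of_subset_isCompact
    (hΩ.of_isClosed_subset (𝒯.isClosed_face K L) (𝒯.face_subset hΩ K L))
    (𝒯.isClosed_face K L).measurableSet Subset.rfl (𝒯.face_lt_top hΩ h).ne

end Faces

/-! ### Reconstructed momenta and their total variation -/

section Reconstruction

lemma integrable_RY_summand (hΩ : IsCompact Ω) {K L : 𝒯.ι} (h : K ≠ L) {b : Ω → Rd d}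
    (hb : Continuous b) (c : ℝ) (n : Rd d) :
    (c • (𝒯.faceMeasure K L).withDensityᵥ (fun _ => n)).Integrable b := by
  have := 𝒯.isFiniteMeasure_faceMeasure hΩ h
  obtain ⟨C, hC⟩ := exists_norm_le_of_continuous hΩ hb
  exact (integrable_withDensityᵥ_of_bound (integrable_const _) hb.aestronglyMeasurable
    hC).smul_vectorMeasure c

lemma pairV_RY (hΩ : IsCompact Ω) (M : 𝒯.momenta) {b : Rd d → Rd d} (hb : ContinuousOn b Ω) :
    pairV (𝒯.RY M) (fun x => b x) = ∑ K, ∑ L ∈ 𝒯.nbrs K, 1 / 2 * M.1 K L * 𝒯.gap K L *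
      ∫ x in 𝒯.face K L, ⟪b x, 𝒯.normal K L⟫ ∂μHE[d - 1] := by
  have hb' : Continuous fun x : Ω => b x := hb.domRestrict
  obtain ⟨C, hC⟩ := exists_norm_le_of_continuous hΩ hb'
  have hI : ∀ K, ∀ L ∈ 𝒯.nbrs K, ((1 / 2 * M.1 K L * 𝒯.gap K L) •
      (𝒯.faceMeasure K L).withDensityᵥ (fun _ => 𝒯.normal K L)).Integrable fun x => b x :=
    fun K L hL => 𝒯.integrable_RY_summand hΩ (𝒯.mem_nbrs.1 hL).ne hb' _ _
  change VectorMeasure.integral (∑ K, ∑ L ∈ 𝒯.nbrs K, _) _ _ = _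
  rw [VectorMeasure.integral_finsetSum_vectorMeasure fun K _ =>
    VectorMeasure.Integrable.finsetSum_vectorMeasure (hI K)]
  refine Finset.sum_congr rfl fun K _ => ?_
  rw [VectorMeasure.integral_finsetSum_vectorMeasure (hI K)]
  refine Finset.sum_congr rfl fun L hL => ?_
  have := 𝒯.isFiniteMeasure_faceMeasure hΩ (𝒯.mem_nbrs.1 hL).ne
  rw [VectorMeasure.integral_smul_vectorMeasure, integral_withDensityᵥ (integrable_const _) _
    (integrable_withDensityᵥ_of_bound (integrable_const _) hb'.aestronglyMeasurable hC),
    ← 𝒯.integral_faceMeasure hΩ K L fun x => ⟪b x, 𝒯.normal K L⟫]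
  rfl

lemma variation_RY_ne_top (hΩ : IsCompact Ω) (M : 𝒯.momenta) : (𝒯.RY M).variation univ ≠ ⊤ := by
  have h1 : ∀ {κ : Type} (s : Finset κ) (μ : κ → VectorMeasure Ω (Rd d)),
      (∀ i ∈ s, (μ i).variation univ < ⊤) → (∑ i ∈ s, μ i).variation univ < ⊤ := by
    intro κ s μ h
    refine ((VectorMeasure.variation_finsetSum_le s μ) univ).trans_lt ?_
    rw [Measure.finsetSum_apply]
    exact ENNReal.sum_lt_top.2 h
  refine (h1 _ _ fun K _ => h1 _ _ fun L hL => ?_).ne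
  have := 𝒯.isFiniteMeasure_faceMeasure hΩ (𝒯.mem_nbrs.1 hL).ne
  have := isFiniteMeasure_variation_withDensityᵥ (μ := 𝒯.faceMeasure K L)
    (integrable_const (𝒯.normal K L))
  rw [VectorMeasure.variation_smul]
  exact measure_lt_top _ _

/-- The part of an interface which does not meet the closure of other cells. -/
def pureFace (K L : 𝒯.ι) : Set (Rd d) :=
  𝒯.face K L \ ⋃ N ∈ {N | N ≠ K ∧ N ≠ L}, closure (𝒯.cell N)

lemma measurableSet_pureFace (K L : 𝒯.ι) : MeasurableSet (𝒯.pureFace K L) :=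
  (𝒯.isClosed_face K L).measurableSet.diff
    (MeasurableSet.biUnion (to_countable _) fun _ _ => isClosed_closure.measurableSet)

lemma measure_pureFace {K L : 𝒯.ι} (h : K ≠ L) :
    μHE[d - 1] (𝒯.pureFace K L) = μHE[d - 1] (𝒯.face K L) := by
  refine measure_sdiff_null' ?_
  rw [inter_iUnion₂]
  exact (measure_biUnion_null_iff (to_countable _)).2 fun N hN =>
    𝒯.face_inter_closure_null h (Ne.symm hN.1) (Ne.symm hN.2)

lemma pureFace_inter_face_eq_empty {K L K' L' : 𝒯.ι} (hK' : K' ≠ L') (h : ¬ (K' = K ∧ L' = L))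
    (h' : ¬ (K' = L ∧ L' = K)) : 𝒯.pureFace K L ∩ 𝒯.face K' L' = ∅ := by
  rw [eq_empty_iff_forall_notMem]
  rintro x ⟨⟨-, hx⟩, hx'⟩
  simp only [mem_ofPred_eq, mem_iUnion, exists_prop, not_exists, not_and, and_imp] at hx
  by_cases h1 : K' = K ∨ K' = L
  · refine hx L' ?_ ?_ hx'.2
    · rintro rfl
      exact h1.elim hK' fun h2 => h' ⟨h2, rfl⟩
    · rintro rfl
      exact h1.elim (fun h2 => h ⟨h2, rfl⟩) hK'
  · push Not at h1
    exact hx K' h1.1 h1.2 hx'.1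

/-- Among all edges only `(K, L)` and `(L, K)` charge the pure part of the interface. Their
contributions are equal, since `M` and the normals both change sign under the swap, and this cancels
the factor `1/2`. -/
lemma RY_apply_pureFace (hΩ : IsCompact Ω) (M : 𝒯.momenta) {K L : 𝒯.ι} (hA : 𝒯.Adj K L) :
    𝒯.RY M (Subtype.val ⁻¹' 𝒯.pureFace K L) =
      (M.1 K L * 𝒯.gap K L * 𝒯.area K L) • 𝒯.normal K L := by
  classical
  have hmeas : MeasurableSet (Subtype.val ⁻¹' 𝒯.pureFace K L : Set Ω) :=
    measurable_subtype_coe (𝒯.measurableSet_pureFace K L)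
  have hsub : 𝒯.pureFace K L ⊆ 𝒯.face K L := sdiff_subset
  have hsubΩ := hsub.trans (𝒯.face_subset hΩ K L)
  have hval : ∀ K', ∀ L' ∈ 𝒯.nbrs K',
      ((1 / 2 * M.1 K' L' * 𝒯.gap K' L') • (𝒯.faceMeasure K' L').withDensityᵥ
        (fun _ => 𝒯.normal K' L')) (Subtype.val ⁻¹' 𝒯.pureFace K L) =
      (if K' = K ∧ L' = L then (1 / 2 * M.1 K L * 𝒯.gap K L * 𝒯.area K L) • 𝒯.normal K L else 0) +
      if K' = L ∧ L' = K then (1 / 2 * M.1 K L * 𝒯.gap K L * 𝒯.area K L) • 𝒯.normal K L else 0 := by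
    intro K' L' hL'
    have hne := (𝒯.mem_nbrs.1 hL').ne
    have := 𝒯.isFiniteMeasure_faceMeasure hΩ hne
    have h0 : ((𝒯.faceMeasure K' L').withDensityᵥ (fun _ => 𝒯.normal K' L'))
        (Subtype.val ⁻¹' 𝒯.pureFace K L) =
        (μHE[d - 1] (𝒯.pureFace K L ∩ 𝒯.face K' L')).toReal • 𝒯.normal K' L' := by
      rw [withDensityᵥ_apply (integrable_const _) hmeas, setIntegral_const, Measure.real,
        𝒯.faceMeasure_apply hΩ _ _ (𝒯.measurableSet_pureFace K L) hsubΩ]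
    change (1 / 2 * M.1 K' L' * 𝒯.gap K' L') • ((𝒯.faceMeasure K' L').withDensityᵥ
        (fun _ => 𝒯.normal K' L')) (Subtype.val ⁻¹' 𝒯.pureFace K L) = _
    rw [h0]
    by_cases h1 : K' = K ∧ L' = L
    · obtain ⟨rfl, rfl⟩ := h1
      rw [inter_eq_left.2 hsub, 𝒯.measure_pureFace hne, smul_smul]
      simp only [and_self, if_true]
      rw [if_neg fun h => hne h.1, add_zero]
      rfl
    · by_cases h2 : K' = L ∧ L' = K
      · obtain ⟨rfl, rfl⟩ := h2
        rw [𝒯.face_comm, inter_eq_left.2 hsub, 𝒯.measure_pureFace hA.ne, smul_smul, if_neg h1,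
          if_pos ⟨rfl, rfl⟩, zero_add, 𝒯.normal_swap L' K', 𝒯.gap_comm K' L', M.2.1 K' L', smul_neg,
          ← neg_smul]
        congr 1
        change _ = _ * _ * _ * (μHE[d - 1] (𝒯.face L' K')).toReal
        ring
      · rw [𝒯.pureFace_inter_face_eq_empty hne h1 h2, if_neg h1, if_neg h2]
        simp
  change (∑ K', ∑ L' ∈ 𝒯.nbrs K', _ : VectorMeasure Ω (Rd d)) _ = _
  rw [FunLike.coe_sum, Finset.sum_apply]
  simp only [FunLike.coe_sum, Finset.sum_apply]
  rw [Finset.sum_congr rfl fun K' _ => Finset.sum_congr rfl (hval K')]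
  simp only [Finset.sum_add_distrib, ite_and]
  simp only [Finset.sum_ite_irrel, Finset.sum_ite_eq', 𝒯.mem_nbrs, hA, (𝒯.adj_comm K L).1 hA,
    Finset.sum_const_zero, Finset.mem_univ, if_true]
  rw [← add_smul]
  congr 1
  ring

lemma sum_nbrs_comm {R : Type*} [AddCommMonoid R] (f : 𝒯.ι → 𝒯.ι → R) :
    ∑ K, ∑ L ∈ 𝒯.nbrs K, f K L = ∑ K, ∑ L ∈ 𝒯.nbrs K, f L K := by
  classical
  simp only [nbrs, Finset.sum_filter]
  rw [Finset.sum_comm]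
  refine Finset.sum_congr rfl fun K _ => Finset.sum_congr rfl fun L _ => ?_
  simp only [𝒯.adj_comm L K]

/-- The total variation norm of the reconstruction of a momentum. -/
lemma sum_abs_le_tvNorm_RY (hΩ : IsCompact Ω) (M : 𝒯.momenta) :
    ∑ K, ∑ L ∈ 𝒯.nbrs K, |M.1 K L| * (𝒯.area K L * 𝒯.gap K L) ≤ 2 * tvNorm (𝒯.RY M) := by
  classical
  set e := Fintype.equivFin 𝒯.ι
  -- An enumeration of the cells selects one orientation of each edge, so that the corresponding
  -- pure interfaces are pairwise disjoint. Summing over both orientations afterwards produces the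
  -- factor `2`.
  set s : Finset (𝒯.ι × 𝒯.ι) := {p | 𝒯.Adj p.1 p.2 ∧ e p.1 < e p.2} with hs
  have hdisj : (s : Set (𝒯.ι × 𝒯.ι)).PairwiseDisjoint
      fun p => (Subtype.val ⁻¹' 𝒯.pureFace p.1 p.2 : Set Ω) := by
    rintro ⟨K, L⟩ hp ⟨K', L'⟩ hp' hne
    simp only [hs, Finset.coe_filter, Finset.mem_univ, true_and, mem_ofPred_eq] at hp hp'
    refine Disjoint.preimage _ (disjoint_left.2 fun x hx hx' => ?_)
    refine (𝒯.pureFace_inter_face_eq_empty hp'.1.ne ?_ ?_).subset ⟨hx, hx'.1⟩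
    · rintro ⟨rfl, rfl⟩
      exact hne rfl
    · rintro ⟨rfl, rfl⟩
      exact lt_asymm hp.2 hp'.2
  have h := sum_norm_le_tvNorm (𝒯.RY M) (𝒯.variation_RY_ne_top hΩ M) s _
    (fun p _ => measurable_subtype_coe (𝒯.measurableSet_pureFace p.1 p.2)) hdisj
  have hval : ∀ p ∈ s, ‖𝒯.RY M (Subtype.val ⁻¹' 𝒯.pureFace p.1 p.2)‖ =
      |M.1 p.1 p.2| * (𝒯.area p.1 p.2 * 𝒯.gap p.1 p.2) := by
    intro p hp
    simp only [hs, Finset.mem_filter, Finset.mem_univ, true_and] at hp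
    rw [𝒯.RY_apply_pureFace hΩ M hp.1, norm_smul, 𝒯.norm_normal hp.1.ne, mul_one,
      Real.norm_eq_abs, mul_assoc, abs_mul, mul_comm (𝒯.gap _ _), abs_of_nonneg
      (𝒯.area_gap_nonneg _ _)]
  rw [Finset.sum_congr rfl hval] at h
  set f : 𝒯.ι → 𝒯.ι → ℝ := fun K L => |M.1 K L| * (𝒯.area K L * 𝒯.gap K L) with hf
  have hfsymm : ∀ K L, f K L = f L K := fun K L => by
    simp only [hf]
    rw [M.2.1 K L, abs_neg, 𝒯.area_comm, 𝒯.gap_comm]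
  set g : 𝒯.ι → 𝒯.ι → ℝ := fun K L => if e K < e L then f K L else 0 with hg
  have hsg : ∑ p ∈ s, f p.1 p.2 = ∑ K, ∑ L ∈ 𝒯.nbrs K, g K L := by
    simp only [hs, hg, nbrs, Finset.sum_filter, ← Finset.univ_product_univ, Finset.sum_product,
      ite_and]
  have hfg : ∀ K, ∀ L ∈ 𝒯.nbrs K, f K L = g K L + g L K := by
    intro K L hL
    have hne : e K ≠ e L := fun h => (𝒯.mem_nbrs.1 hL).ne (e.injective h)
    rcases lt_or_gt_of_ne hne with h | h
    · simp only [hg, h, if_true, if_neg h.le.not_gt, add_zero]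
    · simp only [hg, h, if_true, if_neg h.le.not_gt, zero_add, hfsymm K L]
  calc ∑ K, ∑ L ∈ 𝒯.nbrs K, f K L = ∑ K, ∑ L ∈ 𝒯.nbrs K, (g K L + g L K) :=
        Finset.sum_congr rfl fun K _ => Finset.sum_congr rfl (hfg K)
    _ = 2 * ∑ p ∈ s, f p.1 p.2 := by
      simp only [Finset.sum_add_distrib]
      rw [← 𝒯.sum_nbrs_comm g, hsg]
      ring
    _ ≤ 2 * tvNorm (𝒯.RY M) := by gcongr

end Reconstruction

end Mesh

/-! ### Regular meshes -/

lemma tendsto_stepToZero (S : Set ℝ) : Tendsto (fun σ : S => (σ : ℝ)) (stepToZero S) (𝓝 0) :=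
  tendsto_comap

lemma tendsto_const_mul_stepToZero (S : Set ℝ) (C : ℝ) :
    Tendsto (fun σ : S => C * (σ : ℝ)) (stepToZero S) (𝓝 0) := by
  simpa using (tendsto_stepToZero S).const_mul C

/-- The volume of the unit ball. -/
noncomputable def ballVol (d : ℕ) : ℝ := (volume : Measure (Rd d)).real (Metric.ball 0 1)

lemma ballVol_pos (d : ℕ) : 0 < ballVol d :=
  ENNReal.toReal_pos (Metric.measure_ball_pos _ _ one_pos).ne' measure_ball_lt_top.ne

lemma volume_real_closedBall {d : ℕ} (p : Rd d) {r : ℝ} (hr : 0 ≤ r) :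
    (volume : Measure (Rd d)).real (Metric.closedBall p r) = r ^ d * ballVol d := by
  rw [Measure.real, Measure.addHaar_closedBall _ _ hr, ENNReal.toReal_mul,
    ENNReal.toReal_ofReal (by positivity), finrank_euclideanSpace_fin]
  rfl

lemma volume_real_ball {d : ℕ} (p : Rd d) {r : ℝ} (hr : 0 < r) :
    (volume : Measure (Rd d)).real (Metric.ball p r) = r ^ d * ballVol d := by
  rw [Measure.real, Measure.addHaar_ball_of_pos _ _ hr, ENNReal.toReal_mul,
    ENNReal.toReal_ofReal (by positivity), finrank_euclideanSpace_fin]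
  rfl

namespace Mesh

variable {d : ℕ} {Ω : Set (Rd d)} (𝒯 : Mesh Ω)

/-- A mesh of step size `σ` is regular, with regularity constant `c`. -/
structure IsRegular (c σ : ℝ) : Prop where
  const_pos : 0 < c
  step_pos : 0 < σ
  diam_le : ∀ K, Metric.diam (𝒯.cell K) ≤ c⁻¹ * σ
  ball_subset : ∀ K, Metric.ball (𝒯.center K) (c * σ) ⊆ 𝒯.cell K
  area_ge : ∀ K L, 𝒯.Adj K L → c * σ ^ (d - 1) ≤ 𝒯.area K L

lemma _root_.OptimalTransport.UniformlyRegular.exists_isRegular {S : Set ℝ} {𝒯 : S → Mesh Ω}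
    (h : UniformlyRegular 𝒯) (hS : S ⊆ Ioi 0) : ∃ c, 0 < c ∧ ∀ σ, (𝒯 σ).IsRegular c σ := by
  obtain ⟨c, hc, h⟩ := h
  exact ⟨c, hc, fun σ => ⟨hc, hS σ.2, (h σ).1, (h σ).2.1, (h σ).2.2⟩⟩

lemma abs_setIntegral_cell_sub_le (hΩ : IsCompact Ω) (K : 𝒯.ι) {f : Rd d → ℝ}
    (hf : ContinuousOn f Ω) {a δ : ℝ} (hδ : ∀ x ∈ 𝒯.cell K, |f x - a| ≤ δ) :
    |(∫ x in 𝒯.cell K, f x) - 𝒯.vol K * a| ≤ δ * 𝒯.vol K := by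
  have hfin := 𝒯.volume_cell_lt_top hΩ K
  have h1 : (∫ x in 𝒯.cell K, f x) - 𝒯.vol K * a = ∫ x in 𝒯.cell K, (f x - a) := by
    rw [integral_sub ((hf.integrableOn_compact hΩ).mono_set (𝒯.cell_subset K))
      (integrableOn_const hfin.ne), setIntegral_const]
    rfl
  rw [h1, ← Real.norm_eq_abs]
  exact norm_setIntegral_le_of_norm_le_const hfin hδ

lemma abs_setIntegral_face_sub_le (hΩ : IsCompact Ω) {K L : 𝒯.ι} (h : K ≠ L) {f : Rd d → ℝ}
    (hf : ContinuousOn f Ω) {a δ : ℝ} (hδ : ∀ x ∈ 𝒯.face K L, |f x - a| ≤ δ) :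
    |(∫ x in 𝒯.face K L, f x ∂μHE[d - 1]) - 𝒯.area K L * a| ≤ δ * 𝒯.area K L := by
  have hfin := 𝒯.face_lt_top hΩ h
  have h1 : (∫ x in 𝒯.face K L, f x ∂μHE[d - 1]) - 𝒯.area K L * a =
      ∫ x in 𝒯.face K L, (f x - a) ∂μHE[d - 1] := by
    rw [integral_sub (𝒯.integrable_face hΩ h hf) (integrableOn_const hfin.ne), setIntegral_const]
    rfl
  rw [h1, ← Real.norm_eq_abs]
  exact norm_setIntegral_le_of_norm_le_const hfin hδ

lemma sum_vol (hΩ : IsCompact Ω) : ∑ K, 𝒯.vol K = volume.real Ω := by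
  have := 𝒯.sum_setIntegral_cell hΩ (f := fun _ => (1 : ℝ)) continuousOn_const
  simpa [vol] using this

namespace IsRegular

variable {𝒯} {c σ : ℝ} (hR : 𝒯.IsRegular c σ) (hΩ : IsCompact Ω)

include hR

lemma mul_pos : 0 < c * σ := _root_.mul_pos hR.const_pos hR.step_pos

lemma inv_mul_pos : 0 < c⁻¹ * σ := _root_.mul_pos (inv_pos.2 hR.const_pos) hR.step_pos

include hΩ

lemma dist_le (K : 𝒯.ι) {x y : Rd d} (hx : x ∈ closure (𝒯.cell K)) (hy : y ∈ closure (𝒯.cell K)) :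
    dist x y ≤ c⁻¹ * σ := by
  have hb : Bornology.IsBounded (closure (𝒯.cell K)) :=
    hΩ.isBounded.subset (𝒯.closure_cell_subset hΩ K)
  refine (Metric.dist_le_diam_of_mem hb hx hy).trans ?_
  rw [Metric.diam_closure]
  exact hR.diam_le K

lemma dist_center_le (K : 𝒯.ι) {x : Rd d} (hx : x ∈ 𝒯.cell K) : dist x (𝒯.center K) ≤ c⁻¹ * σ :=
  hR.dist_le hΩ K (subset_closure hx) (subset_closure (𝒯.center_mem_cell K))

lemma dist_center_left_le {K L : 𝒯.ι} {x : Rd d} (hx : x ∈ 𝒯.face K L) :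
    dist (𝒯.center K) x ≤ c⁻¹ * σ :=
  hR.dist_le hΩ K (subset_closure (𝒯.center_mem_cell K)) hx.1

lemma dist_center_right_le {K L : 𝒯.ι} {x : Rd d} (hx : x ∈ 𝒯.face K L) :
    dist (𝒯.center L) x ≤ c⁻¹ * σ :=
  hR.dist_le hΩ L (subset_closure (𝒯.center_mem_cell L)) hx.2

lemma gap_le {K L : 𝒯.ι} (h : 𝒯.Adj K L) : 𝒯.gap K L ≤ 2 * (c⁻¹ * σ) := by
  obtain ⟨x, hx⟩ : (𝒯.face K L).Nonempty := by
    by_contra hne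
    have := h.2
    rw [show interface (𝒯.cell K) (𝒯.cell L) = ∅ from not_nonempty_iff_eq_empty.1 hne] at this
    simp at this
  have h1 := hR.dist_center_left_le hΩ hx
  have h2 := hR.dist_center_right_le hΩ hx
  have := dist_triangle_right (𝒯.center K) (𝒯.center L) x
  rw [gap]
  linarith

lemma dist_cell_le {K L : 𝒯.ι} (h : 𝒯.Adj K L) {x : Rd d} (hx : x ∈ 𝒯.cell L) :
    dist x (𝒯.center K) ≤ 3 * (c⁻¹ * σ) := by
  have h1 := hR.dist_center_le hΩ L hx
  have h2 := hR.gap_le hΩ h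
  have := dist_triangle x (𝒯.center L) (𝒯.center K)
  rw [gap, dist_comm] at h2
  linarith

lemma vol_le (K : 𝒯.ι) : 𝒯.vol K ≤ (c⁻¹ * σ) ^ d * ballVol d := by
  rw [← volume_real_closedBall (𝒯.center K) hR.inv_mul_pos.le]
  exact measureReal_mono (fun x hx => hR.dist_center_le hΩ K hx) measure_closedBall_lt_top.ne

lemma vol_ge (K : 𝒯.ι) : (c * σ) ^ d * ballVol d ≤ 𝒯.vol K := by
  rw [← volume_real_ball (𝒯.center K) hR.mul_pos]
  exact measureReal_mono (hR.ball_subset K) (𝒯.volume_cell_lt_top hΩ K).ne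

lemma area_le {K L : 𝒯.ι} (h : K ≠ L) :
    𝒯.area K L ≤ 2 ^ d * (c⁻¹ * σ) ^ (d - 1) * ballVol d := by
  obtain ⟨ν, e, hs⟩ := 𝒯.exists_separates h
  have := area_le_of_subset_closedBall (F := 𝒯.face K L) (p := 𝒯.center K) hs.norm_eq
    (fun x hx => hs.inner_eq hx) hR.inv_mul_pos
    fun x hx => by rw [Metric.mem_closedBall, dist_comm]; exact hR.dist_center_left_le hΩ hx
  have h2 := ENNReal.toReal_mono
    (ENNReal.mul_lt_top ENNReal.ofReal_lt_top measure_ball_lt_top).ne this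
  rwa [ENNReal.toReal_mul, ENNReal.toReal_ofReal (by have := hR.inv_mul_pos; positivity)] at h2

omit hΩ in
/-- The number of cells with centers in a ball. -/
lemma card_mul_pow_le (s : Finset 𝒯.ι) (p : Rd d) {R : ℝ} (hR0 : 0 ≤ R)
    (hs : ∀ K ∈ s, dist (𝒯.center K) p ≤ R) : (s.card : ℝ) * (c * σ) ^ d ≤ (R + c * σ) ^ d := by
  have hpos := hR.mul_pos
  -- Packing: the balls of radius `cσ` around the centres are disjoint and all lie in the ball of
  -- radius `R + cσ` around `p`; their volumes are compared.
  have hdisj : (s : Set 𝒯.ι).PairwiseDisjoint fun K => Metric.ball (𝒯.center K) (c * σ) :=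
    fun K _ L _ h => (𝒯.disjoint_cell h).mono (hR.ball_subset K) (hR.ball_subset L)
  have hsub : ⋃ K ∈ s, Metric.ball (𝒯.center K) (c * σ) ⊆ Metric.closedBall p (R + c * σ) := by
    refine iUnion₂_subset fun K hK x hx => ?_
    have := dist_triangle x (𝒯.center K) p
    have h1 := hs K hK
    have h2 : dist x (𝒯.center K) < c * σ := hx
    rw [Metric.mem_closedBall]
    linarith
  have h1 := measureReal_mono (μ := volume) hsub measure_closedBall_lt_top.ne
  rw [measureReal_biUnion_finset hdisj (fun _ _ => measurableSet_ball)
    (fun _ _ => measure_ball_lt_top.ne)] at h1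
  rw [Finset.sum_congr rfl fun K _ => volume_real_ball (𝒯.center K) hpos, Finset.sum_const,
    nsmul_eq_mul, volume_real_closedBall p (by positivity), ← mul_assoc] at h1
  exact le_of_mul_le_mul_right h1 (ballVol_pos d)

lemma card_nbrs_le (K : 𝒯.ι) : ((𝒯.nbrs K).card : ℝ) ≤ ((2 * c⁻¹ + c) / c) ^ d := by
  have h := hR.card_mul_pow_le (𝒯.nbrs K) (𝒯.center K) (R := 2 * (c⁻¹ * σ))
    (by have := hR.inv_mul_pos; positivity) fun L hL => by
      rw [dist_comm]
      exact hR.gap_le hΩ (𝒯.mem_nbrs.1 hL)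
  have hc := hR.const_pos
  have hσ := hR.step_pos
  rw [← le_div_iff₀ (by positivity), ← div_pow] at h
  have heq : (2 * (c⁻¹ * σ) + c * σ) / (c * σ) = (2 * c⁻¹ + c) / c := by
    rw [← mul_assoc, ← add_mul, mul_div_mul_right _ _ hσ.ne']
  rwa [heq] at h

/-- The sum of the products of areas and gaps around a cell is controlled by the volume of the
cell. -/
lemma sum_area_mul_gap_le (K : 𝒯.ι) : ∑ L ∈ 𝒯.nbrs K, 𝒯.area K L * 𝒯.gap K L ≤
    ((2 * c⁻¹ + c) / c) ^ d * (2 ^ (d + 1) * (c⁻¹ * c⁻¹) ^ d) * 𝒯.vol K := by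
  have hc := hR.const_pos
  have hσ := hR.step_pos
  have hω := ballVol_pos d
  have h1 : ∀ L ∈ 𝒯.nbrs K, 𝒯.area K L * 𝒯.gap K L ≤
      2 ^ (d + 1) * (c⁻¹ * σ) ^ d * ballVol d := by
    intro L hL
    have hA := 𝒯.mem_nbrs.1 hL
    -- Needed because `d - 1` is truncated. In dimension `0` all centres coincide, so distinct cells
    -- cannot exist.
    have hd : d ≠ 0 := by
      rintro rfl
      exact hA.ne (by_contra fun h => (𝒯.gap_pos h).ne'
        (by simp [gap, Subsingleton.elim (𝒯.center K) (𝒯.center L)]))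
    calc 𝒯.area K L * 𝒯.gap K L ≤
        (2 ^ d * (c⁻¹ * σ) ^ (d - 1) * ballVol d) * (2 * (c⁻¹ * σ)) :=
          mul_le_mul (hR.area_le hΩ hA.ne) (hR.gap_le hΩ hA) dist_nonneg (by positivity)
      _ = 2 ^ (d + 1) * ((c⁻¹ * σ) ^ (d - 1) * (c⁻¹ * σ)) * ballVol d := by ring
      _ = _ := by rw [← pow_succ, Nat.sub_add_cancel (Nat.one_le_iff_ne_zero.2 hd)]
  calc ∑ L ∈ 𝒯.nbrs K, 𝒯.area K L * 𝒯.gap K L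
      ≤ (𝒯.nbrs K).card • (2 ^ (d + 1) * (c⁻¹ * σ) ^ d * ballVol d) :=
        Finset.sum_le_card_nsmul _ _ _ h1
    _ ≤ ((2 * c⁻¹ + c) / c) ^ d * (2 ^ (d + 1) * (c⁻¹ * σ) ^ d * ballVol d) := by
      rw [nsmul_eq_mul]
      exact mul_le_mul_of_nonneg_right (hR.card_nbrs_le hΩ K) (by positivity)
    _ = ((2 * c⁻¹ + c) / c) ^ d * (2 ^ (d + 1) * (c⁻¹ * c⁻¹) ^ d) * ((c * σ) ^ d * ballVol d) := by
      have : (c⁻¹ * σ) ^ d = (c⁻¹ * c⁻¹) ^ d * (c * σ) ^ d := by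
        rw [← mul_pow]
        congr 1
        field_simp
      rw [this]
      ring
    _ ≤ _ := mul_le_mul_of_nonneg_left (hR.vol_ge hΩ K) (by positivity)

end IsRegular

/-! ### Sampling and reconstruction of densities -/

section Consistency

variable {c σ : ℝ}

/-- Reconstructing a sampled measure moves the mass of each cell to its centre, so the error is the
oscillation of `φ` inside cells times the total mass. -/
lemma abs_pair_RCE_SX_sub_le (hΩ : IsCompact Ω) (μ : Measure Ω) [IsFiniteMeasure μ] (φ : C(Ω, ℝ))
    {δ : ℝ} (hφ : ∀ K, ∀ x : Ω, x.1 ∈ 𝒯.cell K →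
      |φ ⟨𝒯.center K, 𝒯.center_mem_domain K⟩ - φ x| ≤ δ) :
    |pair (𝒯.RCE (𝒯.SX μ.toSignedMeasure)) φ - pair μ.toSignedMeasure φ| ≤ δ * μ.real univ := by
  have := isCompact_iff_compactSpace.1 hΩ
  have hint : Integrable φ μ := φ.continuous.integrable_of_hasCompactSupport
    (HasCompactSupport.of_compactSpace _)
  have h1 : ∫ x, φ x ∂μ = ∑ K, ∫ x in 𝒯.cellOn K, φ x ∂μ := by
    rw [← integral_iUnion_fintype 𝒯.measurableSet_cellOn 𝒯.pairwise_disjoint_cellOn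
      (fun K => hint.integrableOn), 𝒯.iUnion_cellOn, setIntegral_univ]
  have h2 : μ.real univ = ∑ K, μ.real (𝒯.cellOn K) := by
    rw [← 𝒯.iUnion_cellOn, measureReal_iUnion_fintype 𝒯.pairwise_disjoint_cellOn
      𝒯.measurableSet_cellOn]
  rw [𝒯.pair_RCE, pair_toSignedMeasure, h1, ← Finset.sum_sub_distrib, h2, Finset.mul_sum]
  refine (Finset.abs_sum_le_sum_abs _ _).trans (Finset.sum_le_sum fun K _ => ?_)
  have h3 : 𝒯.SX μ.toSignedMeasure K * 𝒯.vol K = μ.real (𝒯.cellOn K) := by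
    change μ.toSignedMeasure (𝒯.cellOn K) / _ * _ = _
    rw [div_mul_cancel₀ _ (𝒯.vol_pos hΩ K).ne',
      Measure.toSignedMeasure_apply_measurable (𝒯.measurableSet_cellOn K)]
  rw [h3]
  set a := φ ⟨𝒯.center K, 𝒯.center_mem_domain K⟩
  have h4 : μ.real (𝒯.cellOn K) * a - ∫ x in 𝒯.cellOn K, φ x ∂μ =
      ∫ x in 𝒯.cellOn K, (a - φ x) ∂μ := by
    rw [integral_sub (integrable_const _) hint.integrableOn, setIntegral_const, smul_eq_mul]
  rw [h4, ← Real.norm_eq_abs]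
  exact norm_setIntegral_le_of_norm_le_const (measure_lt_top _ _) fun x hx => hφ K x hx

/-- On each cell the value of `φ` at the centre is compared with its mean; the Lipschitz bound and
the diameter bound give `C c⁻¹ σ`. -/
lemma abs_pair_RCE_sub_RA_le (hR : 𝒯.IsRegular c σ) (hΩ : IsCompact Ω) (P : 𝒯.ι → ℝ)
    {φ : Rd d → ℝ} {C : ℝ} (hC : 0 ≤ C) (hφ : ContinuousOn φ Ω)
    (hlip : ∀ x ∈ Ω, ∀ y ∈ Ω, ‖φ x - φ y‖ ≤ C * ‖x - y‖) :
    pair (𝒯.RCE P - 𝒯.RA P) (fun x => φ x) ≤ C * c⁻¹ * σ * tvNorm (𝒯.RCE P) := by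
  rw [𝒯.pair_RCE_sub_RA hΩ P hφ]
  have hnn : 0 ≤ C * c⁻¹ * σ := by
    rw [mul_assoc]
    exact mul_nonneg hC hR.inv_mul_pos.le
  refine le_trans ?_ (mul_le_mul_of_nonneg_left (𝒯.sum_abs_le_tvNorm_RCE hΩ P) hnn)
  rw [Finset.mul_sum]
  refine Finset.sum_le_sum fun K _ => (le_abs_self _).trans ?_
  have h1 := 𝒯.abs_setIntegral_cell_sub_le hΩ K hφ (a := φ (𝒯.center K)) (δ := C * c⁻¹ * σ)
    fun x hx => by
      refine (hlip x (𝒯.cell_subset K hx) _ (𝒯.center_mem_domain K)).trans ?_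
      rw [mul_assoc, ← dist_eq_norm]
      exact mul_le_mul_of_nonneg_left (hR.dist_center_le hΩ K hx) hC
  rw [abs_mul, abs_sub_comm]
  calc |P K| * _ ≤ |P K| * (C * c⁻¹ * σ * 𝒯.vol K) := by gcongr
    _ = _ := by ring

/-- Summation by parts: areas are symmetric and `M` is antisymmetric, so the sum equals its swapped
version and may be replaced by the average of the two. The volumes cancel. -/
lemma pair_RCE_discreteDiv (hΩ : IsCompact Ω) (M : 𝒯.momenta) (φ : Rd d → ℝ) :
    pair (𝒯.RCE (𝒯.discreteDiv M)) (fun x => φ x) = ∑ K, ∑ L ∈ 𝒯.nbrs K,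
      1 / 2 * M.1 K L * (𝒯.area K L * (φ (𝒯.center K) - φ (𝒯.center L))) := by
  have h1 : pair (𝒯.RCE (𝒯.discreteDiv M)) (fun x => φ x) =
      ∑ K, ∑ L ∈ 𝒯.nbrs K, M.1 K L * 𝒯.area K L * φ (𝒯.center K) := by
    rw [𝒯.pair_RCE]
    refine Finset.sum_congr rfl fun K _ => ?_
    change (∑ L ∈ 𝒯.nbrs K, _) * _ * _ = _
    rw [Finset.sum_mul, Finset.sum_mul]
    refine Finset.sum_congr rfl fun L _ => ?_
    have := (𝒯.vol_pos hΩ K).ne'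
    field_simp
  have h2 : ∑ K, ∑ L ∈ 𝒯.nbrs K, M.1 K L * 𝒯.area K L * φ (𝒯.center K) =
      ∑ K, ∑ L ∈ 𝒯.nbrs K, -(M.1 K L * 𝒯.area K L * φ (𝒯.center L)) := by
    rw [𝒯.sum_nbrs_comm]
    refine Finset.sum_congr rfl fun K _ => Finset.sum_congr rfl fun L _ => ?_
    rw [M.2.1 L K, 𝒯.area_comm L K]
    ring
  have h3 : ∑ K, ∑ L ∈ 𝒯.nbrs K, M.1 K L * 𝒯.area K L * φ (𝒯.center K) =
      1 / 2 * (∑ K, ∑ L ∈ 𝒯.nbrs K, M.1 K L * 𝒯.area K L * φ (𝒯.center K)) +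
      1 / 2 * (∑ K, ∑ L ∈ 𝒯.nbrs K, -(M.1 K L * 𝒯.area K L * φ (𝒯.center L))) := by
    rw [← h2]
    ring
  rw [h1, h3, Finset.mul_sum, Finset.mul_sum, ← Finset.sum_add_distrib]
  refine Finset.sum_congr rfl fun K _ => ?_
  rw [Finset.mul_sum, Finset.mul_sum, ← Finset.sum_add_distrib]
  exact Finset.sum_congr rfl fun L _ => by ring

/-- Since `d_KL n_KL = x_L - x_K`, Taylor's formula at the points of the interface gives on each
edge an error at most `C c⁻¹ σ` relative to `|M_KL| |(K|L)| d_KL / 2`. The sum of these weights is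
at most the total variation norm. -/
lemma abs_pair_discreteDiv_add_le (hR : 𝒯.IsRegular c σ) (hΩ : IsCompact Ω) (M : 𝒯.momenta)
    {φ : Rd d → ℝ} {g : Rd d → Rd d} {C : ℝ} (hC : 0 ≤ C) (hg : ContinuousOn g Ω)
    (hφ : ∀ x ∈ Ω, ∀ a ∈ Ω, ∀ b ∈ Ω, ∀ r : ℝ, dist a x ≤ r → dist b x ≤ r →
        |φ b - φ a - ⟪g x, b - a⟫| ≤ C * r * ‖b - a‖) :
    |pair (𝒯.RCE (𝒯.discreteDiv M)) (fun x => φ x) + pairV (𝒯.RY M) (fun x => g x)| ≤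
      C * c⁻¹ * σ * tvNorm (𝒯.RY M) := by
  have hnn : 0 ≤ C * c⁻¹ * σ := by
    rw [mul_assoc]
    exact mul_nonneg hC hR.inv_mul_pos.le
  rw [𝒯.pair_RCE_discreteDiv hΩ, 𝒯.pairV_RY hΩ M hg]
  simp only [← Finset.sum_add_distrib]
  have key : ∀ K, ∀ L ∈ 𝒯.nbrs K,
      |1 / 2 * M.1 K L * (𝒯.area K L * (φ (𝒯.center K) - φ (𝒯.center L))) +
        1 / 2 * M.1 K L * 𝒯.gap K L * ∫ x in 𝒯.face K L, ⟪g x, 𝒯.normal K L⟫ ∂μHE[d - 1]| ≤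
      C * c⁻¹ * σ * (1 / 2) * (|M.1 K L| * (𝒯.area K L * 𝒯.gap K L)) := by
    intro K L hL
    have hne := (𝒯.mem_nbrs.1 hL).ne
    have hgap := 𝒯.gap_pos hne
    have h1 := 𝒯.abs_setIntegral_face_sub_le hΩ hne
      (f := fun x => ⟪g x, 𝒯.normal K L⟫) (hg.inner continuousOn_const)
      (a := (φ (𝒯.center L) - φ (𝒯.center K)) / 𝒯.gap K L) (δ := C * c⁻¹ * σ) fun x hx => by
        have := hφ x (𝒯.face_subset hΩ K L hx) _ (𝒯.center_mem_domain K) _ (𝒯.center_mem_domain L)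
          _ (hR.dist_center_left_le hΩ hx) (hR.dist_center_right_le hΩ hx)
        have hn : ‖𝒯.center L - 𝒯.center K‖ = 𝒯.gap K L := by
          rw [← dist_eq_norm, dist_comm, gap]
        rw [hn, ← 𝒯.gap_smul_normal hne, real_inner_smul_right] at this
        have h2 : ⟪g x, 𝒯.normal K L⟫ - (φ (𝒯.center L) - φ (𝒯.center K)) / 𝒯.gap K L =
            -((φ (𝒯.center L) - φ (𝒯.center K) - 𝒯.gap K L * ⟪g x, 𝒯.normal K L⟫) /
              𝒯.gap K L) := by
          field_simp
          ring
        rw [h2, abs_neg, abs_div, abs_of_pos hgap, div_le_iff₀ hgap]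
        calc _ ≤ _ := this
          _ = _ := by ring
    have h3 : 1 / 2 * M.1 K L * (𝒯.area K L * (φ (𝒯.center K) - φ (𝒯.center L))) +
        1 / 2 * M.1 K L * 𝒯.gap K L * ∫ x in 𝒯.face K L, ⟪g x, 𝒯.normal K L⟫ ∂μHE[d - 1] =
        1 / 2 * M.1 K L * 𝒯.gap K L * ((∫ x in 𝒯.face K L, ⟪g x, 𝒯.normal K L⟫ ∂μHE[d - 1]) -
          𝒯.area K L * ((φ (𝒯.center L) - φ (𝒯.center K)) / 𝒯.gap K L)) := by
      field_simp
      ring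
    rw [h3, abs_mul, abs_mul, abs_mul, abs_of_pos hgap, abs_of_pos (by norm_num : (0 : ℝ) < 1 / 2)]
    calc _ ≤ 1 / 2 * |M.1 K L| * 𝒯.gap K L * (C * c⁻¹ * σ * 𝒯.area K L) := by gcongr
      _ = _ := by ring
  refine (Finset.abs_sum_le_sum_abs _ _).trans ?_
  calc ∑ K, |∑ L ∈ 𝒯.nbrs K, _| ≤ ∑ K, ∑ L ∈ 𝒯.nbrs K,
        C * c⁻¹ * σ * (1 / 2) * (|M.1 K L| * (𝒯.area K L * 𝒯.gap K L)) :=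
        Finset.sum_le_sum fun K _ => (Finset.abs_sum_le_sum_abs _ _).trans
          (Finset.sum_le_sum (key K))
    _ = C * c⁻¹ * σ * (1 / 2) *
        ∑ K, ∑ L ∈ 𝒯.nbrs K, (|M.1 K L| * (𝒯.area K L * 𝒯.gap K L)) := by
      simp only [Finset.mul_sum]
    _ ≤ C * c⁻¹ * σ * (1 / 2) * (2 * tvNorm (𝒯.RY M)) :=
      mul_le_mul_of_nonneg_left (𝒯.sum_abs_le_tvNorm_RY hΩ M) (by positivity)
    _ = _ := by ring

end Consistency

end Mesh

/-! ### Consistency along a family of meshes -/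

section Family

variable {d : ℕ} {Ω : Set (Rd d)} {S : Set ℝ} {𝒯 : S → Mesh Ω} {c : ℝ}

theorem tendsto_pair_RCE_SX (hΩ : IsCompact Ω) (hR : ∀ σ, (𝒯 σ).IsRegular c σ)
    {ρ : SignedMeasure Ω} (hρ : 0 ≤ ρ) (φ : C(Ω, ℝ)) :
    Tendsto (fun σ => pair ((𝒯 σ).RCE ((𝒯 σ).SX ρ)) φ) (stepToZero S) (𝓝 (pair ρ φ)) := by
  obtain ⟨μ, hμ, rfl⟩ := exists_measure_of_nonneg hρ
  have := isCompact_iff_compactSpace.1 hΩ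
  have huc := CompactSpace.uniformContinuous_of_continuous φ.continuous
  rw [Metric.tendsto_nhds]
  intro ε hε
  have hm : 0 < μ.real univ + 1 := by have : 0 ≤ μ.real univ := measureReal_nonneg; positivity
  obtain ⟨δ, hδ, hφ⟩ := Metric.uniformContinuous_iff.1 huc (ε / (μ.real univ + 1)) (by positivity)
  filter_upwards [(tendsto_const_mul_stepToZero S c⁻¹).eventually (gt_mem_nhds hδ)] with σ hσ
  have h := (𝒯 σ).abs_pair_RCE_SX_sub_le hΩ μ φ (δ := ε / (μ.real univ + 1)) fun K x hx => by
    refine (hφ ?_).le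
    rw [dist_comm]
    exact ((hR σ).dist_center_le hΩ K hx).trans_lt hσ
  rw [Real.dist_eq]
  refine h.trans_lt ?_
  rw [div_mul_eq_mul_div, div_lt_iff₀ hm]
  exact mul_lt_mul_of_pos_left (lt_add_one _) hε

theorem exists_reconstructions_equivalent (hΩ : IsCompact Ω) (hconv : Convex ℝ Ω)
    (hint : (interior Ω).Nonempty) (hR : ∀ σ, (𝒯 σ).IsRegular c σ) {B : Set (Rd d → ℝ)}
    (hB : IsBoundedInC 1 Ω B) :
    ∃ ε : S → ℝ, Tendsto ε (stepToZero S) (𝓝 0) ∧ ∀ σ, ∀ φ ∈ B, ∀ P : (𝒯 σ).ι → ℝ,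
      pair ((𝒯 σ).RCE P - (𝒯 σ).RA P) (fun x => φ x) ≤ ε σ * tvNorm ((𝒯 σ).RCE P) := by
  obtain ⟨C, hC, h⟩ := hB.exists_bound hconv hint
  exact ⟨_, tendsto_const_mul_stepToZero S (C * c⁻¹), fun σ φ hφ P =>
    (𝒯 σ).abs_pair_RCE_sub_RA_le (hR σ) hΩ P hC (h φ hφ).1 (h φ hφ).2.2⟩

theorem exists_reconstruction_derivation (hΩ : IsCompact Ω) (hconv : Convex ℝ Ω)
    (hint : (interior Ω).Nonempty) (hR : ∀ σ, (𝒯 σ).IsRegular c σ) {B : Set (Rd d → ℝ)}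
    (hB : IsBoundedInC 2 Ω B) :
    ∃ ε : S → ℝ, Tendsto ε (stepToZero S) (𝓝 0) ∧ ∀ σ, ∀ M : (𝒯 σ).momenta, ∀ φ ∈ B,
      |pair ((𝒯 σ).RCE ((𝒯 σ).discreteDiv M)) (fun x => φ x) +
          pairV ((𝒯 σ).RY M) (fun x => gradientWithin φ Ω x)| ≤ ε σ * tvNorm ((𝒯 σ).RY M) := by
  obtain ⟨C, hC, h⟩ := hB.exists_taylor hconv hint
  exact ⟨_, tendsto_const_mul_stepToZero S (C * c⁻¹), fun σ M φ hφ =>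
    (𝒯 σ).abs_pair_discreteDiv_add_le (hR σ) hΩ M hC (h φ hφ).2.1 (h φ hφ).2.2⟩

end Family

/-! ### Estimates for the discrete action -/

namespace Mesh

variable {d : ℕ} {Ω : Set (Rd d)} (𝒯 : Mesh Ω) {θ : ℝ → ℝ → ℝ}

lemma discreteAction_eq_ofReal (hθ : IsAdmissibleMean θ) {P : 𝒯.ι → ℝ} (hP : ∀ K, 0 ≤ P K)
    {M : 𝒯.momenta} (h : ∀ K, ∀ L ∈ 𝒯.nbrs K, θ (P K) (P L) = 0 → M.1 K L = 0) :
    𝒯.discreteAction θ P M = ENNReal.ofReal (∑ K, ∑ L ∈ 𝒯.nbrs K,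
      M.1 K L ^ 2 / (4 * θ (P K) (P L)) * (𝒯.area K L * 𝒯.gap K L)) := by
  have h0 : ∀ K L, 0 ≤ M.1 K L ^ 2 / (4 * θ (P K) (P L)) := fun K L =>
    div_nonneg (sq_nonneg _) (mul_nonneg (by norm_num) (hθ.nonneg _ _ (hP K) (hP L)))
  have hnn : ∀ K L, 0 ≤ M.1 K L ^ 2 / (4 * θ (P K) (P L)) * (𝒯.area K L * 𝒯.gap K L) :=
    fun K L => mul_nonneg (h0 K L) (𝒯.area_gap_nonneg K L)
  rw [𝒯.discreteAction_of_nonneg hP,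
    ENNReal.ofReal_sum_of_nonneg fun K _ => Finset.sum_nonneg fun L _ => hnn K L]
  refine Finset.sum_congr rfl fun K _ => ?_
  rw [ENNReal.ofReal_sum_of_nonneg fun L _ => hnn K L]
  refine Finset.sum_congr rfl fun L hL => ?_
  rw [ENNReal.ofReal_mul (h0 K L), ofReal_sq_div_ofReal
    (mul_nonneg (by norm_num) (hθ.nonneg _ _ (hP K) (hP L))) fun h4 => h K L hL (by simpa using h4)]

/-- The area and the gap of an edge are positive, so the weight of the edge does not turn the
infinite quotient into zero. -/
lemma discreteAction_eq_top (hΩ : IsCompact Ω) {P : 𝒯.ι → ℝ} (hP : ∀ K, 0 ≤ P K)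
    {M : 𝒯.momenta} {K L : 𝒯.ι} (hL : L ∈ 𝒯.nbrs K) (hθ0 : θ (P K) (P L) = 0)
    (hM : M.1 K L ≠ 0) : 𝒯.discreteAction θ P M = ⊤ := by
  have hA := 𝒯.mem_nbrs.1 hL
  have h1 : ENNReal.ofReal (M.1 K L ^ 2) ≠ 0 := by simpa using hM
  have h2 : ENNReal.ofReal (𝒯.area K L * 𝒯.gap K L) ≠ 0 := by
    simpa using mul_pos (𝒯.area_pos hΩ hA) (𝒯.gap_pos hA.ne)
  have h3 : ENNReal.ofReal (M.1 K L ^ 2) / ENNReal.ofReal (4 * θ (P K) (P L)) *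
      ENNReal.ofReal (𝒯.area K L * 𝒯.gap K L) = ⊤ := by
    rw [hθ0, mul_zero, ENNReal.ofReal_zero, ENNReal.div_zero h1, ENNReal.top_mul h2]
  rw [𝒯.discreteAction_of_nonneg hP, ENNReal.sum_eq_top]
  exact ⟨K, Finset.mem_univ K, ENNReal.sum_eq_top.2 ⟨L, hL, h3⟩⟩

/-- The mean of the normal component of a vector field over an interface. -/
noncomputable def faceMean (b : Rd d → Rd d) (K L : 𝒯.ι) : ℝ :=
  (∫ x in 𝒯.face K L, ⟪b x, 𝒯.normal K L⟫ ∂μHE[d - 1]) / 𝒯.area K L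

lemma faceMean_swap (b : Rd d → Rd d) (K L : 𝒯.ι) : 𝒯.faceMean b L K = -𝒯.faceMean b K L := by
  rw [faceMean, faceMean, 𝒯.area_comm, 𝒯.face_comm, 𝒯.normal_swap]
  simp only [inner_neg_right, integral_neg, neg_div]

lemma abs_faceMean_sub_le (hΩ : IsCompact Ω) {K L : 𝒯.ι} (hA : 𝒯.Adj K L) {b : Rd d → Rd d}
    (hb : ContinuousOn b Ω) {v : Rd d} {δ : ℝ} (hδ : ∀ x ∈ 𝒯.face K L, ‖b x - v‖ ≤ δ) :
    |𝒯.faceMean b K L - ⟪v, 𝒯.normal K L⟫| ≤ δ := by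
  have hpos := 𝒯.area_pos hΩ hA
  have h := 𝒯.abs_setIntegral_face_sub_le hΩ hA.ne (f := fun x => ⟪b x, 𝒯.normal K L⟫)
    (hb.inner continuousOn_const) (a := ⟪v, 𝒯.normal K L⟫) (δ := δ) fun x hx => by
      rw [← inner_sub_left]
      refine (abs_real_inner_le_norm _ _).trans ?_
      rw [𝒯.norm_normal hA.ne, mul_one]
      exact hδ x hx
  have h2 : 𝒯.faceMean b K L - ⟪v, 𝒯.normal K L⟫ =
      ((∫ x in 𝒯.face K L, ⟪b x, 𝒯.normal K L⟫ ∂μHE[d - 1]) -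
        𝒯.area K L * ⟪v, 𝒯.normal K L⟫) / 𝒯.area K L := by
    rw [faceMean]
    field_simp
  rwa [h2, abs_div, abs_of_pos hpos, div_le_iff₀ hpos]

lemma abs_faceMean_le (hΩ : IsCompact Ω) {K L : 𝒯.ι} (hA : 𝒯.Adj K L) {b : Rd d → Rd d}
    (hb : ContinuousOn b Ω) {C : ℝ} (hC : ∀ x ∈ Ω, ‖b x‖ ≤ C) : |𝒯.faceMean b K L| ≤ C := by
  have := 𝒯.abs_faceMean_sub_le hΩ hA hb (v := 0) (δ := C) fun x hx => by
    simpa using hC x (𝒯.face_subset hΩ K L hx)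
  simpa using this

/-- The square of the mean normal component is close to its value for the frozen field. -/
lemma faceMean_sq_le (hΩ : IsCompact Ω) {c σ : ℝ} (hR : 𝒯.IsRegular c σ) {K L : 𝒯.ι}
    (hA : 𝒯.Adj K L) {b : Rd d → Rd d} {C : ℝ} (hC0 : 0 ≤ C) (hb : ContinuousOn b Ω)
    (hC : ∀ x ∈ Ω, ‖b x‖ ≤ C) (hlip : ∀ x ∈ Ω, ∀ y ∈ Ω, ‖b x - b y‖ ≤ C * ‖x - y‖) :
    𝒯.faceMean b K L ^ 2 ≤ ⟪b (𝒯.center K), 𝒯.normal K L⟫ ^ 2 + 2 * C ^ 2 * (c⁻¹ * σ) := by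
  have h1 := 𝒯.abs_faceMean_sub_le hΩ hA hb (v := b (𝒯.center K)) (δ := C * (c⁻¹ * σ))
    fun x hx => (hlip x (𝒯.face_subset hΩ K L hx) _ (𝒯.center_mem_domain K)).trans <| by
      rw [← dist_eq_norm, dist_comm]
      exact mul_le_mul_of_nonneg_left (hR.dist_center_left_le hΩ hx) hC0
  have h2 := 𝒯.abs_faceMean_le hΩ hA hb hC
  have h3 : |⟪b (𝒯.center K), 𝒯.normal K L⟫| ≤ C := by
    refine (abs_real_inner_le_norm _ _).trans ?_
    rw [𝒯.norm_normal hA.ne, mul_one]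
    exact hC _ (𝒯.center_mem_domain K)
  set a := ⟪b (𝒯.center K), 𝒯.normal K L⟫
  set β := 𝒯.faceMean b K L
  have hr := hR.inv_mul_pos
  have h4 : |β + a| ≤ 2 * C := (abs_add_le _ _).trans (by linarith)
  have h5 : (β - a) * (β + a) ≤ (C * (c⁻¹ * σ)) * (2 * C) :=
    (le_abs_self _).trans (by rw [abs_mul]; gcongr)
  nlinarith

lemma pairV_RY_eq_faceMean (hΩ : IsCompact Ω) (M : 𝒯.momenta) {b : Rd d → Rd d}
    (hb : ContinuousOn b Ω) :
    pairV (𝒯.RY M) (fun x => b x) = ∑ K, ∑ L ∈ 𝒯.nbrs K,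
      1 / 2 * M.1 K L * 𝒯.faceMean b K L * (𝒯.area K L * 𝒯.gap K L) := by
  rw [𝒯.pairV_RY hΩ M hb]
  refine Finset.sum_congr rfl fun K _ => Finset.sum_congr rfl fun L hL => ?_
  have := (𝒯.area_pos hΩ (𝒯.mem_nbrs.1 hL)).ne'
  rw [faceMean]
  field_simp

/-- Such densities have infinite action, hence every term of the supremum is `-∞`. This is why the
upper bounds on the Legendre transform may be stated for all `P`. -/
lemma AStar_of_not_nonneg {P : 𝒯.ι → ℝ} (hP : ¬ ∀ K, 0 ≤ P K) (B : 𝒯.momenta → ℝ) :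
    (𝒯.model θ).AStar P B = ⊥ := by
  refine iSup_eq_bot.2 fun M => ?_
  have : (𝒯.model θ).A P M = ⊤ := 𝒯.discreteAction_of_not_nonneg hP M
  rw [this]
  simp

/-- Completing the square on each edge, with `t = θ(P_K, P_L)`, shows that `M β / 2 - M² / (4t)` is
at most `t β² / 4`. The mean `t` is at most `(P_K + P_L) / 2`, and by symmetry of the remaining
factors the sum over ordered edges collects `P_K / 4` at `K`. -/
lemma AStar_le (hθ : IsAdmissibleMean θ) (hΩ : IsCompact Ω) {P : 𝒯.ι → ℝ} (hP : ∀ K, 0 ≤ P K)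
    {b : Rd d → Rd d} (hb : ContinuousOn b Ω) :
    (𝒯.model θ).AStar P ((𝒯.operators hΩ θ).RYAdjoint (fun x => b x)) ≤
      ((∑ K, P K / 4 * ∑ L ∈ 𝒯.nbrs K, 𝒯.faceMean b K L ^ 2 * (𝒯.area K L * 𝒯.gap K L) : ℝ) :
        EReal) := by
  have hsym : ∑ K, ∑ L ∈ 𝒯.nbrs K, (P K + P L) / 8 *
        (𝒯.faceMean b K L ^ 2 * (𝒯.area K L * 𝒯.gap K L)) =
      ∑ K, P K / 4 * ∑ L ∈ 𝒯.nbrs K, 𝒯.faceMean b K L ^ 2 * (𝒯.area K L * 𝒯.gap K L) := by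
    have h1 := 𝒯.sum_nbrs_comm fun K L => P L / 8 *
      (𝒯.faceMean b K L ^ 2 * (𝒯.area K L * 𝒯.gap K L))
    have h2 : ∀ K L, P K / 8 * (𝒯.faceMean b L K ^ 2 * (𝒯.area L K * 𝒯.gap L K)) =
        P K / 8 * (𝒯.faceMean b K L ^ 2 * (𝒯.area K L * 𝒯.gap K L)) := fun K L => by
      rw [𝒯.faceMean_swap, neg_sq, 𝒯.area_comm, 𝒯.gap_comm]
    simp only [h2] at h1
    simp only [add_div, add_mul, Finset.sum_add_distrib, h1]
    rw [← Finset.sum_add_distrib]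
    refine Finset.sum_congr rfl fun K _ => ?_
    rw [← Finset.sum_add_distrib, Finset.mul_sum]
    exact Finset.sum_congr rfl fun L _ => by ring
  rw [← hsym]
  refine iSup_le fun M => ?_
  have hA : (𝒯.model θ).A P M = 𝒯.discreteAction θ P M := rfl
  have hB : (𝒯.operators hΩ θ).RYAdjoint (fun x => b x) M = pairV (𝒯.RY M) (fun x => b x) := rfl
  rw [hA, hB]
  -- A momentum that charges an edge on which the mean vanishes has infinite action and cannot
  -- contribute to the supremum.
  by_cases h : ∀ K, ∀ L ∈ 𝒯.nbrs K, θ (P K) (P L) = 0 → M.1 K L = 0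
  swap
  · push Not at h
    obtain ⟨K, L, hL, h0, hM⟩ := h
    rw [𝒯.discreteAction_eq_top hΩ hP hL h0 hM]
    simp
  have hnn : 0 ≤ ∑ K, ∑ L ∈ 𝒯.nbrs K,
      M.1 K L ^ 2 / (4 * θ (P K) (P L)) * (𝒯.area K L * 𝒯.gap K L) :=
    Finset.sum_nonneg fun K _ => Finset.sum_nonneg fun L _ => mul_nonneg
      (div_nonneg (sq_nonneg _) (mul_nonneg (by norm_num) (hθ.nonneg _ _ (hP K) (hP L))))
      (𝒯.area_gap_nonneg K L)
  rw [𝒯.discreteAction_eq_ofReal hθ hP h, EReal.coe_ennreal_ofReal, max_eq_left hnn,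
    ← EReal.coe_sub, EReal.coe_le_coe_iff, 𝒯.pairV_RY_eq_faceMean hΩ M hb,
    ← Finset.sum_sub_distrib]
  refine Finset.sum_le_sum fun K _ => ?_
  rw [← Finset.sum_sub_distrib]
  refine Finset.sum_le_sum fun L hL => ?_
  rw [← sub_mul, ← mul_assoc ((P K + P L) / 8)]
  refine mul_le_mul_of_nonneg_right ?_ (𝒯.area_gap_nonneg K L)
  have hmean := hθ.le_half_add (hP K) (hP L)
  rcases (hθ.nonneg _ _ (hP K) (hP L)).eq_or_lt with h0 | h0
  · rw [h K L hL h0.symm]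
    simp only [mul_zero, zero_mul, ne_eq, OfNat.ofNat_ne_zero, not_false_eq_true, zero_pow,
      zero_div, sub_zero]
    exact mul_nonneg (div_nonneg (add_nonneg (hP K) (hP L)) (by norm_num)) (sq_nonneg _)
  · set t := θ (P K) (P L)
    set β := 𝒯.faceMean b K L
    calc 1 / 2 * M.1 K L * β - M.1 K L ^ 2 / (4 * t)
        = t / 4 * β ^ 2 - (M.1 K L - t * β) ^ 2 / (4 * t) := by field_simp; ring
      _ ≤ t / 4 * β ^ 2 := sub_le_self _ (by positivity)
      _ ≤ (P K + P L) / 8 * β ^ 2 := by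
        refine mul_le_mul_of_nonneg_right ?_ (sq_nonneg _)
        linarith

/-- The isotropy bound on one mesh. -/
def IsIsotropic (ε : ℝ) : Prop := ∀ (K : 𝒯.ι) (v : Rd d),
  1 / (2 * 𝒯.vol K) * ∑ L ∈ 𝒯.nbrs K, 𝒯.area K L * 𝒯.gap K L * ⟪v, 𝒯.normal K L⟫ ^ 2 ≤
    (1 + ε) * ‖v‖ ^ 2

variable {𝒯}

lemma IsIsotropic.sum_le {ε : ℝ} (h : 𝒯.IsIsotropic ε) (hΩ : IsCompact Ω) (K : 𝒯.ι) (v : Rd d) :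
    ∑ L ∈ 𝒯.nbrs K, ⟪v, 𝒯.normal K L⟫ ^ 2 * (𝒯.area K L * 𝒯.gap K L) ≤
      2 * 𝒯.vol K * (‖v‖ ^ 2 + |ε| * ‖v‖ ^ 2) := by
  have hv := 𝒯.vol_pos hΩ K
  have h1 := h K v
  rw [one_div, inv_mul_le_iff₀ (by positivity)] at h1
  have h2 : (1 + ε) * ‖v‖ ^ 2 ≤ ‖v‖ ^ 2 + |ε| * ‖v‖ ^ 2 := by
    have := mul_le_mul_of_nonneg_right (le_abs_self ε) (sq_nonneg ‖v‖)
    linarith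
  calc _ = ∑ L ∈ 𝒯.nbrs K, 𝒯.area K L * 𝒯.gap K L * ⟪v, 𝒯.normal K L⟫ ^ 2 :=
        Finset.sum_congr rfl fun L _ => mul_comm _ _
    _ ≤ _ := h1.trans (mul_le_mul_of_nonneg_left h2 (by positivity))

/-- The constant of the estimate of the sum of areas times gaps around a cell. -/
noncomputable def nbrsConst (d : ℕ) (c : ℝ) : ℝ :=
  ((2 * c⁻¹ + c) / c) ^ d * (2 ^ (d + 1) * (c⁻¹ * c⁻¹) ^ d)

lemma nbrsConst_nonneg (d : ℕ) {c : ℝ} (hc : 0 < c) : 0 ≤ nbrsConst d c := by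
  unfold nbrsConst
  positivity

/-- Freezing the field at the centre costs `2 C² c⁻¹ σ` per interface, which is summed by the bound
on areas times gaps. Isotropy bounds the frozen quadratic form. -/
lemma sum_faceMean_sq_le {c σ ε : ℝ} (hR : 𝒯.IsRegular c σ) (hI : 𝒯.IsIsotropic ε)
    (hΩ : IsCompact Ω) (K : 𝒯.ι) {b : Rd d → Rd d} {C : ℝ} (hC0 : 0 ≤ C)
    (hb : ContinuousOn b Ω) (hC : ∀ x ∈ Ω, ‖b x‖ ≤ C)
    (hlip : ∀ x ∈ Ω, ∀ y ∈ Ω, ‖b x - b y‖ ≤ C * ‖x - y‖) :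
    ∑ L ∈ 𝒯.nbrs K, 𝒯.faceMean b K L ^ 2 * (𝒯.area K L * 𝒯.gap K L) ≤
      2 * 𝒯.vol K * (‖b (𝒯.center K)‖ ^ 2 + |ε| * C ^ 2 + C ^ 2 * (c⁻¹ * σ) * nbrsConst d c) := by
  have hr := hR.inv_mul_pos
  have hv := 𝒯.vol_pos hΩ K
  have h1 : ‖b (𝒯.center K)‖ ^ 2 ≤ C ^ 2 :=
    pow_le_pow_left₀ (norm_nonneg _) (hC _ (𝒯.center_mem_domain K)) 2
  calc ∑ L ∈ 𝒯.nbrs K, 𝒯.faceMean b K L ^ 2 * (𝒯.area K L * 𝒯.gap K L)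
      ≤ ∑ L ∈ 𝒯.nbrs K, (⟪b (𝒯.center K), 𝒯.normal K L⟫ ^ 2 + 2 * C ^ 2 * (c⁻¹ * σ)) *
          (𝒯.area K L * 𝒯.gap K L) := Finset.sum_le_sum fun L hL => mul_le_mul_of_nonneg_right
          (𝒯.faceMean_sq_le hΩ hR (𝒯.mem_nbrs.1 hL) hC0 hb hC hlip) (𝒯.area_gap_nonneg K L)
    _ = ∑ L ∈ 𝒯.nbrs K, ⟪b (𝒯.center K), 𝒯.normal K L⟫ ^ 2 * (𝒯.area K L * 𝒯.gap K L) +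
          2 * C ^ 2 * (c⁻¹ * σ) * ∑ L ∈ 𝒯.nbrs K, 𝒯.area K L * 𝒯.gap K L := by
        simp only [add_mul, Finset.sum_add_distrib, Finset.mul_sum]
    _ ≤ 2 * 𝒯.vol K * (‖b (𝒯.center K)‖ ^ 2 + |ε| * ‖b (𝒯.center K)‖ ^ 2) +
          2 * C ^ 2 * (c⁻¹ * σ) * (nbrsConst d c * 𝒯.vol K) := by
        gcongr
        · exact hI.sum_le hΩ K _
        · exact hR.sum_area_mul_gap_le hΩ K
    _ ≤ 2 * 𝒯.vol K * (‖b (𝒯.center K)‖ ^ 2 + |ε| * C ^ 2) +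
          2 * C ^ 2 * (c⁻¹ * σ) * (nbrsConst d c * 𝒯.vol K) := by gcongr
    _ = _ := by ring

lemma abs_sq_norm_sub_le {b b' : Rd d} {C δ : ℝ} (hb : ‖b‖ ≤ C) (hb' : ‖b'‖ ≤ C)
    (hδ : ‖b - b'‖ ≤ δ) : |‖b‖ ^ 2 - ‖b'‖ ^ 2| ≤ 2 * C * δ := by
  have h1 := (abs_norm_sub_norm_le b b').trans hδ
  have h2 : |‖b‖ + ‖b'‖| ≤ 2 * C := by rw [abs_of_nonneg (by positivity)]; linarith
  have hC : 0 ≤ C := (norm_nonneg _).trans hb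
  calc |‖b‖ ^ 2 - ‖b'‖ ^ 2| = |‖b‖ + ‖b'‖| * |‖b‖ - ‖b'‖| := by rw [← abs_mul]; congr 1; ring
    _ ≤ 2 * C * δ := by gcongr

lemma actionStar_RA_ge {c σ : ℝ} (hR : 𝒯.IsRegular c σ) (hΩ : IsCompact Ω) {P : 𝒯.ι → ℝ}
    (hP : ∀ K, 0 ≤ P K) {b : Rd d → Rd d} {C : ℝ} (hC0 : 0 ≤ C)
    (hb : ContinuousOn b Ω) (hC : ∀ x ∈ Ω, ‖b x‖ ≤ C)
    (hlip : ∀ x ∈ Ω, ∀ y ∈ Ω, ‖b x - b y‖ ≤ C * ‖x - y‖) :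
    ∑ K, P K * 𝒯.vol K * (‖b (𝒯.center K)‖ ^ 2 / 2 - C ^ 2 * (c⁻¹ * σ)) ≤
      actionStar (𝒯.RA P) (fun x => b x) := by
  have hcont : ContinuousOn (fun x => ‖b x‖ ^ 2) Ω := hb.norm.pow 2
  rw [actionStar, 𝒯.pair_RA hΩ P hcont, Finset.mul_sum]
  refine Finset.sum_le_sum fun K _ => ?_
  have h := 𝒯.abs_setIntegral_cell_sub_le hΩ K hcont (a := ‖b (𝒯.center K)‖ ^ 2)
    (δ := 2 * C * (C * (c⁻¹ * σ))) fun x hx => by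
      refine abs_sq_norm_sub_le (hC x (𝒯.cell_subset K hx)) (hC _ (𝒯.center_mem_domain K)) ?_
      refine (hlip x (𝒯.cell_subset K hx) _ (𝒯.center_mem_domain K)).trans ?_
      rw [← dist_eq_norm]
      exact mul_le_mul_of_nonneg_left (hR.dist_center_le hΩ K hx) hC0
  have h1 := (abs_le.1 h).1
  have h2 := mul_le_mul_of_nonneg_left h1 (hP K)
  nlinarith

/-- The one-sided estimate of the Legendre transform of the discrete action. -/
lemma AStar_le_actionStar {c σ ε : ℝ} (hθ : IsAdmissibleMean θ) (hR : 𝒯.IsRegular c σ)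
    (hI : 𝒯.IsIsotropic ε) (hΩ : IsCompact Ω) (P : 𝒯.ι → ℝ) {b : Rd d → Rd d} {C : ℝ}
    (hC0 : 0 ≤ C) (hb : ContinuousOn b Ω) (hC : ∀ x ∈ Ω, ‖b x‖ ≤ C)
    (hlip : ∀ x ∈ Ω, ∀ y ∈ Ω, ‖b x - b y‖ ≤ C * ‖x - y‖) :
    (𝒯.model θ).AStar P ((𝒯.operators hΩ θ).RYAdjoint (fun x => b x)) ≤
      ((actionStar (𝒯.RA P) (fun x => b x) +
        (C ^ 2 / 2 * |ε| + C ^ 2 * (nbrsConst d c / 2 + 1) * c⁻¹ * σ) * tvNorm (𝒯.RA P) : ℝ) :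
        EReal) := by
  by_cases hP : ∀ K, 0 ≤ P K
  swap
  · exact (𝒯.AStar_of_not_nonneg hP _).trans_le bot_le
  have hc := hR.const_pos
  have hσ := hR.step_pos
  have hN := nbrsConst_nonneg d hc
  refine (𝒯.AStar_le hθ hΩ hP hb).trans (EReal.coe_le_coe_iff.2 ?_)
  have h1 := 𝒯.sum_abs_le_tvNorm_RA hΩ P
  simp only [abs_of_nonneg (hP _)] at h1
  -- The error collects the isotropy defect `C²/2 · |ε|`, the freezing of `b` on interfaces
  -- (`nbrsConst / 2`), and the freezing of `‖b‖²` on cells (the summand `1`).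
  set E := C ^ 2 / 2 * |ε| + C ^ 2 * (nbrsConst d c / 2 + 1) * c⁻¹ * σ with hE
  have hE0 : 0 ≤ E := by positivity
  calc _ ≤ ∑ K, (P K * 𝒯.vol K * (‖b (𝒯.center K)‖ ^ 2 / 2 - C ^ 2 * (c⁻¹ * σ)) +
        E * (P K * 𝒯.vol K)) := by
        refine Finset.sum_le_sum fun K _ => ?_
        have h2 := mul_le_mul_of_nonneg_left
          (sum_faceMean_sq_le hR hI hΩ K hC0 hb hC hlip)
          (div_nonneg (hP K) (by norm_num : (0 : ℝ) ≤ 4))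
        refine h2.trans_eq ?_
        rw [hE]
        ring
    _ ≤ actionStar (𝒯.RA P) (fun x => b x) + E * tvNorm (𝒯.RA P) := by
        rw [Finset.sum_add_distrib, ← Finset.mul_sum]
        exact add_le_add (actionStar_RA_ge hR hΩ hP hC0 hb hC hlip)
          (mul_le_mul_of_nonneg_left h1 hE0)

/-- The crude version of the estimate: interface means are bounded by the supremum of `‖b‖`, so no
modulus of continuity of `b` and no isotropy is needed. The maximum with `1` provides a constant
that is at least `1`. -/
lemma AStar_le_sup {c σ : ℝ} (hθ : IsAdmissibleMean θ) (hR : 𝒯.IsRegular c σ)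
    (hΩ : IsCompact Ω) (P : 𝒯.ι → ℝ) (b : C(Ω, Rd d)) :
    (𝒯.model θ).AStar P ((𝒯.operators hΩ θ).RYAdjoint b) ≤
      ((max 1 (nbrsConst d c / 2) / 2 * tvNorm (𝒯.RA P) * (⨆ x, ‖b x‖) ^ 2 : ℝ) : EReal) := by
  classical
  by_cases hP : ∀ K, 0 ≤ P K
  swap
  · exact (𝒯.AStar_of_not_nonneg hP _).trans_le bot_le
  -- Interface means are formed from functions on the whole space; extending by zero is harmless,
  -- because only continuity on `Ω` is used.
  set b' : Rd d → Rd d := fun x => if h : x ∈ Ω then b ⟨x, h⟩ else 0 with hb'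
  have hbb : (b : Ω → Rd d) = fun x : Ω => b' x := by
    ext1 x
    simp [hb']
  have hcont : ContinuousOn b' Ω := by
    rw [continuousOn_iff_continuous_domRestrict]
    have : Ω.domRestrict b' = b := hbb.symm
    rw [this]
    exact b.continuous
  obtain ⟨C, hC⟩ := exists_norm_le_of_continuous hΩ b.continuous
  set s := ⨆ x, ‖b x‖
  have hs : ∀ x ∈ Ω, ‖b' x‖ ≤ s := fun x hx => by
    have h1 : b' x = b ⟨x, hx⟩ := (congrFun hbb ⟨x, hx⟩).symm
    rw [h1]
    exact le_ciSup (f := fun x => ‖b x‖) ⟨C, by rintro _ ⟨x, rfl⟩; exact hC x⟩ ⟨x, hx⟩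
  rw [hbb]
  refine (𝒯.AStar_le hθ hΩ hP hcont).trans (EReal.coe_le_coe_iff.2 ?_)
  have hc := hR.const_pos
  have hN := nbrsConst_nonneg d hc
  have h1 := 𝒯.sum_abs_le_tvNorm_RA hΩ P
  simp only [abs_of_nonneg (hP _)] at h1
  calc _ ≤ ∑ K, P K / 4 * (s ^ 2 * (nbrsConst d c * 𝒯.vol K)) := by
        refine Finset.sum_le_sum fun K _ =>
          mul_le_mul_of_nonneg_left ?_ (div_nonneg (hP K) (by norm_num))
        refine le_trans ?_ (mul_le_mul_of_nonneg_left (hR.sum_area_mul_gap_le hΩ K) (sq_nonneg s))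
        rw [Finset.mul_sum]
        refine Finset.sum_le_sum fun L hL =>
          mul_le_mul_of_nonneg_right (sq_le_sq' ?_ ?_) (𝒯.area_gap_nonneg K L)
        · exact (abs_le.1 (𝒯.abs_faceMean_le hΩ (𝒯.mem_nbrs.1 hL) hcont hs)).1
        · exact (abs_le.1 (𝒯.abs_faceMean_le hΩ (𝒯.mem_nbrs.1 hL) hcont hs)).2
    _ = nbrsConst d c / 2 / 2 * (∑ K, P K * 𝒯.vol K) * s ^ 2 := by
        rw [Finset.mul_sum, Finset.sum_mul]
        exact Finset.sum_congr rfl fun K _ => by ring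
    _ ≤ max 1 (nbrsConst d c / 2) / 2 * tvNorm (𝒯.RA P) * s ^ 2 := by
        have h2 : nbrsConst d c / 2 / 2 ≤ max 1 (nbrsConst d c / 2) / 2 :=
          div_le_div_of_nonneg_right (le_max_right _ _) zero_le_two
        exact mul_le_mul_of_nonneg_right (mul_le_mul h2 h1
          (Finset.sum_nonneg fun K _ => mul_nonneg (hP K) measureReal_nonneg)
          ((by positivity : (0 : ℝ) ≤ nbrsConst d c / 2 / 2).trans h2)) (sq_nonneg s)

/-! ### The action on smooth densities -/

lemma flux_restrictC (hΩ : IsCompact Ω) {m : Rd d → Rd d} (hm : ContinuousOn m Ω) {K L : 𝒯.ι}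
    (hA : 𝒯.Adj K L) : 𝒯.flux (restrictC m hm) K L = 𝒯.faceMean m K L := by
  rw [flux, if_pos hA, average_eq, faceMean, Measure.real, 𝒯.faceMeasure_univ hΩ,
    ← 𝒯.integral_faceMeasure hΩ K L fun x => ⟪m x, 𝒯.normal K L⟫, div_eq_inv_mul, smul_eq_mul]
  rfl

/-- The supremum is tested at its formal maximizer `b = m / ρ`, `a = -‖b‖² / 2`, which is continuous
on `Ω` because `ρ` is positive there. -/
lemma _root_.OptimalTransport.action_ofDensity_ge (hΩ : IsCompact Ω) {ρ : Rd d → ℝ}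
    {m : Rd d → Rd d} (hρ : ContinuousOn ρ Ω) (hm : ContinuousOn m Ω) (hpos : ∀ x ∈ Ω, 0 < ρ x) :
    ((∫ x in Ω, ‖m x‖ ^ 2 / (2 * ρ x) : ℝ) : EReal) ≤ action (ofDensity Ω ρ) (ofDensity Ω m) := by
  have hb : ContinuousOn (fun x => (ρ x)⁻¹ • m x) Ω := (hρ.inv₀ fun x hx => (hpos x hx).ne').smul hm
  have ha : ContinuousOn (fun x => -(‖(ρ x)⁻¹ • m x‖ ^ 2 / 2)) Ω :=
    ((hb.norm.pow 2).div_const 2).neg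
  refine le_trans ?_ (le_iSup_of_le (restrictC _ ha) (le_iSup_of_le (restrictC _ hb)
    (le_iSup_of_le (fun x => ?_) le_rfl)))
  · refine EReal.coe_le_coe_iff.2 (le_of_eq ?_)
    have h1 := pair_ofDensity hΩ hρ ha
    have h2 := pairV_ofDensity hΩ hm hb
    change _ = pair (ofDensity Ω ρ) (fun x => -(‖(ρ x)⁻¹ • m x‖ ^ 2 / 2)) +
      pairV (ofDensity Ω m) (fun x => (ρ x)⁻¹ • m x)
    have i1 : IntegrableOn (fun x => -(‖(ρ x)⁻¹ • m x‖ ^ 2 / 2) * ρ x) Ω :=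
      (ha.mul hρ).integrableOn_compact hΩ
    have i2 : IntegrableOn (fun x => ⟪(ρ x)⁻¹ • m x, m x⟫) Ω :=
      (hb.inner hm).integrableOn_compact hΩ
    rw [h1, h2, ← integral_add i1 i2]
    refine setIntegral_congr_fun hΩ.measurableSet fun x hx => ?_
    have := (hpos x hx).ne'
    simp only [norm_smul, norm_inv, real_inner_smul_left, real_inner_self_eq_norm_sq,
      Real.norm_eq_abs, abs_of_pos (hpos x hx)]
    field_simp
    ring
  · change -(‖(ρ x)⁻¹ • m x‖ ^ 2 / 2) + ‖(ρ x)⁻¹ • m x‖ ^ 2 / 2 ≤ 0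
    simp

/-- Only a lower bound on `t` in terms of `r` is required. It is thus enough to bound the mean of
the sampled densities from below, which monotonicity of `θ` provides. -/
lemma inv_le_inv_add {t r δ e : ℝ} (hδ : 0 < δ) (ht : δ ≤ t) (hr : δ ≤ r) (hrt : r - e ≤ t)
    (he : 0 ≤ e) : t⁻¹ ≤ r⁻¹ + e / δ ^ 2 := by
  have ht0 := hδ.trans_le ht
  have hr0 := hδ.trans_le hr
  have h1 : t⁻¹ - r⁻¹ = (r - t) / (t * r) := by field_simp
  have h2 : (r - t) / (t * r) ≤ e / δ ^ 2 := by
    refine div_le_div₀ he (by linarith) (by positivity) ?_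
    rw [sq]
    exact mul_le_mul ht hr hδ.le ht0.le
  linarith

/-- On each interface both the flux and the mean density are frozen at the centre of `K`, at
relative cost `O(σ)`. Isotropy then yields `|K| ‖m‖² / (2ρ)` at the centre, which is compared with
the integral over the cell and finally with the lower bound for the continuous action. -/
lemma action_SX_SY_le {c σ ε : ℝ} (hθ : IsAdmissibleMean θ) (hR : 𝒯.IsRegular c σ)
    (hI : 𝒯.IsIsotropic ε) (hΩ : IsCompact Ω) {ρ : Rd d → ℝ} {m : Rd d → Rd d} {C δ : ℝ}
    (hC0 : 0 ≤ C) (hδ : 0 < δ) (hρδ : ∀ x ∈ Ω, δ ≤ ρ x) (hρ : ContinuousOn ρ Ω)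
    (hρlip : ∀ x ∈ Ω, ∀ y ∈ Ω, ‖ρ x - ρ y‖ ≤ C * ‖x - y‖)
    (hm : ContinuousOn m Ω) (hC : ∀ x ∈ Ω, ‖m x‖ ≤ C)
    (hlip : ∀ x ∈ Ω, ∀ y ∈ Ω, ‖m x - m y‖ ≤ C * ‖x - y‖) :
    ((𝒯.discreteAction θ (𝒯.SX (ofDensity Ω ρ)) (𝒯.SY hΩ (restrictC m hm)) : ENNReal) : EReal) ≤
      action (ofDensity Ω ρ) (ofDensity Ω m) +
        ((volume.real Ω * (C ^ 2 / δ / 2 * |ε| + (2 * C ^ 2 / δ + 3 * C ^ 3 / δ ^ 2) *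
          (nbrsConst d c + 1) * c⁻¹ * σ) : ℝ) : EReal) := by
  have hc := hR.const_pos
  have hσ := hR.step_pos
  have hN := nbrsConst_nonneg d hc
  set r := c⁻¹ * σ with hr
  have hr0 : 0 < r := hR.inv_mul_pos
  set P := 𝒯.SX (ofDensity Ω ρ) with hPdef
  have hPint : ∀ K, P K = (∫ x in 𝒯.cell K, ρ x) / 𝒯.vol K := fun K => 𝒯.SX_ofDensity hΩ hρ K
  have hPδ : ∀ K, δ ≤ P K := fun K => by
    rw [hPint, le_div_iff₀ (𝒯.vol_pos hΩ K)]
    have := setIntegral_mono_on (integrableOn_const (𝒯.volume_cell_lt_top hΩ K).ne)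
      ((hρ.integrableOn_compact hΩ).mono_set (𝒯.cell_subset K)) (𝒯.measurableSet_cell K)
      fun x hx => hρδ x (𝒯.cell_subset K hx)
    rw [setIntegral_const, smul_eq_mul, mul_comm] at this
    exact this
  have hPnn : ∀ K, 0 ≤ P K := fun K => hδ.le.trans (hPδ K)
  have hPnear : ∀ (L : 𝒯.ι) (a e : ℝ), (∀ x ∈ 𝒯.cell L, |ρ x - a| ≤ e) →
      a - e ≤ P L := fun L a e h => by
    have h1 := (abs_le.1 (𝒯.abs_setIntegral_cell_sub_le hΩ L hρ h)).1
    rw [hPint, le_div_iff₀ (𝒯.vol_pos hΩ L)]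
    linarith
  have hθpos : ∀ K L, δ ≤ θ (P K) (P L) := fun K L => hθ.le_of_le hδ.le (hPδ K) (hPδ L)
  -- All points of `K` and of a neighbour `L` are within `3r` of the centre of `K`, so both sampled
  -- densities are at least `ρ(x_K) - 3Cr`, and so is their mean.
  have hθnear : ∀ K, ∀ L ∈ 𝒯.nbrs K, ρ (𝒯.center K) - 3 * C * r ≤ θ (P K) (P L) := by
    intro K L hL
    rcases le_or_gt (ρ (𝒯.center K) - 3 * C * r) 0 with h | h
    · exact h.trans (hδ.le.trans (hθpos K L))
    refine hθ.le_of_le h.le (hPnear K _ _ fun x hx => ?_) (hPnear L _ _ fun x hx => ?_)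
    · refine (hρlip x (𝒯.cell_subset K hx) _ (𝒯.center_mem_domain K)).trans ?_
      rw [← dist_eq_norm, mul_comm 3 C, mul_assoc]
      exact mul_le_mul_of_nonneg_left ((hR.dist_center_le hΩ K hx).trans (by linarith)) hC0
    · refine (hρlip x (𝒯.cell_subset L hx) _ (𝒯.center_mem_domain K)).trans ?_
      rw [← dist_eq_norm, mul_comm 3 C, mul_assoc]
      exact mul_le_mul_of_nonneg_left (hR.dist_cell_le hΩ (𝒯.mem_nbrs.1 hL) hx) hC0
  -- The first summand is the error `2 C² r` of freezing the squared flux, times `1 / ρ ≤ 1 / δ`.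
  -- The second is the error `3 C r / δ²` of the inverse mean, times the squared flux, which is at
  -- most `C²`.
  set E := 2 * C ^ 2 / δ + 3 * C ^ 3 / δ ^ 2 with hE
  have hE0 : 0 ≤ E := by positivity
  have hterm : ∀ K, ∀ L ∈ 𝒯.nbrs K, 𝒯.faceMean m K L ^ 2 / (4 * θ (P K) (P L)) ≤
      1 / 4 * (⟪m (𝒯.center K), 𝒯.normal K L⟫ ^ 2 * (ρ (𝒯.center K))⁻¹ + E * r) := by
    intro K L hL
    have hA := 𝒯.mem_nbrs.1 hL
    have hρK := hρδ _ (𝒯.center_mem_domain K)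
    have h1 := inv_le_inv_add hδ (hθpos K L) hρK (hθnear K L hL) (by positivity)
    have h2 : 𝒯.faceMean m K L ^ 2 ≤ C ^ 2 :=
      sq_le_sq' (abs_le.1 (𝒯.abs_faceMean_le hΩ hA hm hC)).1
        (abs_le.1 (𝒯.abs_faceMean_le hΩ hA hm hC)).2
    have h3 := 𝒯.faceMean_sq_le hΩ hR hA hC0 hm hC hlip
    have h4 : (ρ (𝒯.center K))⁻¹ ≤ δ⁻¹ := inv_anti₀ hδ hρK
    have h5 : 0 < (ρ (𝒯.center K))⁻¹ := inv_pos.2 (hδ.trans_le hρK)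
    set q := (ρ (𝒯.center K))⁻¹
    set a := ⟪m (𝒯.center K), 𝒯.normal K L⟫
    set β := 𝒯.faceMean m K L
    have h6 : β ^ 2 * (θ (P K) (P L))⁻¹ ≤ a ^ 2 * q + E * r := by
      calc β ^ 2 * (θ (P K) (P L))⁻¹ ≤ β ^ 2 * (q + 3 * C * r / δ ^ 2) := by gcongr
        _ = β ^ 2 * q + β ^ 2 * (3 * C * r / δ ^ 2) := by ring
        _ ≤ (a ^ 2 + 2 * C ^ 2 * r) * q + C ^ 2 * (3 * C * r / δ ^ 2) := by gcongr
        _ = a ^ 2 * q + 2 * C ^ 2 * r * q + C ^ 2 * (3 * C * r / δ ^ 2) := by ring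
        _ ≤ a ^ 2 * q + 2 * C ^ 2 * r * δ⁻¹ + C ^ 2 * (3 * C * r / δ ^ 2) := by gcongr
        _ = _ := by rw [hE]; ring
    have h7 : β ^ 2 / (4 * θ (P K) (P L)) = 1 / 4 * (β ^ 2 * (θ (P K) (P L))⁻¹) := by
      have := (hδ.trans_le (hθpos K L)).ne'
      field_simp
    rw [h7]
    gcongr
  have hcell : ∀ K, ∑ L ∈ 𝒯.nbrs K, 𝒯.faceMean m K L ^ 2 / (4 * θ (P K) (P L)) *
      (𝒯.area K L * 𝒯.gap K L) ≤ (∫ x in 𝒯.cell K, ‖m x‖ ^ 2 / (2 * ρ x)) +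
        𝒯.vol K * (C ^ 2 / δ / 2 * |ε| + E * (nbrsConst d c + 1) * r) := by
    intro K
    have hv := 𝒯.vol_pos hΩ K
    have hρK := hρδ _ (𝒯.center_mem_domain K)
    have hq : (ρ (𝒯.center K))⁻¹ ≤ δ⁻¹ := inv_anti₀ hδ hρK
    have hq0 : 0 < (ρ (𝒯.center K))⁻¹ := inv_pos.2 (hδ.trans_le hρK)
    have hmK := hC _ (𝒯.center_mem_domain K)
    have h1 : ∑ L ∈ 𝒯.nbrs K, 𝒯.faceMean m K L ^ 2 / (4 * θ (P K) (P L)) *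
        (𝒯.area K L * 𝒯.gap K L) ≤ 1 / 4 * (2 * 𝒯.vol K *
          (‖m (𝒯.center K)‖ ^ 2 + |ε| * ‖m (𝒯.center K)‖ ^ 2) * (ρ (𝒯.center K))⁻¹ +
            E * r * (nbrsConst d c * 𝒯.vol K)) := by
      calc _ ≤ ∑ L ∈ 𝒯.nbrs K, 1 / 4 * (⟪m (𝒯.center K), 𝒯.normal K L⟫ ^ 2 *
            (ρ (𝒯.center K))⁻¹ + E * r) * (𝒯.area K L * 𝒯.gap K L) :=
            Finset.sum_le_sum fun L hL => mul_le_mul_of_nonneg_right (hterm K L hL)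
              (𝒯.area_gap_nonneg K L)
        _ = 1 / 4 * ((∑ L ∈ 𝒯.nbrs K, ⟪m (𝒯.center K), 𝒯.normal K L⟫ ^ 2 *
            (𝒯.area K L * 𝒯.gap K L)) * (ρ (𝒯.center K))⁻¹ +
            E * r * ∑ L ∈ 𝒯.nbrs K, 𝒯.area K L * 𝒯.gap K L) := by
          rw [Finset.sum_mul, Finset.mul_sum, ← Finset.sum_add_distrib, Finset.mul_sum]
          exact Finset.sum_congr rfl fun L _ => by ring
        _ ≤ _ := by
          gcongr
          · exact hI.sum_le hΩ K _
          · exact hR.sum_area_mul_gap_le hΩ K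
    have hcont : ContinuousOn (fun x => ‖m x‖ ^ 2 / (2 * ρ x)) Ω :=
      (hm.norm.pow 2).div (continuousOn_const.mul hρ) fun x hx =>
        (mul_pos two_pos (hδ.trans_le (hρδ x hx))).ne'
    have h2 := 𝒯.abs_setIntegral_cell_sub_le hΩ K hcont
      (a := ‖m (𝒯.center K)‖ ^ 2 * (ρ (𝒯.center K))⁻¹ / 2) (δ := E / 2 * r) fun x hx => by
        have hxΩ := 𝒯.cell_subset K hx
        have hd := hR.dist_center_le hΩ K hx
        have e1 : |‖m x‖ ^ 2 - ‖m (𝒯.center K)‖ ^ 2| ≤ 2 * C * (C * r) := by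
          refine abs_sq_norm_sub_le (hC x hxΩ) hmK ?_
          refine (hlip x hxΩ _ (𝒯.center_mem_domain K)).trans ?_
          rw [← dist_eq_norm]
          exact mul_le_mul_of_nonneg_left hd hC0
        have e2 : |ρ (𝒯.center K) - ρ x| ≤ C * r := by
          refine (hρlip _ (𝒯.center_mem_domain K) x hxΩ).trans ?_
          rw [← dist_eq_norm, dist_comm]
          exact mul_le_mul_of_nonneg_left hd hC0
        have hx0 := hδ.trans_le (hρδ x hxΩ)
        have hK0 := hδ.trans_le hρK
        have e3 : ‖m x‖ ^ 2 / (2 * ρ x) - ‖m (𝒯.center K)‖ ^ 2 * (ρ (𝒯.center K))⁻¹ / 2 =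
            1 / 2 * ((‖m x‖ ^ 2 - ‖m (𝒯.center K)‖ ^ 2) / ρ x + ‖m (𝒯.center K)‖ ^ 2 *
              ((ρ (𝒯.center K) - ρ x) / (ρ x * ρ (𝒯.center K)))) := by
          field_simp
          ring
        rw [e3, abs_mul, abs_of_pos (by norm_num : (0 : ℝ) < 1 / 2)]
        have e4 : |(‖m x‖ ^ 2 - ‖m (𝒯.center K)‖ ^ 2) / ρ x| ≤ 2 * C * (C * r) / δ := by
          rw [abs_div, abs_of_pos hx0]
          exact div_le_div₀ (by positivity) e1 hδ (hρδ x hxΩ)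
        have e5 : |‖m (𝒯.center K)‖ ^ 2 * ((ρ (𝒯.center K) - ρ x) / (ρ x * ρ (𝒯.center K)))| ≤
            C ^ 2 * (C * r / δ ^ 2) := by
          rw [abs_mul, abs_div, abs_of_pos (mul_pos hx0 hK0), abs_of_nonneg (sq_nonneg _), sq δ]
          gcongr
          exact hρδ x hxΩ
        have e6 : C ^ 2 * (C * r / δ ^ 2) ≤ 3 * C ^ 3 / δ ^ 2 * r := by
          have : 0 ≤ C ^ 3 / δ ^ 2 * r := by positivity
          calc C ^ 2 * (C * r / δ ^ 2) = C ^ 3 / δ ^ 2 * r := by ring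
            _ ≤ 3 * (C ^ 3 / δ ^ 2 * r) := by linarith
            _ = _ := by ring
        calc _ ≤ 1 / 2 * (2 * C * (C * r) / δ + C ^ 2 * (C * r / δ ^ 2)) := by
              gcongr
              exact (abs_add_le _ _).trans (add_le_add e4 e5)
          _ ≤ 1 / 2 * (2 * C * (C * r) / δ + 3 * C ^ 3 / δ ^ 2 * r) := by gcongr
          _ = E / 2 * r := by rw [hE]; ring
    have h3 := (abs_le.1 h2).1
    have h4 : |ε| * ‖m (𝒯.center K)‖ ^ 2 * (ρ (𝒯.center K))⁻¹ ≤ |ε| * C ^ 2 * δ⁻¹ := by gcongr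
    have h5 : 0 ≤ E * r * 𝒯.vol K := by positivity
    have h6 : 0 ≤ E * r * (nbrsConst d c * 𝒯.vol K) := by positivity
    have h7 := mul_le_mul_of_nonneg_left h4 hv.le
    refine h1.trans ?_
    have e1 : 𝒯.vol K * (C ^ 2 / δ / 2 * |ε| + E * (nbrsConst d c + 1) * r) =
        1 / 2 * (𝒯.vol K * (|ε| * C ^ 2 * δ⁻¹)) + E * r * (nbrsConst d c * 𝒯.vol K) +
          E * r * 𝒯.vol K := by ring
    rw [e1]
    nlinarith
  have hmom : ∀ K, ∀ L ∈ 𝒯.nbrs K, (𝒯.SY hΩ (restrictC m hm)).1 K L = 𝒯.faceMean m K L :=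
    fun K L hL => flux_restrictC hΩ hm (𝒯.mem_nbrs.1 hL)
  have hcont : ContinuousOn (fun x => ‖m x‖ ^ 2 / (2 * ρ x)) Ω :=
    (hm.norm.pow 2).div (continuousOn_const.mul hρ) fun x hx =>
      (mul_pos two_pos (hδ.trans_le (hρδ x hx))).ne'
  have hnn : 0 ≤ ∑ K, ∑ L ∈ 𝒯.nbrs K, 𝒯.faceMean m K L ^ 2 / (4 * θ (P K) (P L)) *
      (𝒯.area K L * 𝒯.gap K L) :=
    Finset.sum_nonneg fun K _ => Finset.sum_nonneg fun L _ => mul_nonneg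
      (div_nonneg (sq_nonneg _) (mul_nonneg (by norm_num) (hδ.le.trans (hθpos K L))))
      (𝒯.area_gap_nonneg K L)
  rw [𝒯.discreteAction_eq_ofReal hθ hPnn fun K L _ h0 =>
    absurd h0 (hδ.trans_le (hθpos K L)).ne', EReal.coe_ennreal_ofReal]
  have hsum : ∑ K, ∑ L ∈ 𝒯.nbrs K, (𝒯.SY hΩ (restrictC m hm)).1 K L ^ 2 / (4 * θ (P K) (P L)) *
      (𝒯.area K L * 𝒯.gap K L) = ∑ K, ∑ L ∈ 𝒯.nbrs K, 𝒯.faceMean m K L ^ 2 /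
        (4 * θ (P K) (P L)) * (𝒯.area K L * 𝒯.gap K L) :=
    Finset.sum_congr rfl fun K _ => Finset.sum_congr rfl fun L hL => by rw [hmom K L hL]
  rw [hsum, max_eq_left hnn]
  refine le_trans ?_ (add_le_add_left (action_ofDensity_ge hΩ hρ hm fun x hx =>
    hδ.trans_le (hρδ x hx)) _)
  rw [← EReal.coe_add, EReal.coe_le_coe_iff]
  refine (Finset.sum_le_sum fun K _ => hcell K).trans_eq ?_
  rw [Finset.sum_add_distrib, 𝒯.sum_setIntegral_cell hΩ hcont, ← Finset.sum_mul, 𝒯.sum_vol hΩ, hr]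
  ring

end Mesh

/-! ### The divergence theorem on convex bodies whose boundary is polyhedral up to a no-flux part -/

section Gauge

variable {d : ℕ} {S : Set (Rd d)} {r : ℝ}

lemma absorbent_of_ball_subset (hr : 0 < r) (hS : Metric.ball 0 r ⊆ S) : Absorbent ℝ S :=
  absorbent_nhds_zero (Filter.mem_of_superset (Metric.ball_mem_nhds 0 hr) hS)

/-- A supporting hyperplane bounds the gauge from below. -/
lemma inner_div_le_gauge (hr : 0 < r) (hS : Metric.ball 0 r ⊆ S) {n : Rd d} {a : ℝ} (ha : 0 < a)
    (hn : ∀ w ∈ S, ⟪n, w⟫ ≤ a) (z : Rd d) : ⟪n, z⟫ / a ≤ gauge S z := by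
  refine le_csInf (absorbent_of_ball_subset hr hS).gauge_set_nonempty ?_
  rintro l ⟨hl, w, hw, rfl⟩
  rw [div_le_iff₀ ha]
  simp only [real_inner_smul_right]
  exact mul_le_mul_of_nonneg_left (hn w hw) (le_of_lt hl)

/-- The gauge on the cone over the contact set of a supporting hyperplane. -/
lemma gauge_smul_of_inner_eq (hr : 0 < r) (hS : Metric.ball 0 r ⊆ S) {n y : Rd d} {a : ℝ}
    (ha : 0 < a) (hn : ∀ w ∈ S, ⟪n, w⟫ ≤ a) (hy : y ∈ S) (hya : ⟪n, y⟫ = a) {s : ℝ} (hs : 0 ≤ s) :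
    gauge S (s • y) = s := by
  refine le_antisymm (gauge_le_of_mem hs (smul_mem_smul_set hy)) ?_
  have h := inner_div_le_gauge hr hS ha hn (s • y)
  rwa [real_inner_smul_right, hya, mul_div_cancel_right₀ _ ha.ne'] at h

/-- The gauge dominates the linear function `⟪n, ·⟫ / a` and equals it at `s • y`. The difference
has a minimum there, so its derivative vanishes. -/
lemma fderiv_gauge_smul (hr : 0 < r) (hS : Metric.ball 0 r ⊆ S) {n y : Rd d} {a : ℝ}
    (ha : 0 < a) (hn : ∀ w ∈ S, ⟪n, w⟫ ≤ a) (hy : y ∈ S) (hya : ⟪n, y⟫ = a) {s : ℝ} (hs : 0 ≤ s)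
    (hd : DifferentiableAt ℝ (gauge S) (s • y)) (v : Rd d) :
    fderiv ℝ (gauge S) (s • y) v = ⟪n, v⟫ / a := by
  have h1 : HasFDerivAt (fun z => gauge S z - a⁻¹ * ⟪n, z⟫)
      (fderiv ℝ (gauge S) (s • y) - a⁻¹ • innerSL ℝ n) (s • y) :=
    hd.hasFDerivAt.sub ((innerSL ℝ n).hasFDerivAt.const_mul a⁻¹)
  have h2 : IsLocalMin (fun z => gauge S z - a⁻¹ * ⟪n, z⟫) (s • y) := by
    refine Filter.Eventually.of_forall fun z => ?_
    have e1 := inner_div_le_gauge hr hS ha hn z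
    rw [div_eq_inv_mul] at e1
    simp only [gauge_smul_of_inner_eq hr hS ha hn hy hya hs, real_inner_smul_right, hya]
    have : a⁻¹ * (s * a) = s := by field_simp
    linarith
  have h3 := DFunLike.congr_fun (h2.hasFDerivAt_eq_zero h1) v
  simp only [sub_apply, smul_apply, innerSL_apply_apply, smul_eq_mul, zero_apply] at h3
  rw [div_eq_inv_mul]
  linarith

/-- Supporting hyperplanes stay at a definite distance from the origin, which keeps the denominators
in the derivative of the gauge bounded below. The test point has length `r / 2` because the ball is
open. -/
lemma norm_mul_le_inner (hr : 0 < r) (hS : Metric.ball 0 r ⊆ S) {n : Rd d} {a : ℝ} (hn1 : ‖n‖ = 1)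
    (hn : ∀ w ∈ S, ⟪n, w⟫ ≤ a) : r / 2 ≤ a := by
  have h := hn ((r / 2) • n) (hS (by
    rw [mem_ball_zero_iff, norm_smul, hn1, Real.norm_of_nonneg (by positivity)]; linarith))
  rwa [real_inner_smul_right, real_inner_self_eq_norm_sq, hn1, one_pow, mul_one] at h

end Gauge

/-! ### Integration over thin cones with a flat base -/

section Cone

variable {d : ℕ} {ν : Rd d} (hν : ‖ν‖ = 1)

include hν

/-- The part of the cone over a subset `F` of a hyperplane, between two parallel hyperplanes. -/
lemma setIntegral_cone {a b : ℝ} (hb : 0 < b) (hba : b < a) {F : Set (Rd d)}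
    (hFm : MeasurableSet F) (hFb : Bornology.IsBounded F)
    {f : Rd d → ℝ} (hf : Continuous f) :
    ∫ z in {z | ⟪ν, z⟫ ∈ Ioo b a ∧ (a / ⟪ν, z⟫) • z ∈ F}, f z =
      ∫ t in Ioo b a, (t / a) ^ (d - 1) *
        ∫ y in hyperplaneMap ν a ⁻¹' F, f ((t / a) • hyperplaneMap ν a y) := by
  have ha : 0 < a := hb.trans hba
  set A : Set (Rd d) := {z | ⟪ν, z⟫ ∈ Ioo b a ∧ (a / ⟪ν, z⟫) • z ∈ F} with hA
  have hAm : MeasurableSet A := by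
    have h1 : Measurable fun z : Rd d => ⟪ν, z⟫ := by fun_prop
    exact (h1 measurableSet_Ioo).inter
      (((measurable_const.div h1).smul measurable_id) hFm)
  obtain ⟨R, hR⟩ := hFb.subset_closedBall 0
  have hAb : A ⊆ Metric.closedBall 0 R := by
    rintro z ⟨⟨hz1, hz2⟩, hz⟩
    have h1 := hR hz
    have hz0 : 0 < ⟪ν, z⟫ := hb.trans hz1
    rw [mem_closedBall_zero_iff, norm_smul, Real.norm_of_nonneg (div_pos ha hz0).le] at h1
    rw [mem_closedBall_zero_iff]
    have h2 : 1 ≤ a / ⟪ν, z⟫ := (one_le_div hz0).2 hz2.le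
    nlinarith [norm_nonneg z]
  have hint : IntegrableOn f A :=
    (hf.continuousOn.integrableOn_compact (isCompact_closedBall 0 R)).mono_set hAb
  have hΨ := measurePreserving_slab hν 0
  have hΨe := measurableEmbedding_slab hν 0
  set Ψ := fun p : (ℝ ∙ ν)ᗮ × ℝ => hyperplaneMap ν 0 p.1 + p.2 • ν with hΨdef
  have hint' : Integrable ((Ψ ⁻¹' A).indicator (f ∘ Ψ)) (volume.prod volume) := by
    rw [integrable_indicator_iff (hΨ.measurable hAm)]
    exact (hΨ.integrableOn_comp_preimage hΨe).2 hint
  rw [← hΨ.setIntegral_preimage_emb hΨe, ← integral_indicator (hΨ.measurable hAm),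
    ← integral_indicator measurableSet_Ioo]
  rw [show (∫ p, (Ψ ⁻¹' A).indicator (fun x => f (Ψ x)) p ∂(volume.prod volume)) =
    ∫ p, (Ψ ⁻¹' A).indicator (f ∘ Ψ) p ∂(volume.prod volume) from rfl, integral_prod_symm _ hint']
  refine integral_congr_ae (Filter.Eventually.of_forall fun t => ?_)
  have hin : ∀ y : (ℝ ∙ ν)ᗮ, ⟪ν, Ψ (y, t)⟫ = t := fun y => by
    simp only [hΨdef, inner_add_right, inner_hyperplaneMap hν, real_inner_smul_right,
      real_inner_self_eq_norm_sq, hν]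
    simp
  by_cases ht : t ∈ Ioo b a
  · have ht0 : 0 < t := hb.trans ht.1
    rw [indicator_of_mem ht]
    -- The slice of the cone at height `t` is `F` scaled by `t / a` towards the origin. The
    -- substitution `y ↦ (a / t) • y` in the hyperplane produces the Jacobian `(t / a) ^ (d - 1)`.
    set φ : (ℝ ∙ ν)ᗮ → ℝ := (hyperplaneMap ν a ⁻¹' F).indicator
      fun y => f ((t / a) • hyperplaneMap ν a y) with hφ
    have hz : ∀ y : (ℝ ∙ ν)ᗮ, (a / t) • Ψ (y, t) = hyperplaneMap ν a ((a / t) • y) := fun y => by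
      simp only [hΨdef, hyperplaneMap, smul_add, smul_smul, Submodule.coe_smul, zero_smul, add_zero]
      rw [div_mul_cancel₀ _ ht0.ne']
    have hz' : ∀ y : (ℝ ∙ ν)ᗮ, (t / a) • hyperplaneMap ν a ((a / t) • y) = Ψ (y, t) := fun y => by
      rw [← hz, smul_smul]
      have : t / a * (a / t) = 1 := by field_simp
      rw [this, one_smul]
    have h1 : ∀ y : (ℝ ∙ ν)ᗮ, (Ψ ⁻¹' A).indicator (f ∘ Ψ) (y, t) = φ ((a / t) • y) := fun y => by
      by_cases hy : hyperplaneMap ν a ((a / t) • y) ∈ F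
      · rw [hφ, indicator_of_mem (show (a / t) • y ∈ hyperplaneMap ν a ⁻¹' F from hy), hz',
          indicator_of_mem]
        · rfl
        · exact ⟨by rw [hin]; exact ht, by rw [hin, hz]; exact hy⟩
      · rw [hφ, indicator_of_notMem (show (a / t) • y ∉ hyperplaneMap ν a ⁻¹' F from hy),
          indicator_of_notMem]
        rintro ⟨-, h⟩
        rw [hin, hz] at h
        exact hy h
    simp only [h1]
    rw [Measure.integral_comp_smul, finrank_orthogonal_unit hν, hφ,
      integral_indicator ((continuous_hyperplaneMap a).measurable hFm), smul_eq_mul]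
    congr 1
    rw [abs_of_nonneg (by positivity), ← inv_pow, inv_div]
  · rw [indicator_of_notMem ht]
    refine (integral_congr_ae (Filter.Eventually.of_forall fun y => ?_)).trans (integral_zero _ _)
    refine indicator_of_notMem ?_ _
    rintro ⟨h, -⟩
    rw [hin] at h
    exact ht h

/-- The mean over thin layers of a cone tends to the integral over the base of the cone. -/
lemma tendsto_setIntegral_cone {a : ℝ} (ha : 0 < a) {F : Set (Rd d)}
    (hFm : MeasurableSet F) (hFb : Bornology.IsBounded F) (hF : ∀ y ∈ F, ⟪ν, y⟫ = a)
    {f : Rd d → ℝ} (hf : Continuous f) :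
    Tendsto (fun h : ℝ => h⁻¹ * ∫ z in {z | ⟪ν, z⟫ ∈ Ioo ((1 - h) * a) a ∧
        (a / ⟪ν, z⟫) • z ∈ F}, f z / a) (𝓝[>] 0) (𝓝 (∫ y in F, f y ∂μHE[d - 1])) := by
  set F' := hyperplaneMap ν a ⁻¹' F with hF'
  obtain ⟨R, hR⟩ := ((isometry_hyperplaneMap
    (ν := ν) a).antilipschitz.isBounded_preimage hFb).subset_closedBall 0
  set Q : ℝ → ℝ := fun t => (t / a) ^ (d - 1) *
    ∫ y in F', f ((t / a) • hyperplaneMap ν a y) / a with hQ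
  have hQc : Continuous Q := by
    refine ((continuous_id.div_const a).pow _).mul ?_
    have h1 := continuous_parametric_integral_of_continuous (μ := volume.restrict F')
      (f := fun (t : ℝ) (y : (ℝ ∙ ν)ᗮ) => f ((t / a) • hyperplaneMap ν a y) / a)
      (by
        have := continuous_hyperplaneMap (ν := ν) a
        exact (hf.comp ((continuous_fst.div_const a).smul (this.comp continuous_snd))).div_const a)
      (isCompact_closedBall 0 R)
    rwa [Measure.restrict_restrict Metric.isClosed_closedBall.measurableSet,
      inter_eq_right.2 hR] at h1
  have hQa : Q a = (∫ y in F, f y ∂μHE[d - 1]) / a := by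
    simp only [hQ, div_self ha.ne', one_pow, one_mul, one_smul]
    rw [setIntegral_hyperplane hν hFm hF, integral_div]
  -- The integral over the layer of the cone is `Φ h`, and the quotient by `h` is a difference
  -- quotient at `0`. The derivative is `a * Q a`, whose factor `a` cancels the division of `f` by
  -- `a`.
  set Φ : ℝ → ℝ := fun h => ∫ t in ((1 - h) * a)..a, Q t with hΦ
  have hder : HasDerivAt Φ (∫ y in F, f y ∂μHE[d - 1]) 0 := by
    have h1 : HasDerivAt (fun x => ∫ t in x..a, Q t) (-Q a) ((1 - 0) * a) := by
      have := intervalIntegral.integral_hasDerivAt_left (hQc.intervalIntegrable a a)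
        hQc.stronglyMeasurable.stronglyMeasurableAtFilter hQc.continuousAt
      simpa using this
    have h2 : HasDerivAt (fun h : ℝ => (1 - h) * a) (-1 * a) 0 :=
      ((hasDerivAt_id (0 : ℝ)).const_sub 1).mul_const a
    have h3 := h1.comp (0 : ℝ) h2
    have h4 : -Q a * (-1 * a) = ∫ y in F, f y ∂μHE[d - 1] := by
      rw [hQa]
      field_simp
    rwa [h4] at h3
  have hlim := (hasDerivAt_iff_tendsto_slope_zero.1 hder).mono_left
    (nhdsWithin_mono (0 : ℝ) fun x (hx : 0 < x) => hx.ne')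
  refine hlim.congr' ?_
  filter_upwards [Ioo_mem_nhdsGT (zero_lt_one (α := ℝ))] with h hh
  have hb : 0 < (1 - h) * a := mul_pos (by linarith [hh.2]) ha
  have hba : (1 - h) * a < a := by nlinarith [hh.1]
  rw [setIntegral_cone hν hb hba hFm hFb (hf.div_const a), smul_eq_mul, zero_add]
  congr 1
  simp only [hΦ, sub_zero, one_mul, intervalIntegral.integral_same]
  rw [intervalIntegral.integral_of_le hba.le, integral_Ioc_eq_integral_Ioo]

end Cone

/-! ### Cutoffs built from the gauge -/

section Cutoff

variable {d : ℕ} {S : Set (Rd d)} {h : ℝ}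

/-- A Lipschitz cutoff, equal to `1` well inside of `S` and to `0` outside. -/
noncomputable def gaugeCutoff (S : Set (Rd d)) (h : ℝ) (z : Rd d) : ℝ :=
  max 0 (min 1 (h⁻¹ * (1 - gauge S z)))

/-- The layer of `S` in which the cutoff is not constant. -/
def gaugeLayer (S : Set (Rd d)) (h : ℝ) : Set (Rd d) := {z | gauge S z ∈ Ioo (1 - h) 1}

lemma gaugeCutoff_nonneg (z : Rd d) : 0 ≤ gaugeCutoff S h z := le_max_left _ _

lemma gaugeCutoff_le_one (z : Rd d) : gaugeCutoff S h z ≤ 1 :=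
  max_le zero_le_one (min_le_left _ _)

lemma gaugeCutoff_eq_zero (hh : 0 < h) {z : Rd d} (hz : 1 ≤ gauge S z) :
    gaugeCutoff S h z = 0 :=
  max_eq_left ((min_le_right _ _).trans
    (mul_nonpos_of_nonneg_of_nonpos (inv_pos.2 hh).le (by linarith)))

lemma gaugeCutoff_eq_one (hh : 0 < h) {z : Rd d} (hz : gauge S z ≤ 1 - h) :
    gaugeCutoff S h z = 1 := by
  rw [gaugeCutoff, min_eq_left, max_eq_right zero_le_one]
  rw [inv_mul_eq_div, one_le_div hh]
  linarith

lemma gaugeCutoff_of_mem_layer (hh : 0 < h) {z : Rd d} (hz : z ∈ gaugeLayer S h) :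
    gaugeCutoff S h z = h⁻¹ * (1 - gauge S z) := by
  rw [gaugeCutoff, min_eq_right, max_eq_right]
  · exact mul_nonneg (inv_pos.2 hh).le (by linarith [hz.2])
  · rw [inv_mul_eq_div, div_le_one hh]
    linarith [hz.1]

lemma lipschitzWith_gaugeCutoff {C : NNReal} (hg : LipschitzWith C (gauge S)) (hh : 0 < h) :
    ∃ D, LipschitzWith D (gaugeCutoff S h) := by
  have h1 : LipschitzWith (Real.toNNReal h⁻¹) fun t : ℝ => h⁻¹ * (1 - t) := by
    refine LipschitzWith.of_dist_le_mul fun s t => ?_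
    rw [Real.dist_eq, Real.dist_eq, Real.coe_toNNReal _ (inv_pos.2 hh).le, ← mul_sub, abs_mul,
      abs_of_pos (inv_pos.2 hh), abs_sub_comm]
    ring_nf
    rfl
  exact ⟨_, ((h1.comp hg).const_min 1).const_max 0⟩

lemma isOpen_gaugeLayer (hg : Continuous (gauge S)) : IsOpen (gaugeLayer S h) :=
  isOpen_Ioo.preimage hg

/-- Inside the layer the cutoff is affine in the gauge. Off the layer it takes its global maximum
`1` or minimum `0`, so its derivative vanishes wherever it exists, including at the edge of the
layer. -/
lemma lineDeriv_gaugeCutoff (hh : 0 < h) (hg : Continuous (gauge S)) {z : Rd d}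
    (hd : DifferentiableAt ℝ (gauge S) z) (hd' : DifferentiableAt ℝ (gaugeCutoff S h) z)
    (v : Rd d) : lineDeriv ℝ (gaugeCutoff S h) z (-v) =
      h⁻¹ * (gaugeLayer S h).indicator (fun z => fderiv ℝ (gauge S) z v) z := by
  rw [hd'.lineDeriv_eq_fderiv]
  by_cases hz : z ∈ gaugeLayer S h
  · rw [indicator_of_mem hz]
    have h1 : gaugeCutoff S h =ᶠ[𝓝 z] fun z => h⁻¹ * (1 - gauge S z) := by
      filter_upwards [(isOpen_gaugeLayer hg).mem_nhds hz] with w hw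
      exact gaugeCutoff_of_mem_layer hh hw
    have h2 : HasFDerivAt (fun z => h⁻¹ * (1 - gauge S z)) (h⁻¹ • -fderiv ℝ (gauge S) z) z :=
      (hd.hasFDerivAt.const_sub 1).const_mul h⁻¹
    rw [h1.fderiv_eq, h2.fderiv]
    simp
  · rw [indicator_of_notMem hz, mul_zero]
    have h0 : fderiv ℝ (gaugeCutoff S h) z = 0 := by
      rcases le_or_gt 1 (gauge S z) with h1 | h1
      · refine IsLocalMin.fderiv_eq_zero (Filter.Eventually.of_forall fun w => ?_)
        simp only [gaugeCutoff_eq_zero hh h1]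
        exact gaugeCutoff_nonneg w
      · refine IsLocalMax.fderiv_eq_zero (Filter.Eventually.of_forall fun w => ?_)
        have h2 : gauge S z ≤ 1 - h := by
          by_contra h3
          exact hz ⟨not_le.1 h3, h1⟩
        simp only [gaugeCutoff_eq_one hh h2]
        exact gaugeCutoff_le_one w
    simp [h0]

end Cutoff

/-! ### Integration by parts against the cutoff, and the limit of thin layers -/

section Divergence

variable {d : ℕ} {S : Set (Rd d)} {r : ℝ}

/-- The divergence of a Lipschitz vector field, defined almost everywhere. -/
noncomputable def lineDivergence (G : Rd d → Rd d) (z : Rd d) : ℝ :=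
  ∑ i, lineDeriv ℝ (fun z => G z i) z (EuclideanSpace.single i 1)

lemma lipschitzWith_coord {G : Rd d → Rd d} {C : NNReal} (hG : LipschitzWith C G) (i : Fin d) :
    LipschitzWith C fun z => G z i := by
  refine LipschitzWith.of_dist_le_mul fun x y => le_trans ?_ (hG.dist_le_mul x y)
  rw [Real.dist_eq, dist_eq_norm, ← PiLp.sub_apply]
  exact PiLp.norm_apply_le (p := 2) (G x - G y) i

lemma sum_fderiv_single (f : Rd d →L[ℝ] ℝ) (v : Rd d) :
    ∑ i, f (EuclideanSpace.single i 1) * v i = f v := by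
  conv_rhs => rw [← (EuclideanSpace.basisFun (Fin d) ℝ).sum_repr v]
  simp [map_sum, mul_comm]

lemma measurableSet_gaugeLayer (hg : Continuous (gauge S)) (h : ℝ) :
    MeasurableSet (gaugeLayer S h) := (isOpen_gaugeLayer hg).measurableSet

lemma integrableOn_lineDivergence (hSc : IsCompact S) {G : Rd d → Rd d} {C : NNReal}
    (hG : LipschitzWith C G) : IntegrableOn (lineDivergence G) S := by
  refine integrable_finsetSum _ fun i _ => ?_
  exact ((lipschitzWith_coord hG i).locallyIntegrable_lineDeriv _).integrableOn_isCompact hSc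

variable (hSc : IsCompact S) (hconv : Convex ℝ S) (hr : 0 < r) (hS : Metric.ball 0 r ⊆ S)

include hr hS

lemma mem_nhds_zero_of_ball_subset : S ∈ 𝓝 (0 : Rd d) :=
  Filter.mem_of_superset (Metric.ball_mem_nhds 0 hr) hS

include hSc hconv

lemma mem_of_gauge_le_one {z : Rd d} (hz : gauge S z ≤ 1) : z ∈ S := by
  have := mem_closure_of_gauge_le_one hconv (hS (Metric.mem_ball_self hr))
    (absorbent_of_ball_subset hr hS) hz
  rwa [hSc.isClosed.closure_eq] at this

lemma gaugeLayer_subset (h : ℝ) : gaugeLayer S h ⊆ S := fun _ hz =>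
  mem_of_gauge_le_one hSc hconv hr hS hz.2.le

lemma volume_gaugeLayer_lt_top (h : ℝ) : volume (gaugeLayer S h) < ⊤ :=
  (measure_mono (gaugeLayer_subset hSc hconv hr hS h)).trans_lt hSc.measure_lt_top

lemma support_gaugeCutoff_subset {h : ℝ} (hh : 0 < h) :
    Function.support (gaugeCutoff S h) ⊆ S := fun z hz => by
  refine mem_of_gauge_le_one hSc hconv hr hS (le_of_not_gt fun h1 => hz ?_)
  exact gaugeCutoff_eq_zero hh h1.le

/-- The mean over a thin layer of the derivative of the gauge along a vector field. -/
lemma integral_lineDivergence_mul_gaugeCutoff {G : Rd d → Rd d} {C : NNReal}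
    (hG : LipschitzWith C G) {h : ℝ} (hh : 0 < h) :
    ∫ z, lineDivergence G z * gaugeCutoff S h z =
      h⁻¹ * ∫ z in gaugeLayer S h, fderiv ℝ (gauge S) z (G z) := by
  obtain ⟨L, hL⟩ := hconv.lipschitz_gauge (mem_nhds_zero_of_ball_subset hr hS)
  obtain ⟨D, hD⟩ := lipschitzWith_gaugeCutoff hL hh
  have hcs : HasCompactSupport (gaugeCutoff S h) :=
    HasCompactSupport.of_support_subset_isCompact hSc
      (support_gaugeCutoff_subset hSc hconv hr hS hh)
  have hmeas := measurableSet_gaugeLayer hL.continuous h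
  have hint1 : ∀ i, Integrable fun z => lineDeriv ℝ (fun z => G z i) z (EuclideanSpace.single i 1) *
      gaugeCutoff S h z := fun i => by
    have h1 : Integrable (gaugeCutoff S h) := hD.continuous.integrable_of_hasCompactSupport hcs
    exact h1.bdd_mul (aestronglyMeasurable_lineDeriv (lipschitzWith_coord hG i).continuous _)
      (Filter.Eventually.of_forall fun z =>
        norm_lineDeriv_le_of_lipschitz ℝ (lipschitzWith_coord hG i))
  obtain ⟨B, hB⟩ := hSc.exists_bound_of_continuousOn hG.continuous.continuousOn
  have hint2 : ∀ i, IntegrableOn (fun z => fderiv ℝ (gauge S) z (EuclideanSpace.single i 1) *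
      G z i) (gaugeLayer S h) := fun i => by
    refine Measure.integrableOn_of_bounded (volume_gaugeLayer_lt_top hSc hconv hr hS h).ne
      (M := L * B) ?_ ?_
    · exact (measurable_fderiv_apply_const ℝ (gauge S) _).aestronglyMeasurable.mul
        (lipschitzWith_coord hG i).continuous.aestronglyMeasurable
    · refine ae_restrict_of_forall_mem hmeas fun z hz => ?_
      rw [norm_mul]
      refine mul_le_mul ?_ ?_ (norm_nonneg _) L.2
      · refine ((fderiv ℝ (gauge S) z).le_opNorm _).trans ?_
        rw [PiLp.norm_single, norm_one, mul_one]
        exact norm_fderiv_le_of_lipschitz ℝ hL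
      · exact (PiLp.norm_apply_le (G z) i).trans (hB z (gaugeLayer_subset hSc hconv hr hS h hz))
  have hterm : ∀ i, ∫ z, lineDeriv ℝ (fun z => G z i) z (EuclideanSpace.single i 1) *
      gaugeCutoff S h z = h⁻¹ * ∫ z in gaugeLayer S h,
        fderiv ℝ (gauge S) z (EuclideanSpace.single i 1) * G z i := fun i => by
    rw [(lipschitzWith_coord hG i).integral_lineDeriv_mul_eq hD hcs, ← integral_indicator hmeas,
      ← integral_const_mul]
    refine integral_congr_ae ?_
    filter_upwards [hL.ae_differentiableAt, hD.ae_differentiableAt] with z hz1 hz2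
    rw [lineDeriv_gaugeCutoff hh hL.continuous hz1 hz2, mul_assoc]
    congr 1
    by_cases hz : z ∈ gaugeLayer S h <;> simp [hz]
  simp only [lineDivergence, Finset.sum_mul]
  rw [integral_finsetSum _ fun i _ => hint1 i]
  simp only [hterm]
  rw [← Finset.mul_sum, ← integral_finsetSum _ fun i _ => hint2 i]
  simp only [sum_fderiv_single]

/-- The cutoffs are bounded by `1`, supported in `S`, and tend pointwise to the indicator of the
interior of `S`; the frontier of a convex set is null. Dominated convergence applies. -/
lemma tendsto_integral_lineDivergence_mul_gaugeCutoff {G : Rd d → Rd d} {C : NNReal}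
    (hG : LipschitzWith C G) :
    Tendsto (fun h => ∫ z, lineDivergence G z * gaugeCutoff S h z) (𝓝[>] 0)
      (𝓝 (∫ z in S, lineDivergence G z)) := by
  have h0 := mem_nhds_zero_of_ball_subset hr hS
  have hg := continuous_gauge hconv h0
  have hdiv := integrableOn_lineDivergence hSc hG
  have hlim : ∫ z in S, lineDivergence G z = ∫ z, (interior S).indicator (lineDivergence G) z := by
    rw [integral_indicator isOpen_interior.measurableSet]
    exact (setIntegral_congr_set
      (interior_ae_eq_of_null_frontier (hconv.addHaar_frontier volume))).symm
  rw [hlim]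
  refine tendsto_integral_filter_of_dominated_convergence
    (fun z => ‖S.indicator (lineDivergence G) z‖) ?_ ?_
    ((integrable_indicator_iff hSc.measurableSet).2 hdiv).norm ?_
  · filter_upwards [self_mem_nhdsWithin] with h hh
    have h1 : (fun z => lineDivergence G z * gaugeCutoff S h z) =
        fun z => S.indicator (lineDivergence G) z * gaugeCutoff S h z := by
      ext z
      by_cases hz : z ∈ S
      · rw [indicator_of_mem hz]
      · have : gaugeCutoff S h z = 0 := by
          by_contra hne
          exact hz (support_gaugeCutoff_subset hSc hconv hr hS hh hne)
        rw [this, mul_zero, mul_zero]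
    rw [h1]
    obtain ⟨L, hL⟩ := hconv.lipschitz_gauge h0
    obtain ⟨D, hD⟩ := lipschitzWith_gaugeCutoff hL (h := h) hh
    exact ((integrable_indicator_iff hSc.measurableSet).2 hdiv).aestronglyMeasurable.mul
      hD.continuous.aestronglyMeasurable
  · filter_upwards [self_mem_nhdsWithin] with h hh
    refine Filter.Eventually.of_forall fun z => ?_
    by_cases hz : z ∈ S
    · rw [indicator_of_mem hz, norm_mul, Real.norm_of_nonneg (gaugeCutoff_nonneg z)]
      exact mul_le_of_le_one_right (norm_nonneg _) (gaugeCutoff_le_one z)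
    · have : gaugeCutoff S h z = 0 := by
        by_contra hne
        exact hz (support_gaugeCutoff_subset hSc hconv hr hS hh hne)
      simp [this]
  · refine Filter.Eventually.of_forall fun z => ?_
    by_cases hz : z ∈ interior S
    · have hz1 : gauge S z < 1 := (gauge_lt_one_iff_mem_interior hconv h0).2 hz
      refine tendsto_const_nhds.congr' ?_
      filter_upwards [Ioo_mem_nhdsGT (sub_pos.2 hz1)] with h hh
      rw [indicator_of_mem hz, gaugeCutoff_eq_one hh.1 (by linarith [hh.2]), mul_one]
    · have hz1 : 1 ≤ gauge S z :=
        not_lt.1 fun h => hz ((gauge_lt_one_iff_mem_interior hconv h0).1 h)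
      refine tendsto_const_nhds.congr' ?_
      filter_upwards [self_mem_nhdsWithin] with h hh
      rw [indicator_of_notMem hz, gaugeCutoff_eq_zero hh hz1, mul_zero]

/-- The layers have finite volume and decrease to the empty set, as the gauge is strictly less than
`1` on them. -/
lemma tendsto_volume_gaugeLayer :
    Tendsto (fun h => volume.real (gaugeLayer S h)) (𝓝[>] 0) (𝓝 0) := by
  have hg := continuous_gauge hconv (mem_nhds_zero_of_ball_subset hr hS)
  have h1 := tendsto_measure_biInter_gt (μ := (volume : Measure (Rd d))) (s := gaugeLayer S)
    (a := (0 : ℝ)) (fun h _ => (measurableSet_gaugeLayer hg h).nullMeasurableSet)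
    (fun i j _ hij z hz => ⟨by linarith [hz.1], hz.2⟩)
    ⟨1, one_pos, (volume_gaugeLayer_lt_top hSc hconv hr hS 1).ne⟩
  have h2 : (⋂ h : ℝ, ⋂ (_ : h > 0), gaugeLayer S h) = ∅ := by
    rw [eq_empty_iff_forall_notMem]
    intro z hz
    simp only [mem_iInter] at hz
    have h3 := (hz 1 one_pos).2
    have h4 := (hz (1 - gauge S z) (sub_pos.2 h3)).1
    linarith
  rw [h2, measure_empty] at h1
  have h3 := (ENNReal.tendsto_toReal ENNReal.zero_ne_top).comp h1
  rwa [ENNReal.toReal_zero] at h3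

end Divergence

/-! ### The divergence theorem with flat faces and a tangential remainder -/

section DivergenceTheorem

variable {d : ℕ} {S : Set (Rd d)} {r : ℝ}

/-- The divergence theorem for a Lipschitz vector field on a convex body with flat faces `F j`, if
the field is tangential at the remaining points of the boundary. -/
theorem integral_lineDivergence (hSc : IsCompact S) (hconv : Convex ℝ S) (hr : 0 < r)
    (hS : Metric.ball 0 r ⊆ S) {G : Rd d → Rd d} {C : NNReal} (hG : LipschitzWith C G)
    {κ : Type*} [Fintype κ] {ν : κ → Rd d} {a : κ → ℝ} {F : κ → Set (Rd d)}
    (hν : ∀ j, ‖ν j‖ = 1) (hSν : ∀ j, ∀ w ∈ S, ⟪ν j, w⟫ ≤ a j) (hFm : ∀ j, MeasurableSet (F j))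
    (hFS : ∀ j, F j ⊆ S) (hF : ∀ j, ∀ y ∈ F j, ⟪ν j, y⟫ = a j)
    (hdisj : Pairwise fun i j => Disjoint (F i) (F j))
    (hrest : ∀ y ∈ frontier S, (∀ j, y ∉ F j) →
      ∃ n, ‖n‖ = 1 ∧ (∀ w ∈ S, ⟪n, w⟫ ≤ ⟪n, y⟫) ∧ ⟪n, G y⟫ = 0) :
    ∫ z in S, lineDivergence G z = ∑ j, ∫ y in F j, ⟪ν j, G y⟫ ∂μHE[d - 1] := by
  classical
  have h0 := mem_nhds_zero_of_ball_subset hr hS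
  obtain ⟨L, hL⟩ := hconv.lipschitz_gauge h0
  have hg := hL.continuous
  obtain ⟨R, hR0, hR⟩ := hSc.isBounded.subset_closedBall_lt 0 0
  have ha : ∀ j, 0 < a j := fun j =>
    (half_pos hr).trans_le (norm_mul_le_inner hr hS (hν j) (hSν j))
  set cone : ℝ → κ → Set (Rd d) := fun h j =>
    {z | ⟪ν j, z⟫ ∈ Ioo ((1 - h) * a j) (a j) ∧ (a j / ⟪ν j, z⟫) • z ∈ F j} with hcone
  set f : κ → Rd d → ℝ := fun j z => ⟪ν j, G z⟫ / a j with hf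
  have hfc : ∀ j, Continuous (f j) := fun j =>
    (continuous_const.inner hG.continuous).div_const _
  have hconem : ∀ h j, MeasurableSet (cone h j) := fun h j => by
    have h1 : Measurable fun z : Rd d => ⟪ν j, z⟫ := by fun_prop
    exact (h1 measurableSet_Ioo).inter (((measurable_const.div h1).smul measurable_id) (hFm j))
  -- On the cone over a face the gauge equals `⟪ν j, z⟫ / a j`, so the scaling in the definition of
  -- the cone is the radial projection to the boundary of `S`.
  have hmem : ∀ h ∈ Ioo (0 : ℝ) 1, ∀ j z, z ∈ gaugeLayer S h →
      (z ∈ cone h j ↔ (gauge S z)⁻¹ • z ∈ F j) := by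
    intro h hh j z hz
    have hgz : 0 < gauge S z := by linarith [hz.1, hh.2]
    constructor
    · rintro ⟨h1, h2⟩
      have hb : 0 < ⟪ν j, z⟫ := (mul_pos (by linarith [hh.2]) (ha j)).trans h1.1
      have h3 : z = (⟪ν j, z⟫ / a j) • (a j / ⟪ν j, z⟫) • z := by
        rw [smul_smul]
        have : ⟪ν j, z⟫ / a j * (a j / ⟪ν j, z⟫) = 1 := by
          have := (ha j).ne'
          field_simp
        rw [this, one_smul]
      have h4 : gauge S z = ⟪ν j, z⟫ / a j := by
        conv_lhs => rw [h3]
        exact gauge_smul_of_inner_eq hr hS (ha j) (hSν j) (hFS j h2) (hF j _ h2)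
          (div_pos hb (ha j)).le
      rwa [h4, inv_div]
    · intro h1
      have h2 := hF j _ h1
      rw [real_inner_smul_right, inv_mul_eq_div, div_eq_iff hgz.ne'] at h2
      refine ⟨?_, ?_⟩
      · rw [h2]
        exact ⟨by nlinarith [hz.1, ha j], by nlinarith [hz.2, ha j]⟩
      · have : a j / ⟪ν j, z⟫ = (gauge S z)⁻¹ := by
          rw [h2]
          have := (ha j).ne'
          field_simp
        rwa [this]
  have hsub : ∀ h ∈ Ioo (0 : ℝ) 1, ∀ j, cone h j ⊆ gaugeLayer S h := by
    rintro h hh j z ⟨h1, h2⟩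
    have hb : 0 < ⟪ν j, z⟫ := (mul_pos (by linarith [hh.2]) (ha j)).trans h1.1
    have h3 : z = (⟪ν j, z⟫ / a j) • (a j / ⟪ν j, z⟫) • z := by
      rw [smul_smul]
      have : ⟪ν j, z⟫ / a j * (a j / ⟪ν j, z⟫) = 1 := by
        have := (ha j).ne'
        field_simp
      rw [this, one_smul]
    have h4 : gauge S z = ⟪ν j, z⟫ / a j := by
      conv_lhs => rw [h3]
      exact gauge_smul_of_inner_eq hr hS (ha j) (hSν j) (hFS j h2) (hF j _ h2)
        (div_pos hb (ha j)).le
    refine ⟨?_, ?_⟩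
    · rw [h4, lt_div_iff₀ (ha j)]
      exact h1.1
    · rw [h4, div_lt_one (ha j)]
      exact h1.2
  set W : Rd d → ℝ := fun z => fderiv ℝ (gauge S) z (G z) with hW
  -- If the radial projection `y` of `z` is on a face, the derivative of the gauge is that of the
  -- face and the difference vanishes. Otherwise the derivative along `G z` is `⟪n, G z⟫ / ⟪n, y⟫`;
  -- since `G y` is tangential, the numerator is controlled by the Lipschitz bound and `‖z - y‖ ≤ h
  -- R`, and the denominator is at least `r / 2`.
  have hpt : ∀ h ∈ Ioo (0 : ℝ) 1, ∀ z ∈ gaugeLayer S h, DifferentiableAt ℝ (gauge S) z →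
      ‖W z - ∑ j, (cone h j).indicator (f j) z‖ ≤ C * (h * R) / (r / 2) := by
    intro h hh z hz hd
    have hgz : 0 < gauge S z := by linarith [hz.1, hh.2]
    set s := gauge S z with hs
    set y := s⁻¹ • z with hy
    have hzy : z = s • y := by rw [hy, smul_smul, mul_inv_cancel₀ hgz.ne', one_smul]
    have hgy : gauge S y = 1 := by
      rw [hy, gauge_smul_of_nonneg (inv_nonneg.2 hgz.le), ← hs, smul_eq_mul,
        inv_mul_cancel₀ hgz.ne']
    have hyS : y ∈ S := mem_of_gauge_le_one hSc hconv hr hS hgy.le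
    by_cases hex : ∃ j, y ∈ F j
    · obtain ⟨j, hj⟩ := hex
      have h1 : ∑ k, (cone h k).indicator (f k) z = f j z := by
        rw [Finset.sum_eq_single j, indicator_of_mem ((hmem h hh j z hz).2 hj)]
        · intro k _ hk
          refine indicator_of_notMem (fun hzk => ?_) _
          exact (hdisj hk).le_bot ⟨(hmem h hh k z hz).1 hzk, hj⟩
        · exact fun hj => absurd (Finset.mem_univ j) hj
      have h2 : W z = f j z := by
        simp only [hW, hf]
        rw [hzy] at hd
        have := fderiv_gauge_smul hr hS (ha j) (hSν j) hyS (hF j y hj) hgz.le hd (G z)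
        rwa [← hzy] at this
      rw [h1, h2, sub_self, norm_zero]
      have := hh.1
      positivity
    · push Not at hex
      have h1 : ∑ k, (cone h k).indicator (f k) z = 0 :=
        Finset.sum_eq_zero fun k _ =>
          indicator_of_notMem (fun hzk => hex k ((hmem h hh k z hz).1 hzk)) _
      have hfr : y ∈ frontier S := (gauge_eq_one_iff_mem_frontier hconv h0).1 hgy
      obtain ⟨n, hn1, hn, hnG⟩ := hrest y hfr hex
      have hna := norm_mul_le_inner hr hS hn1 hn
      have hnp : 0 < ⟪n, y⟫ := (half_pos hr).trans_le hna
      have h2 : W z = ⟪n, G z⟫ / ⟪n, y⟫ := by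
        simp only [hW]
        rw [hzy] at hd
        have := fderiv_gauge_smul hr hS hnp hn hyS rfl hgz.le hd (G z)
        rwa [← hzy] at this
      have h3 : ‖z - y‖ ≤ h * R := by
        have e1 : z - y = (s - 1) • y := by
          conv_lhs => rw [hzy]
          rw [sub_smul, one_smul]
        rw [e1, norm_smul]
        have e2 : ‖y‖ ≤ R := mem_closedBall_zero_iff.1 (hR hyS)
        have e3 : ‖s - 1‖ ≤ h := by
          rw [Real.norm_eq_abs, abs_le]
          exact ⟨by linarith [hz.1], by linarith [hz.2, hh.1]⟩
        exact mul_le_mul e3 e2 (norm_nonneg _) hh.1.le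
      rw [h1, sub_zero, h2, norm_div, Real.norm_of_nonneg hnp.le]
      have h4 : ‖⟪n, G z⟫‖ ≤ C * (h * R) := by
        have e1 : ⟪n, G z⟫ = ⟪n, G z - G y⟫ := by rw [inner_sub_right, hnG, sub_zero]
        rw [e1]
        refine (norm_inner_le_norm _ _).trans ?_
        rw [hn1, one_mul]
        refine (hG.norm_sub_le z y).trans ?_
        exact mul_le_mul_of_nonneg_left h3 C.2
      have := hh.1
      exact div_le_div₀ (by positivity) h4 (half_pos hr) hna
  obtain ⟨B, hB⟩ := hSc.exists_bound_of_continuousOn hG.continuous.continuousOn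
  have hWint : ∀ h, IntegrableOn W (gaugeLayer S h) := fun h => by
    refine Measure.integrableOn_of_bounded (volume_gaugeLayer_lt_top hSc hconv hr hS h).ne
      (M := L * B) ?_ ?_
    · have : W = fun z => ∑ i, fderiv ℝ (gauge S) z (EuclideanSpace.single i 1) * G z i := by
        ext z
        rw [sum_fderiv_single]
      rw [this]
      refine (Finset.measurable_fun_sum _ fun i _ => ?_).aestronglyMeasurable
      exact (measurable_fderiv_apply_const ℝ (gauge S) _).mul
        (lipschitzWith_coord hG i).continuous.measurable
    · refine ae_restrict_of_forall_mem (measurableSet_gaugeLayer hg h) fun z hz => ?_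
      refine ((fderiv ℝ (gauge S) z).le_opNorm _).trans ?_
      exact mul_le_mul (norm_fderiv_le_of_lipschitz ℝ hL)
        (hB z (gaugeLayer_subset hSc hconv hr hS h hz)) (norm_nonneg _) L.2
  have hfint : ∀ h j, IntegrableOn ((cone h j).indicator (f j)) (gaugeLayer S h) := fun h j =>
    (((hfc j).continuousOn.integrableOn_compact hSc).mono_set
      (gaugeLayer_subset hSc hconv hr hS h)).indicator (hconem h j)
  -- The factor `h` of the pointwise bound absorbs `h⁻¹`; what remains is a constant times the
  -- volume of the layer, which tends to zero.
  have herr : ∀ h ∈ Ioo (0 : ℝ) 1,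
      ‖h⁻¹ * (∫ z in gaugeLayer S h, W z) - ∑ j, h⁻¹ * ∫ z in cone h j, f j z‖ ≤
        C * R / (r / 2) * volume.real (gaugeLayer S h) := by
    intro h hh
    have h1 : ∀ j, ∫ z in cone h j, f j z =
        ∫ z in gaugeLayer S h, (cone h j).indicator (f j) z := fun j => by
      rw [setIntegral_indicator (hconem h j), inter_eq_right.2 (hsub h hh j)]
    simp only [h1]
    rw [← Finset.mul_sum, ← integral_finsetSum _ fun j _ => hfint h j, ← mul_sub,
      ← integral_sub (hWint h) (integrable_finsetSum _ fun j _ => hfint h j), norm_mul,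
      Real.norm_of_nonneg (inv_pos.2 hh.1).le, inv_mul_le_iff₀ hh.1]
    refine (norm_setIntegral_le_of_norm_le_const_ae
      (volume_gaugeLayer_lt_top hSc hconv hr hS h) (C := C * (h * R) / (r / 2)) ?_).trans_eq
        (by ring)
    rw [ae_restrict_iff' (measurableSet_gaugeLayer hg h)]
    filter_upwards [hL.ae_differentiableAt] with z hd hz
    exact hpt h hh z hz hd
  have hlim1 : Tendsto (fun h => h⁻¹ * ∫ z in gaugeLayer S h, W z) (𝓝[>] 0)
      (𝓝 (∫ z in S, lineDivergence G z)) := by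
    refine (tendsto_integral_lineDivergence_mul_gaugeCutoff hSc hconv hr hS hG).congr' ?_
    filter_upwards [self_mem_nhdsWithin] with h hh
    exact integral_lineDivergence_mul_gaugeCutoff hSc hconv hr hS hG hh
  have hlim2 : Tendsto (fun h => ∑ j, h⁻¹ * ∫ z in cone h j, f j z) (𝓝[>] 0)
      (𝓝 (∑ j, ∫ y in F j, ⟪ν j, G y⟫ ∂μHE[d - 1])) :=
    tendsto_finsetSum _ fun j _ => tendsto_setIntegral_cone (hν j) (ha j) (hFm j)
      (hSc.isBounded.subset (hFS j)) (hF j) (continuous_const.inner hG.continuous)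
  have hlim3 : Tendsto (fun h => h⁻¹ * (∫ z in gaugeLayer S h, W z) -
      ∑ j, h⁻¹ * ∫ z in cone h j, f j z) (𝓝[>] 0) (𝓝 0) := by
    have h1 := (tendsto_volume_gaugeLayer hSc hconv hr hS).const_mul (C * R / (r / 2))
    rw [mul_zero] at h1
    refine squeeze_zero_norm' ?_ h1
    filter_upwards [Ioo_mem_nhdsGT (zero_lt_one (α := ℝ))] with h hh
    exact herr h hh
  have := tendsto_nhds_unique (hlim1.sub hlim2) hlim3
  exact sub_eq_zero.1 this

end DivergenceTheorem

/-! ### Sampling and divergence -/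

section NoFlux

variable {d : ℕ} {Ω : Set (Rd d)}

lemma exists_isOutwardNormal (hconv : Convex ℝ Ω) (hint : (interior Ω).Nonempty)
    {x : Rd d} (hx : x ∈ frontier Ω) : ∃ n, IsOutwardNormal Ω x n := by
  obtain ⟨f, hf⟩ := geometric_hahn_banach_open_point hconv.interior isOpen_interior hx.2
  obtain ⟨w₀, hw₀⟩ := hint
  have hf0 : f ≠ 0 := by
    rintro rfl
    simpa using hf w₀ hw₀
  have hle : ∀ w ∈ Ω, f w ≤ f x := fun w hw => by
    have h1 : w ∈ closure (interior Ω) := by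
      rw [hconv.closure_interior_eq_closure_of_nonempty_interior ⟨w₀, hw₀⟩]
      exact subset_closure hw
    exact closure_minimal (fun z hz => (hf z hz).le)
      (isClosed_le f.continuous continuous_const) h1
  set n₀ : Rd d := (InnerProductSpace.toDual ℝ (Rd d)).symm f with hn₀
  have hf' : ∀ z, f z = ⟪n₀, z⟫ := fun z => by rw [hn₀, InnerProductSpace.toDual_symm_apply]
  have hn0 : n₀ ≠ 0 := by simpa [hn₀] using hf0
  have hpos : 0 < ‖n₀‖ := norm_pos_iff.2 hn0
  refine ⟨‖n₀‖⁻¹ • n₀, ?_, fun y hy => ?_⟩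
  · rw [norm_smul, norm_inv, norm_norm, inv_mul_cancel₀ hpos.ne']
  · rw [real_inner_smul_left, inner_sub_right, ← hf', ← hf']
    exact mul_nonpos_of_nonneg_of_nonpos (inv_pos.2 hpos).le (by linarith [hle y hy])

lemma ContDiffOn.exists_lipschitzOnWith (hΩ : IsCompact Ω) (hconv : Convex ℝ Ω)
    (hint : (interior Ω).Nonempty) {F : Type*} [NormedAddCommGroup F] [NormedSpace ℝ F]
    {m : Rd d → F} (hm : ContDiffOn ℝ 1 m Ω) : ∃ C, LipschitzOnWith C m Ω := by
  obtain ⟨C, hC⟩ := hΩ.exists_bound_of_continuousOn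
    (hm.continuousOn_fderivWithin (uniqueDiffOn_convex hconv hint) le_rfl)
  refine ⟨Real.toNNReal C, LipschitzOnWith.of_dist_le_mul fun x hx y hy => ?_⟩
  rw [dist_eq_norm, dist_eq_norm]
  exact (lipschitz_of_norm_fderivWithin_le hconv (hm.differentiableOn one_ne_zero) hC hx hy).trans
    (mul_le_mul_of_nonneg_right (Real.le_coe_toNNReal C) (norm_nonneg _))

lemma continuousOn_divergenceWithin (hconv : Convex ℝ Ω)
    (hint : (interior Ω).Nonempty) {m : Rd d → Rd d} (hm : ContDiffOn ℝ 1 m Ω) :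
    ContinuousOn (divergenceWithin Ω m) Ω := by
  have h1 := hm.continuousOn_fderivWithin (uniqueDiffOn_convex hconv hint) le_rfl
  refine continuousOn_finsetSum _ fun i _ => ?_
  exact (EuclideanSpace.proj (𝕜 := ℝ) i).continuous.comp_continuousOn
    (h1.clm_apply continuousOn_const)

/-- At points corresponding to the interior of `Ω` the field `G` agrees with the translate of `m` on
a whole neighbourhood, so the derivatives coincide. -/
lemma lineDivergence_eq_divergenceWithin {m G : Rd d → Rd d} (hm : ContDiffOn ℝ 1 m Ω) {p z : Rd d}
    (hz : p + z ∈ interior Ω) (hG : ∀ w, p + w ∈ Ω → G w = m (p + w)) :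
    lineDivergence G z = divergenceWithin Ω m (p + z) := by
  have hnhds : Ω ∈ 𝓝 (p + z) := mem_interior_iff_mem_nhds.1 hz
  have hd : DifferentiableAt ℝ m (p + z) :=
    ((hm.differentiableOn one_ne_zero) _ (interior_subset hz)).differentiableAt hnhds
  have h1 : HasFDerivAt (fun w => m (p + w)) (fderivWithin ℝ m Ω (p + z)) z := by
    rw [fderivWithin_of_mem_nhds hnhds]
    exact (hd.hasFDerivAt.comp z ((hasFDerivAt_id z).const_add p)).congr_fderiv
      (ContinuousLinearMap.comp_id _)
  have h2 : G =ᶠ[𝓝 z] fun w => m (p + w) := by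
    have : ∀ᶠ w in 𝓝 z, p + w ∈ Ω := (continuous_const_add p).continuousAt.eventually hnhds
    exact this.mono hG
  have h3 : HasFDerivAt G (fderivWithin ℝ m Ω (p + z)) z := h1.congr_of_eventuallyEq h2
  refine Finset.sum_congr rfl fun i _ => ?_
  have h4 : HasFDerivAt (fun z => G z i)
      ((EuclideanSpace.proj (𝕜 := ℝ) i).comp (fderivWithin ℝ m Ω (p + z))) z :=
    (EuclideanSpace.proj (𝕜 := ℝ) i).hasFDerivAt.comp z h3
  rw [h4.differentiableAt.lineDeriv_eq_fderiv, h4.fderiv]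
  rfl

end NoFlux

/-! ### The divergence theorem on cells -/

namespace Mesh

variable {d : ℕ} {Ω : Set (Rd d)} (𝒯 : Mesh Ω)

/-- The other cells are finitely many, so a point of the interior of `Ω` outside all their closures
has a neighbourhood covered by `K` alone and is not a boundary point of `K`. -/
lemma mem_frontier_of_notMem_face (hΩ : IsCompact Ω) {K : 𝒯.ι} {x : Rd d}
    (hx : x ∈ frontier (closure (𝒯.cell K))) (h : ∀ L, L ≠ K → x ∉ 𝒯.face K L) :
    x ∈ frontier Ω := by
  have hxK : x ∈ closure (𝒯.cell K) := by
    have := frontier_subset_closure hx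
    rwa [closure_closure] at this
  refine ⟨subset_closure (𝒯.closure_cell_subset hΩ K hxK), fun hxi => hx.2 ?_⟩
  set V := interior Ω \ ⋃ L ∈ {L | L ≠ K}, closure (𝒯.cell L) with hV
  have hVo : IsOpen V := isOpen_interior.sdiff
    ((Set.toFinite _).isClosed_biUnion fun L _ => isClosed_closure)
  have hxV : x ∈ V := by
    refine ⟨hxi, fun hmem => ?_⟩
    simp only [mem_iUnion] at hmem
    obtain ⟨L, hL, hxL⟩ := hmem
    exact h L hL ⟨hxK, hxL⟩
  refine interior_mono subset_closure (interior_maximal (fun z hz => ?_) hVo hxV)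
  have hzΩ := interior_subset hz.1
  rw [← 𝒯.iUnion_cell, mem_iUnion] at hzΩ
  obtain ⟨L, hL⟩ := hzΩ
  by_cases hLK : L = K
  · exact hLK ▸ hL
  · exact absurd (mem_biUnion (show L ∈ {L | L ≠ K} from hLK) (subset_closure hL)) hz.2

/-- The divergence theorem on a cell, for a vector field without flux through the boundary of the
domain. -/
lemma setIntegral_cell_divergenceWithin (hΩ : IsCompact Ω) (hconv : Convex ℝ Ω)
    (hint : (interior Ω).Nonempty) {m : Rd d → Rd d} (hm : ContDiffOn ℝ 1 m Ω)
    (hflux : ∀ x ∈ frontier Ω, ∀ n, IsOutwardNormal Ω x n → ⟪m x, n⟫ = 0) (K : 𝒯.ι) :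
    ∫ x in 𝒯.cell K, divergenceWithin Ω m x =
      ∑ L ∈ 𝒯.nbrs K, ∫ x in 𝒯.face K L, ⟪m x, 𝒯.normal K L⟫ ∂μHE[d - 1] := by
  classical
  obtain ⟨C, hC⟩ := ContDiffOn.exists_lipschitzOnWith hΩ hconv hint hm
  -- A Lipschitz extension to the whole space is what the integration by parts requires; it agrees
  -- with `m` on `Ω`.
  obtain ⟨G₀, hG₀, hmG⟩ := hC.extend_finite_dimension
  set p := 𝒯.center K with hp
  obtain ⟨r, hr, hball⟩ := Metric.isOpen_iff.1 isOpen_interior p (𝒯.center_mem K)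
  set e := Fintype.equivFin 𝒯.ι
  -- Translation brings the centre of the cell to the origin, so that the gauge of the cell is
  -- continuous.
  set S : Set (Rd d) := (fun z => p + z) ⁻¹' closure (𝒯.cell K)
  set iso : Rd d ≃ᵢ Rd d := IsometryEquiv.addLeft p
  have hisoh : (iso : Rd d → Rd d) = fun z => p + z := rfl
  have hcl : IsCompact (closure (𝒯.cell K)) :=
    hΩ.of_isClosed_subset isClosed_closure (𝒯.closure_cell_subset hΩ K)
  have hSc : IsCompact S := iso.toHomeomorph.isCompact_preimage.2 hcl
  have hSconv : Convex ℝ S := (𝒯.convex_cell K).closure.translate_preimage_right p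
  have hSb : Metric.ball 0 r ⊆ S := fun z hz => by
    refine subset_closure (interior_subset (hball ?_))
    rw [Metric.mem_ball, dist_eq_norm, add_sub_cancel_left]
    simpa using hz
  have hGl : LipschitzWith _ fun z => G₀ (p + z) := hG₀.comp (isometry_add_left p).lipschitz
  choose ν c hsep using fun j : {L // L ≠ K} => 𝒯.exists_separates (Ne.symm j.2)
  -- Interfaces may overlap in null sets, whereas the divergence theorem wants disjoint faces. From
  -- each interface those that come earlier in the enumeration `e` are removed, which keeps the
  -- union and all integrals.
  set A : {L // L ≠ K} → Set (Rd d) := fun j =>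
    𝒯.face K j \ ⋃ L ∈ {L : {L // L ≠ K} | e L < e j}, 𝒯.face K L with hA
  have hAm : ∀ j, MeasurableSet (A j) := fun j => (𝒯.isClosed_face K j).measurableSet.diff
    (MeasurableSet.biUnion (to_countable _) fun L _ => (𝒯.isClosed_face K L).measurableSet)
  have hdisj : ∀ i j, e i.1 < e j.1 → Disjoint (A i) (A j) := fun i j hij =>
    disjoint_left.2 fun x hi hj =>
      hj.2 (mem_biUnion (show i ∈ {L : {L // L ≠ K} | e L < e j} from hij) hi.1)
  have hcover : ∀ x, (∀ j, x ∉ A j) → ∀ L, L ≠ K → x ∉ 𝒯.face K L := by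
    intro x hx L hLK hxL
    obtain ⟨j, hj, hmin⟩ := Finset.exists_min_image
      (Finset.univ.filter fun j : {L // L ≠ K} => x ∈ 𝒯.face K j) (fun j => e j.1)
      ⟨⟨L, hLK⟩, by simpa using hxL⟩
    refine hx j ⟨(Finset.mem_filter.1 hj).2, fun hmem => ?_⟩
    simp only [mem_iUnion] at hmem
    obtain ⟨i, hi, hxi⟩ := hmem
    exact absurd (hmin i (Finset.mem_filter.2 ⟨Finset.mem_univ i, hxi⟩)) (not_le.2 hi)
  have hmain := integral_lineDivergence hSc hSconv hr hSb hGl (ν := ν)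
    (a := fun j => c j - ⟪ν j, p⟫) (F := fun j => iso ⁻¹' A j)
    (fun j => (hsep j).norm_eq)
    (fun j w hw => by
      have := (hsep j).left _ hw
      rw [inner_add_right] at this
      linarith)
    (fun j => iso.continuous.measurable (hAm j))
    (fun j y hy => hy.1.1)
    (fun j y hy => by
      have := (hsep j).inner_eq hy.1
      rw [hisoh] at this
      simp only [inner_add_right] at this
      linarith)
    (fun i j hij => by
      rcases lt_trichotomy (e i.1) (e j.1) with h | h | h
      · exact (hdisj i j h).preimage _
      · exact absurd (Subtype.ext (e.injective h)) hij
      · exact (hdisj j i h).symm.preimage _)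
    -- A boundary point of the cell on no interface is a boundary point of `Ω`. An outward normal of
    -- `Ω` there also supports the cell, and the field is orthogonal to it by the no-flux condition.
    (fun y hy hyF => by
      have hyf : p + y ∈ frontier (closure (𝒯.cell K)) := by
        have h1 := iso.toHomeomorph.preimage_frontier (closure (𝒯.cell K))
        have h2 : y ∈ iso.toHomeomorph ⁻¹' frontier (closure (𝒯.cell K)) := by
          rw [h1]
          exact hy
        exact h2
      have hfr := 𝒯.mem_frontier_of_notMem_face hΩ hyf (hcover _ hyF)
      obtain ⟨n, hn⟩ := exists_isOutwardNormal hconv hint hfr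
      refine ⟨n, hn.1, fun w hw => ?_, ?_⟩
      · have h1 := hn.2 _ (𝒯.closure_cell_subset hΩ K hw)
        rw [add_sub_add_left_eq_sub, inner_sub_right] at h1
        linarith
      · have h1 : p + y ∈ Ω := hΩ.isClosed.closure_eq ▸ hfr.1
        rw [← hmG h1, real_inner_comm]
        exact hflux _ hfr n hn)
  have hfront : volume (frontier (𝒯.cell K)) = 0 := (𝒯.convex_cell K).addHaar_frontier volume
  have hleft : ∫ z in S, lineDivergence (fun z => G₀ (p + z)) z =
      ∫ x in 𝒯.cell K, divergenceWithin Ω m x := by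
    have h1 : ∫ z in S, lineDivergence (fun z => G₀ (p + z)) z =
        ∫ z in S, divergenceWithin Ω m (p + z) := by
      rw [← setIntegral_congr_set
        (interior_ae_eq_of_null_frontier (hSconv.addHaar_frontier volume))]
      rw [← setIntegral_congr_set
        (interior_ae_eq_of_null_frontier (hSconv.addHaar_frontier volume))]
      refine setIntegral_congr_fun isOpen_interior.measurableSet fun z hz => ?_
      refine lineDivergence_eq_divergenceWithin hm ?_ fun w hw => (hmG hw).symm
      have h2 : z ∈ iso.toHomeomorph ⁻¹' interior (closure (𝒯.cell K)) := by
        rw [iso.toHomeomorph.preimage_interior]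
        exact hz
      exact interior_mono (𝒯.closure_cell_subset hΩ K) h2
    rw [h1, (measurePreserving_add_left volume p).setIntegral_preimage_emb
      (measurableEmbedding_addLeft p) (divergenceWithin Ω m)]
    exact setIntegral_congr_set (closure_ae_eq_of_null_frontier hfront)
  have hface : ∀ j : {L // L ≠ K}, ∫ y in iso ⁻¹' A j, ⟪ν j, G₀ (p + y)⟫ ∂μHE[d - 1] =
      ∫ x in 𝒯.face K j, ⟪m x, 𝒯.normal K j⟫ ∂μHE[d - 1] := fun j => by
    refine ((iso.measurePreserving_euclideanHausdorffMeasure (d - 1)).setIntegral_preimage_emb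
      iso.toHomeomorph.measurableEmbedding (fun x => ⟪ν j, G₀ x⟫) (A j)).trans ?_
    have hae : A j =ᵐ[μHE[d - 1]] 𝒯.face K j := by
      rw [hA]
      simp only
      rw [← sdiff_self_inter]
      refine sdiff_null_ae_eq_self ?_
      rw [inter_iUnion₂]
      refine (measure_biUnion_null_iff (to_countable _)).2 fun L hL => ?_
      refine measure_mono_null (inter_subset_inter_right _ inter_subset_right)
        (𝒯.face_inter_closure_null (Ne.symm j.2) (Ne.symm L.2) fun h => ?_)
      have hL' : e L.1 < e j.1 := hL
      rw [h] at hL'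
      exact lt_irrefl _ hL'
    rw [setIntegral_congr_set hae]
    by_cases hadj : 𝒯.Adj K j
    · refine setIntegral_congr_fun (𝒯.isClosed_face K j).measurableSet fun x hx => ?_
      simp only [𝒯.normal_eq hadj (hsep j), hmG (𝒯.face_subset hΩ K j hx), real_inner_comm]
    · have h0 := 𝒯.face_null_of_not_adj (Ne.symm j.2) hadj
      rw [Measure.restrict_eq_zero.2 h0, integral_zero_measure, integral_zero_measure]
  rw [← hleft, hmain]
  refine (Finset.sum_congr rfl fun j _ => hface j).trans ?_
  have h1 : ∑ L ∈ Finset.univ.filter (fun L => L ≠ K),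
      ∫ x in 𝒯.face K L, ⟪m x, 𝒯.normal K L⟫ ∂μHE[d - 1] =
        ∑ j : {L // L ≠ K}, ∫ x in 𝒯.face K j, ⟪m x, 𝒯.normal K j⟫ ∂μHE[d - 1] :=
    Finset.sum_subtype _ (by simp) _
  rw [← h1]
  symm
  refine Finset.sum_subset (fun L hL => by simpa using (𝒯.mem_nbrs.1 hL).ne.symm) ?_
  intro L hL hLn
  have hLK : L ≠ K := by simpa using hL
  rw [Measure.restrict_eq_zero.2
    (𝒯.face_null_of_not_adj hLK.symm fun h => hLn (𝒯.mem_nbrs.2 h)), integral_zero_measure]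

/-- Exact commutation of sampling and divergence. -/
theorem SX_divergenceWithin (hΩ : IsCompact Ω) (hconv : Convex ℝ Ω)
    (hint : (interior Ω).Nonempty) {m : Rd d → Rd d} (hm : ContDiffOn ℝ 1 m Ω)
    (hflux : ∀ x ∈ frontier Ω, ∀ n, IsOutwardNormal Ω x n → ⟪m x, n⟫ = 0) :
    𝒯.SX (ofDensity Ω (divergenceWithin Ω m)) =
      𝒯.discreteDiv (𝒯.SY hΩ (restrictC m hm.continuousOn)) := by
  ext K
  rw [𝒯.SX_ofDensity hΩ (continuousOn_divergenceWithin hconv hint hm),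
    𝒯.setIntegral_cell_divergenceWithin hΩ hconv hint hm hflux, Finset.sum_div]
  refine Finset.sum_congr rfl fun L hL => ?_
  have hadj := 𝒯.mem_nbrs.1 hL
  have h1 : (𝒯.SY hΩ (restrictC m hm.continuousOn)).1 K L = 𝒯.faceMean m K L :=
    flux_restrictC hΩ hm.continuousOn hadj
  have h2 := (𝒯.area_pos hΩ hadj).ne'
  rw [h1, faceMean]
  field_simp

end Mesh

/-! ### Chains of cells -/

section Chains

variable {d : ℕ}

/-- The projection of an `H^{d-1}`-null set on a hyperplane is null. -/
lemma volume_orthogonalProjection_image_eq_zero {ν : Rd d} (hν : ‖ν‖ = 1) {N : Set (Rd d)}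
    (hN : μHE[d - 1] N = 0) :
    volume ((ℝ ∙ ν)ᗮ.orthogonalProjectionOnto '' N) = 0 := by
  rw [← InnerProductSpace.euclideanHausdorffMeasure_eq_volume, finrank_orthogonal_unit hν]
  have hlip : LipschitzWith 1 (ℝ ∙ ν)ᗮ.orthogonalProjectionOnto :=
    LipschitzWith.of_dist_le_mul fun x y => by
      rw [dist_eq_norm, dist_eq_norm, ← map_sub, NNReal.coe_one, one_mul]
      exact ((ℝ ∙ ν)ᗮ.norm_orthogonalProjectionOnto_apply_le _)
  have h := hlip.hausdorffMeasure_image_le (d := ((d - 1 : ℕ) : ℝ)) (Nat.cast_nonneg _) N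
  simp only [ENNReal.coe_one, ENNReal.one_rpow, one_mul] at h
  rw [Measure.euclideanHausdorffMeasure_def, Measure.smul_apply] at hN ⊢
  refine le_antisymm (le_trans ?_ hN.le) zero_le
  gcongr

/-- Two open sets are joined by a segment which avoids a given `H^{d-1}`-null set. -/
lemma exists_segment_disjoint {p q : Rd d} (hpq : p ≠ q) {O : Set (Rd d)} (hO : O ∈ 𝓝 0)
    {N : Set (Rd d)} (hN : μHE[d - 1] N = 0) :
    ∃ w ∈ O, Disjoint (segment ℝ (p + w) (q + w)) N := by
  have hpos : 0 < ‖q - p‖ := norm_pos_iff.2 (sub_ne_zero.2 hpq.symm)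
  set ν : Rd d := ‖q - p‖⁻¹ • (q - p) with hνdef
  have hν : ‖ν‖ = 1 := by rw [hνdef, norm_smul, norm_inv, norm_norm, inv_mul_cancel₀ hpos.ne']
  set π := (ℝ ∙ ν)ᗮ.orthogonalProjectionOnto with hπ
  have hπν : π (q - p) = 0 := by
    have h1 : q - p = ‖q - p‖ • ν := by rw [hνdef, smul_smul, mul_inv_cancel₀ hpos.ne', one_smul]
    rw [h1, map_smul, hπ, Submodule.orthogonalProjectionOnto_orthogonalComplement_singleton_eq_zero,
      smul_zero]
  set O' : Set (ℝ ∙ ν)ᗮ := (fun w : (ℝ ∙ ν)ᗮ => (w : Rd d)) ⁻¹' O with hO'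
  have hO'n : O' ∈ 𝓝 (0 : (ℝ ∙ ν)ᗮ) :=
    continuous_subtype_val.continuousAt.preimage_mem_nhds (by simpa using hO)
  have hnull : volume ((fun w => π p + w) ⁻¹' (π '' N)) = 0 := by
    rw [(measurePreserving_add_left volume (π p)).measure_preimage_emb
      (measurableEmbedding_addLeft (π p))]
    exact volume_orthogonalProjection_image_eq_zero hν hN
  -- For `w` orthogonal to `q - p`, the whole translated segment projects to the single point `π p +
  -- w`. The projection of `N` is null, so some small `w` avoids it.
  obtain ⟨w, hwO, hw⟩ : ∃ w ∈ O', w ∉ (fun w => π p + w) ⁻¹' (π '' N) := by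
    by_contra! hcon
    exact (Measure.measure_pos_of_mem_nhds volume hO'n).ne' (measure_mono_null hcon hnull)
  refine ⟨w, hwO, disjoint_left.2 ?_⟩
  rintro _ ⟨s, t, hs, ht, hst, rfl⟩ hz
  refine hw ⟨_, hz, ?_⟩
  have h1 : s • (p + (w : Rd d)) + t • (q + (w : Rd d)) = p + w + t • (q - p) := by
    have : s = 1 - t := by linarith
    rw [this]
    module
  rw [h1, map_add, map_add, map_smul, hπν, smul_zero, add_zero]
  congr 1
  exact Submodule.orthogonalProjectionOnto_mem_subspace_eq_self w

end Chains

namespace Mesh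

variable {d : ℕ} {Ω : Set (Rd d)} (𝒯 : Mesh Ω)

/-- The graph of the cells which meet a set `U`, with the neighbour relation. -/
def cellGraph (U : Set (Rd d)) : SimpleGraph 𝒯.ι where
  Adj K L := 𝒯.Adj K L ∧ (interior (𝒯.cell K) ∩ U).Nonempty ∧ (interior (𝒯.cell L) ∩ U).Nonempty
  symm := ⟨fun K L h => ⟨(𝒯.adj_comm K L).1 h.1, h.2.2, h.2.1⟩⟩
  loopless := ⟨fun _ h => h.1.ne rfl⟩

lemma closure_interior_cell (K : 𝒯.ι) : closure (interior (𝒯.cell K)) = closure (𝒯.cell K) :=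
  (𝒯.convex_cell K).closure_interior_eq_closure_of_nonempty_interior ⟨_, 𝒯.center_mem K⟩

/-- The cells which meet a convex open subset of the domain are connected. -/
lemma reachable_cellGraph {U : Set (Rd d)} (hUo : IsOpen U) (hUc : Convex ℝ U) (hUΩ : U ⊆ Ω)
    {K L : 𝒯.ι} (hK : (interior (𝒯.cell K) ∩ U).Nonempty)
    (hL : (interior (𝒯.cell L) ∩ U).Nonempty) : (𝒯.cellGraph U).Reachable K L := by
  by_contra hKL
  set A : Set 𝒯.ι := {I | (𝒯.cellGraph U).Reachable K I} with hA
  obtain ⟨p, hpK, hpU⟩ := hK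
  obtain ⟨q, hqL, hqU⟩ := hL
  have hne : K ≠ L := fun h => hKL (h ▸ SimpleGraph.Reachable.refl _)
  have hpq : p ≠ q := fun h => (𝒯.disjoint_cell hne).le_bot
    ⟨interior_subset hpK, h ▸ interior_subset hqL⟩
  -- These are the parts in `U` of interfaces between the component `A` of `K` and the remaining
  -- cells. They have zero area, since an interface of positive area meeting `U` would be an edge of
  -- the graph.
  set N : Set (Rd d) := ⋃ I ∈ A, ⋃ J ∈ Aᶜ, (𝒯.face I J ∩ U) with hN
  have hmeet : ∀ I, ∀ z ∈ closure (𝒯.cell I) ∩ U, (interior (𝒯.cell I) ∩ U).Nonempty := by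
    rintro I z ⟨hz, hzU⟩
    rw [← 𝒯.closure_interior_cell] at hz
    rw [inter_comm]
    exact mem_closure_iff.1 hz U hUo hzU
  have hNnull : μHE[d - 1] N = 0 := by
    refine (measure_biUnion_null_iff (to_countable _)).2 fun I hI =>
      (measure_biUnion_null_iff (to_countable _)).2 fun J hJ => ?_
    by_cases hemp : (𝒯.face I J ∩ U).Nonempty
    · obtain ⟨z, ⟨hzI, hzJ⟩, hzU⟩ := hemp
      refine measure_mono_null inter_subset_left (𝒯.face_null_of_not_adj ?_ fun hadj => hJ ?_)
      · rintro rfl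
        exact hJ hI
      · have hadj' : (𝒯.cellGraph U).Adj I J :=
          ⟨hadj, hmeet I z ⟨hzI, hzU⟩, hmeet J z ⟨hzJ, hzU⟩⟩
        exact SimpleGraph.Reachable.trans hI hadj'.reachable
    · rw [not_nonempty_iff_eq_empty.1 hemp, measure_empty]
  have hO : {w | (p + w ∈ interior (𝒯.cell K) ∩ U) ∧ (q + w ∈ interior (𝒯.cell L) ∩ U)} ∈
      𝓝 (0 : Rd d) := by
    have h1 : ∀ᶠ w in 𝓝 (0 : Rd d), p + w ∈ interior (𝒯.cell K) ∩ U :=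
      (continuous_const_add p).continuousAt.eventually
        ((isOpen_interior.inter hUo).mem_nhds (by simpa using ⟨hpK, hpU⟩))
    have h2 : ∀ᶠ w in 𝓝 (0 : Rd d), q + w ∈ interior (𝒯.cell L) ∩ U :=
      (continuous_const_add q).continuousAt.eventually
        ((isOpen_interior.inter hUo).mem_nhds (by simpa using ⟨hqL, hqU⟩))
    exact h1.and h2
  obtain ⟨w, ⟨hw1, hw2⟩, hdisj⟩ := exists_segment_disjoint hpq hO hNnull
  have hseg : segment ℝ (p + w) (q + w) ⊆ U := hUc.segment_subset hw1.2 hw2.2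
  have hconn : IsPreconnected (segment ℝ (p + w) (q + w)) := (convex_segment _ _).isPreconnected
  -- The segment is connected and covered by two closed sets, the closed cells in `A` and those
  -- outside. Both meet it, hence so does their intersection, which within `U` is the set `N` that
  -- the segment avoids.
  obtain ⟨z, hz, hzA, hzB⟩ := isPreconnected_closed_iff.1 hconn (⋃ I ∈ A, closure (𝒯.cell I))
    (⋃ J ∈ Aᶜ, closure (𝒯.cell J))
    ((Set.toFinite _).isClosed_biUnion fun _ _ => isClosed_closure)
    ((Set.toFinite _).isClosed_biUnion fun _ _ => isClosed_closure)
    (fun z hz => by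
      have hzΩ := hUΩ (hseg hz)
      rw [← 𝒯.iUnion_cell, mem_iUnion] at hzΩ
      obtain ⟨I, hI⟩ := hzΩ
      by_cases hIA : I ∈ A
      · exact Or.inl (mem_biUnion hIA (subset_closure hI))
      · exact Or.inr (mem_biUnion (show I ∈ Aᶜ from hIA) (subset_closure hI)))
    ⟨p + w, left_mem_segment _ _ _, mem_biUnion (show K ∈ A from SimpleGraph.Reachable.refl _)
      (subset_closure (interior_subset hw1.1))⟩
    ⟨q + w, right_mem_segment _ _ _, mem_biUnion (show L ∈ Aᶜ from hKL)
      (subset_closure (interior_subset hw2.1))⟩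
  simp only [mem_iUnion] at hzA hzB
  obtain ⟨I, hI, hzI⟩ := hzA
  obtain ⟨J, hJ, hzJ⟩ := hzB
  exact disjoint_left.1 hdisj hz
    (mem_biUnion hI (mem_biUnion hJ ⟨⟨hzI, hzJ⟩, hseg hz⟩))

end Mesh

/-! ### Flows along paths -/

/-- A flow on a path which carries the uniform mass from the path to its first vertex. -/
lemma exists_flow_of_isPath {V : Type*} [Fintype V] [DecidableEq V] {G : SimpleGraph V} {u v : V}
    (p : G.Walk u v) (hp : p.IsPath) : ∃ J : V → V → ℝ, (∀ K L, J K L = -J L K) ∧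
      (∀ K L, J K L ≠ 0 → G.Adj K L ∧ K ∈ p.support ∧ L ∈ p.support) ∧
      (∀ K L, |J K L| ≤ p.support.length) ∧
      ∀ K, ∑ L, J K L = (if K ∈ p.support then 1 else 0) -
        (if K = u then (p.support.length : ℝ) else 0) := by
  induction p with
  | nil =>
    refine ⟨fun _ _ => 0, by simp, by simp, by simp, fun K => ?_⟩
    simp
  | @cons u v w hadj p ih =>
    rw [SimpleGraph.Walk.cons_isPath_iff] at hp
    obtain ⟨J, hJ1, hJ2, hJ3, hJ4⟩ := ih hp.1
    have huv : u ≠ v := hadj.ne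
    set n : ℝ := ((p.support.length : ℕ) : ℝ) with hn
    have hn0 : 0 ≤ n := Nat.cast_nonneg _
    have hu1 : ∀ L, J u L = 0 := fun L => by
      by_contra h
      exact hp.2 (hJ2 u L h).2.1
    have hu2 : ∀ L, J L u = 0 := fun L => by rw [hJ1, hu1, neg_zero]
    -- On the tail, `J` already gathers all `n` units at its first vertex `v`. The new edge forwards
    -- them from `v` to `u`, so the net outflow is `1` at `v` and `-n = 1 - (n + 1)` at `u`.
    refine ⟨fun K L => J K L + ((if K = v ∧ L = u then n else 0) - if K = u ∧ L = v then n else 0),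
      fun K L => ?_, fun K L h => ?_, fun K L => ?_, fun K => ?_⟩
    · have e1 : (L = v ∧ K = u) = (K = u ∧ L = v) := propext and_comm
      have e2 : (L = u ∧ K = v) = (K = v ∧ L = u) := propext and_comm
      beta_reduce
      rw [hJ1 K L]
      simp only [e1, e2]
      ring
    · beta_reduce at h
      simp only [SimpleGraph.Walk.support_cons, List.mem_cons]
      by_cases h1 : K = v ∧ L = u
      · obtain ⟨rfl, rfl⟩ := h1
        exact ⟨hadj.symm, Or.inr p.start_mem_support, Or.inl rfl⟩
      by_cases h2 : K = u ∧ L = v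
      · obtain ⟨rfl, rfl⟩ := h2
        exact ⟨hadj, Or.inl rfl, Or.inr p.start_mem_support⟩
      rw [if_neg h1, if_neg h2, sub_zero, add_zero] at h
      obtain ⟨e1, e2, e3⟩ := hJ2 K L h
      exact ⟨e1, Or.inr e2, Or.inr e3⟩
    · have hlen : (((SimpleGraph.Walk.cons hadj p).support.length : ℕ) : ℝ) = n + 1 := by
        simp [hn]
      rw [hlen]
      beta_reduce
      by_cases h1 : K = v ∧ L = u
      · obtain ⟨rfl, rfl⟩ := h1
        rw [hu2, if_pos ⟨rfl, rfl⟩, if_neg fun h => huv h.2, sub_zero, zero_add,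
          abs_of_nonneg hn0]
        linarith
      by_cases h2 : K = u ∧ L = v
      · obtain ⟨rfl, rfl⟩ := h2
        rw [hu1, if_neg fun h => huv h.1, if_pos ⟨rfl, rfl⟩, zero_sub, zero_add, abs_neg,
          abs_of_nonneg hn0]
        linarith
      rw [if_neg h1, if_neg h2, sub_zero, add_zero]
      exact (hJ3 K L).trans (by linarith)
    · have hlen : (((SimpleGraph.Walk.cons hadj p).support.length : ℕ) : ℝ) = n + 1 := by
        simp [hn]
      rw [hlen, Finset.sum_add_distrib, hJ4, Finset.sum_sub_distrib]
      have hs1 : ∑ L, (if K = v ∧ L = u then n else 0) = if K = v then n else 0 := by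
        by_cases h : K = v <;> simp [h]
      have hs2 : ∑ L, (if K = u ∧ L = v then n else 0) = if K = u then n else 0 := by
        by_cases h : K = u <;> simp [h]
      rw [hs1, hs2]
      simp only [SimpleGraph.Walk.support_cons, List.mem_cons]
      by_cases h1 : K = u
      · subst h1
        simp [huv, hp.2]
      · simp [h1]

/-! ### Controllability -/

namespace Mesh

variable {d : ℕ} {Ω : Set (Rd d)} {𝒯 : Mesh Ω} {c σ : ℝ}

/-- Points at spacing at most `σ` along the segment are within `(c⁻¹ + 2) σ` of every centre
considered: `c⁻¹ σ` inside the cell, `σ` to the segment, `σ` to the next grid point. Packing bounds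
the number of cells per grid point. -/
lemma IsRegular.card_le_of_near_segment (hR : 𝒯.IsRegular c σ) (hΩ : IsCompact Ω) {x y : Rd d}
    (s : Finset 𝒯.ι) (hs : ∀ K ∈ s, ∃ z ∈ 𝒯.cell K, ∃ w ∈ segment ℝ x y, dist z w ≤ σ) :
    (s.card : ℝ) * σ ≤ ((c⁻¹ + 2 + c) / c) ^ d * (dist x y + 2 * σ) := by
  classical
  have hc := hR.const_pos
  have hσ := hR.step_pos
  set D := ((c⁻¹ + 2 + c) / c) ^ d with hD
  have hD0 : 0 ≤ D := by positivity
  -- The summand `1` keeps `n` positive also when the floor vanishes, in particular for `x = y`.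
  set n : ℕ := ⌊dist x y / σ⌋₊ + 1 with hn
  have hn0 : (0 : ℝ) < n := by rw [hn]; positivity
  have hn1 : dist x y / σ ≤ n := by
    rw [hn, Nat.cast_add, Nat.cast_one]
    exact (Nat.lt_floor_add_one _).le
  have hn2 : (n : ℝ) ≤ dist x y / σ + 1 := by
    rw [hn, Nat.cast_add, Nat.cast_one]
    exact add_le_add_left (Nat.floor_le (by positivity)) 1
  set pt : ℕ → Rd d := fun i => x + ((i : ℝ) / n) • (y - x) with hpt
  set t : ℕ → Finset 𝒯.ι := fun i =>
    s.filter fun K => dist (𝒯.center K) (pt i) ≤ (c⁻¹ + 2) * σ with ht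
  have hcard : ∀ i, ((t i).card : ℝ) ≤ D := fun i => by
    have h := hR.card_mul_pow_le (t i) (pt i) (R := (c⁻¹ + 2) * σ) (by positivity)
      fun K hK => (Finset.mem_filter.1 hK).2
    rw [← le_div_iff₀ (by positivity), ← div_pow] at h
    refine h.trans_eq ?_
    rw [hD]
    congr 1
    field_simp
  have hcover : s ⊆ (Finset.range (n + 1)).biUnion t := by
    intro K hK
    obtain ⟨z, hz, w, hw, hzw⟩ := hs K hK
    rw [segment_eq_image'] at hw
    obtain ⟨l, ⟨hl0, hl1⟩, rfl⟩ := hw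
    set i := ⌊l * n⌋₊ with hi
    have hi1 : (i : ℝ) ≤ l * n := Nat.floor_le (by positivity)
    have hi2 : l * n < i + 1 := Nat.lt_floor_add_one _
    have hin : i ≤ n := by
      have : (i : ℝ) ≤ n := hi1.trans (mul_le_of_le_one_left hn0.le hl1)
      exact_mod_cast this
    refine Finset.mem_biUnion.2 ⟨i, Finset.mem_range.2 (by omega),
      Finset.mem_filter.2 ⟨hK, ?_⟩⟩
    have h1 : dist (x + l • (y - x)) (pt i) ≤ σ := by
      rw [hpt, dist_eq_norm, add_sub_add_left_eq_sub, ← sub_smul, norm_smul, Real.norm_eq_abs,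
        ← dist_eq_norm y x, dist_comm y x]
      have h2 : |l - i / n| ≤ 1 / n := by
        have e1 : l - i / n = (l * n - i) / n := by field_simp
        rw [e1, abs_div, abs_of_pos hn0]
        refine div_le_div_of_nonneg_right ?_ hn0.le
        rw [abs_le]
        constructor <;> linarith
      calc |l - i / n| * dist x y ≤ 1 / n * dist x y :=
            mul_le_mul_of_nonneg_right h2 dist_nonneg
        _ = dist x y / n := by ring
        _ ≤ σ := by
          rw [div_le_iff₀ hn0, mul_comm]
          exact (div_le_iff₀ hσ).1 hn1
    have h3 := hR.dist_center_le hΩ K hz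
    rw [dist_comm] at h3
    have h4 := dist_triangle4 (𝒯.center K) z (x + l • (y - x)) (pt i)
    linarith
  have h1 : (s.card : ℝ) ≤ (n + 1) * D := by
    have h2 : s.card ≤ ∑ i ∈ Finset.range (n + 1), (t i).card :=
      (Finset.card_le_card hcover).trans Finset.card_biUnion_le
    calc (s.card : ℝ) ≤ ∑ i ∈ Finset.range (n + 1), ((t i).card : ℝ) := by exact_mod_cast h2
      _ ≤ ∑ i ∈ Finset.range (n + 1), D := Finset.sum_le_sum fun i _ => hcard i
      _ = (n + 1) * D := by simp
  calc (s.card : ℝ) * σ ≤ (n + 1) * D * σ := mul_le_mul_of_nonneg_right h1 hσ.le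
    _ ≤ (dist x y / σ + 1 + 1) * D * σ := by gcongr
    _ = D * (dist x y + 2 * σ) := by field_simp; ring

lemma interior_cell_inter_of_mem_support {U : Set (Rd d)} {u v : 𝒯.ι}
    (p : (𝒯.cellGraph U).Walk u v) (hu : (interior (𝒯.cell u) ∩ U).Nonempty) {K : 𝒯.ι}
    (hK : K ∈ p.support) : (interior (𝒯.cell K) ∩ U).Nonempty := by
  induction p with
  | nil =>
    rw [SimpleGraph.Walk.support_nil, List.mem_singleton] at hK
    exact hK ▸ hu
  | cons h p ih =>
    rw [SimpleGraph.Walk.support_cons, List.mem_cons] at hK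
    rcases hK with rfl | hK
    · exact hu
    · exact ih h.2.2 hK

/-- Two points of the domain are joined by a path of cells near the segment between them. -/
lemma IsRegular.exists_path (hR : 𝒯.IsRegular c σ) (hΩ : IsCompact Ω) (hconv : Convex ℝ Ω)
    {x y : Rd d} {u v : 𝒯.ι} (hx : x ∈ 𝒯.cell u) (hy : y ∈ 𝒯.cell v) :
    ∃ U, ∃ p : (𝒯.cellGraph U).Walk u v, p.IsPath ∧
      (p.support.length : ℝ) * σ ≤ ((c⁻¹ + 2 + c) / c) ^ d * (dist x y + 2 * σ) := by
  classical
  have hσ := hR.step_pos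
  -- Both factors are convex and open, so the cells that meet `U` are connected. The interior of `Ω`
  -- is included because the segment may touch the boundary of `Ω`.
  set U := Metric.thickening σ (segment ℝ x y) ∩ interior Ω with hU
  have hUo : IsOpen U := Metric.isOpen_thickening.inter isOpen_interior
  have hUc : Convex ℝ U := ((convex_segment x y).thickening σ).inter hconv.interior
  have hmeet : ∀ (K : 𝒯.ι) (z : Rd d), z ∈ 𝒯.cell K → z ∈ segment ℝ x y →
      (interior (𝒯.cell K) ∩ U).Nonempty := by
    intro K z hz hzs
    have h1 : z ∈ closure (interior (𝒯.cell K)) := by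
      rw [𝒯.closure_interior_cell]
      exact subset_closure hz
    obtain ⟨w, hw, hwK⟩ := mem_closure_iff.1 h1 (Metric.thickening σ (segment ℝ x y))
      Metric.isOpen_thickening (Metric.self_subset_thickening hσ _ hzs)
    exact ⟨w, hwK, hw, interior_mono (𝒯.cell_subset K) hwK⟩
  have hu := hmeet u x hx (left_mem_segment _ _ _)
  have hv := hmeet v y hy (right_mem_segment _ _ _)
  obtain ⟨p, hp⟩ := (𝒯.reachable_cellGraph hUo hUc (inter_subset_right.trans interior_subset)
    hu hv).exists_isPath
  refine ⟨U, p, hp, ?_⟩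
  -- A path has no repeated cells, so its length is a number of distinct cells near the segment.
  rw [← List.toFinset_card_of_nodup hp.support_nodup]
  refine hR.card_le_of_near_segment hΩ _ fun K hK => ?_
  obtain ⟨z, hzK, hzU⟩ := interior_cell_inter_of_mem_support p hu (List.mem_toFinset.1 hK)
  obtain ⟨w, hw, hzw⟩ := Metric.mem_thickening_iff.1 hzU.1
  exact ⟨z, interior_subset hzK, w, hw, hzw.le⟩

/-- The uniform distribution of a unit mass on the cells of a finite set. -/
noncomputable def uniformOn (𝒯 : Mesh Ω) (s : Set 𝒯.ι) (n : ℕ) (K : 𝒯.ι) : ℝ :=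
  s.indicator (fun K => (n * 𝒯.vol K)⁻¹) K

lemma uniformOn_nonneg (s : Set 𝒯.ι) (n : ℕ) (K : 𝒯.ι) : 0 ≤ 𝒯.uniformOn s n K :=
  indicator_nonneg (fun _ _ => inv_nonneg.2 (mul_nonneg (Nat.cast_nonneg _) measureReal_nonneg)) K

/-- The constant of the cost of transport along a path. -/
noncomputable def pathConst (d : ℕ) (c : ℝ) : ℝ :=
  ((2 * c⁻¹ + c) / c) ^ d * ((c⁻¹) ^ d * ballVol d * c⁻¹ / (2 * c))

lemma pathConst_nonneg (d : ℕ) {c : ℝ} (hc : 0 < c) : 0 ≤ pathConst d c := by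
  have := ballVol_pos d
  unfold pathConst
  positivity

/-- The cost of spreading a point mass uniformly along a path of cells. -/
lemma IsRegular.exists_momentum_of_isPath (hd : 1 ≤ d) (hR : 𝒯.IsRegular c σ) (hΩ : IsCompact Ω)
    {θ : ℝ → ℝ → ℝ} (hθ : IsAdmissibleMean θ) {U : Set (Rd d)} {u v : 𝒯.ι} {x : Ω}
    (hx : x.1 ∈ 𝒯.cell u) (p : (𝒯.cellGraph U).Walk u v) (hp : p.IsPath) :
    ∃ M : 𝒯.momenta,
      𝒯.discreteDiv M = 𝒯.uniformOn {K | K ∈ p.support} p.support.length -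
        𝒯.SX (VectorMeasure.dirac x 1) ∧
      𝒯.discreteAction θ (𝒯.uniformOn {K | K ∈ p.support} p.support.length) M ≤
        ENNReal.ofReal (pathConst d c * (p.support.length * σ) ^ 2) := by
  classical
  obtain ⟨J, hJ1, hJ2, hJ3, hJ4⟩ := exists_flow_of_isPath p hp
  set n : ℕ := p.support.length with hn
  have hn0 : (0 : ℝ) < n := by
    have : 0 < n := List.length_pos_of_mem p.start_mem_support
    exact_mod_cast this
  set P := 𝒯.uniformOn {K | K ∈ p.support} n with hP
  have hPmem : ∀ K ∈ p.support, P K = (n * 𝒯.vol K)⁻¹ := fun K hK =>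
    indicator_of_mem (s := {K | K ∈ p.support}) hK _
  have hPnot : ∀ K ∉ p.support, P K = 0 := fun K hK =>
    indicator_of_notMem (s := {K | K ∈ p.support}) hK _
  have hP0 : ∀ K, 0 ≤ P K := uniformOn_nonneg _ _
  have hJadj : ∀ K L, ¬ 𝒯.Adj K L → J K L = 0 := fun K L h => by
    by_contra hne
    exact h (hJ2 K L hne).1.1
  -- Dividing by `n |(K|L)|` turns the flow of `n` unit masses into a momentum whose discrete
  -- divergence is the net outflow divided by `n |K|`.
  set M : 𝒯.momenta := ⟨fun K L => J K L / (n * 𝒯.area K L), fun K L => by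
    beta_reduce
    rw [hJ1, 𝒯.area_comm, neg_div], fun K L h => by
    beta_reduce
    rw [hJadj K L h, zero_div]⟩ with hM
  have hMv : ∀ K L, M.1 K L = J K L / (n * 𝒯.area K L) := fun K L => rfl
  have hc := hR.const_pos
  have hσ := hR.step_pos
  have hω := ballVol_pos d
  refine ⟨M, ?_, ?_⟩
  · ext K
    have hvol := 𝒯.vol_pos hΩ K
    change ∑ L ∈ 𝒯.nbrs K, 𝒯.area K L / 𝒯.vol K * M.1 K L = P K - 𝒯.SX (VectorMeasure.dirac x 1) K
    have h1 : ∑ L ∈ 𝒯.nbrs K, 𝒯.area K L / 𝒯.vol K * M.1 K L =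
        (n * 𝒯.vol K)⁻¹ * ∑ L, J K L := by
      have h2 : ∑ L, J K L = ∑ L ∈ 𝒯.nbrs K, J K L :=
        (Finset.sum_subset (Finset.subset_univ _) fun L _ hL =>
          hJadj K L fun h => hL (𝒯.mem_nbrs.2 h)).symm
      rw [h2, Finset.mul_sum]
      refine Finset.sum_congr rfl fun L hL => ?_
      have := (𝒯.area_pos hΩ (𝒯.mem_nbrs.1 hL)).ne'
      rw [hMv]
      field_simp
    have h3 : x.1 ∈ 𝒯.cell K ↔ K = u := by
      refine ⟨fun h => ?_, fun h => h ▸ hx⟩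
      by_contra hne
      exact (𝒯.disjoint_cell hne).le_bot ⟨h, hx⟩
    rw [h1, hJ4, 𝒯.SX_dirac, mul_sub]
    congr 1
    · by_cases hK : K ∈ p.support
      · rw [if_pos hK, hPmem K hK, mul_one]
      · rw [if_neg hK, hPnot K hK, mul_zero]
    · by_cases hK : K = u
      · rw [if_pos hK, if_pos (h3.2 hK)]
        field_simp
      · rw [if_neg hK, if_neg fun h => hK (h3.1 h), mul_zero]
  · set V := (c⁻¹ * σ) ^ d * ballVol d with hV
    have hV0 : 0 < V := by have := hR.inv_mul_pos; positivity
    have hPge : ∀ K ∈ p.support, (n * V)⁻¹ ≤ P K := fun K hK => by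
      rw [hPmem K hK]
      have := 𝒯.vol_pos hΩ K
      exact inv_anti₀ (by positivity) (mul_le_mul_of_nonneg_left (hR.vol_le hΩ K) hn0.le)
    have hθge : ∀ K ∈ p.support, ∀ L ∈ p.support, (n * V)⁻¹ ≤ θ (P K) (P L) :=
      fun K hK L hL => hθ.le_of_le (by positivity) (hPge K hK) (hPge L hL)
    have hM0 : ∀ K L, ¬ (K ∈ p.support ∧ L ∈ p.support) → M.1 K L = 0 := fun K L h => by
      rw [hMv]
      by_contra hne
      exact h (hJ2 K L fun h0 => hne (by rw [h0, zero_div])).2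
    rw [𝒯.discreteAction_eq_ofReal hθ hP0 fun K L _ h0 => by
      refine hM0 K L fun h => ?_
      have h1 := hθge K h.1 L h.2
      rw [h0] at h1
      exact absurd h1 (not_le.2 (by positivity))]
    refine ENNReal.ofReal_le_ofReal ?_
    -- The flow is at most `n`, so the momentum is at most `1 / |(K|L)|`, and the mean on the path
    -- is at least `1 / (n V)`. An edge costs at most `n V d_KL / (4 |(K|L)|)`, which is `O(n σ²)`
    -- by the bounds on volume, gap and area. Summing over `n` cells with boundedly many neighbours
    -- gives `O((nσ)²)`.
    set T := n * ((c⁻¹) ^ d * ballVol d * c⁻¹ / (2 * c)) * σ ^ 2 with hT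
    have hT0 : 0 ≤ T := by positivity
    have hterm : ∀ K, ∀ L ∈ 𝒯.nbrs K,
        M.1 K L ^ 2 / (4 * θ (P K) (P L)) * (𝒯.area K L * 𝒯.gap K L) ≤ T := by
      intro K L hL
      have hadj := 𝒯.mem_nbrs.1 hL
      by_cases h : K ∈ p.support ∧ L ∈ p.support
      · have hθKL := hθge K h.1 L h.2
        have harea := 𝒯.area_pos hΩ hadj
        have hM1 : M.1 K L ^ 2 ≤ (𝒯.area K L)⁻¹ ^ 2 := by
          rw [← sq_abs, hMv, abs_div, abs_of_pos (by positivity : 0 < n * 𝒯.area K L)]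
          refine pow_le_pow_left₀ (by positivity) ?_ 2
          rw [div_le_iff₀ (by positivity)]
          refine (hJ3 K L).trans_eq ?_
          field_simp
        have hd' : σ ^ d = σ ^ (d - 1) * σ := by
          rw [← pow_succ, Nat.sub_add_cancel hd]
        have hgap := hR.gap_le hΩ hadj
        have hgap0 : 0 ≤ 𝒯.gap K L := dist_nonneg
        calc M.1 K L ^ 2 / (4 * θ (P K) (P L)) * (𝒯.area K L * 𝒯.gap K L)
            ≤ (𝒯.area K L)⁻¹ ^ 2 / (4 * (n * V)⁻¹) * (𝒯.area K L * 𝒯.gap K L) := by gcongr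
          _ = n * V * 𝒯.gap K L / 4 * (𝒯.area K L)⁻¹ := by field_simp
          _ ≤ n * V * (2 * (c⁻¹ * σ)) / 4 * (c * σ ^ (d - 1))⁻¹ := by
            gcongr
            exact hR.area_ge K L hadj
          _ = T := by
            rw [hT, hV, mul_pow, hd']
            field_simp
            ring
      · rw [hM0 K L h]
        simpa using hT0
    have hzero : ∀ K ∉ p.support, ∑ L ∈ 𝒯.nbrs K,
        M.1 K L ^ 2 / (4 * θ (P K) (P L)) * (𝒯.area K L * 𝒯.gap K L) = 0 := fun K hK =>
      Finset.sum_eq_zero fun L _ => by rw [hM0 K L fun h => hK h.1]; simp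
    calc ∑ K, ∑ L ∈ 𝒯.nbrs K, M.1 K L ^ 2 / (4 * θ (P K) (P L)) * (𝒯.area K L * 𝒯.gap K L)
        = ∑ K ∈ p.support.toFinset, ∑ L ∈ 𝒯.nbrs K,
            M.1 K L ^ 2 / (4 * θ (P K) (P L)) * (𝒯.area K L * 𝒯.gap K L) :=
          (Finset.sum_subset (Finset.subset_univ _) fun K _ hK =>
            hzero K fun h => hK (List.mem_toFinset.2 h)).symm
      _ ≤ ∑ K ∈ p.support.toFinset, ((2 * c⁻¹ + c) / c) ^ d * T := by
          refine Finset.sum_le_sum fun K _ => (Finset.sum_le_card_nsmul _ _ T (hterm K)).trans ?_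
          rw [nsmul_eq_mul]
          exact mul_le_mul_of_nonneg_right (hR.card_nbrs_le hΩ K) hT0
      _ = n * (((2 * c⁻¹ + c) / c) ^ d * T) := by
          rw [Finset.sum_const, List.toFinset_card_of_nodup hp.support_nodup, nsmul_eq_mul]
      _ = pathConst d c * (n * σ) ^ 2 := by
          rw [hT, pathConst]
          ring

end Mesh

/-! ### Families of meshes -/

section Families

variable {d : ℕ} {Ω : Set (Rd d)} {S : Set ℝ} {𝒯 : S → Mesh Ω} {c : ℝ} {θ : ℝ → ℝ → ℝ}

lemma tendsto_abs_add_const_mul {e : S → ℝ} (he : Tendsto e (stepToZero S) (𝓝 0)) (a b : ℝ) :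
    Tendsto (fun σ : S => a * |e σ| + b * (σ : ℝ)) (stepToZero S) (𝓝 0) := by
  have h1 := (he.abs.const_mul a).add (tendsto_const_mul_stepToZero S b)
  simpa using h1

theorem exists_actionStar_le (hΩ : IsCompact Ω) (hconv : Convex ℝ Ω)
    (hint : (interior Ω).Nonempty) (hθ : IsAdmissibleMean θ) (hR : ∀ σ, (𝒯 σ).IsRegular c σ)
    {e : S → ℝ} (he : Tendsto e (stepToZero S) (𝓝 0)) (hI : ∀ σ, (𝒯 σ).IsIsotropic (e σ))
    {B : Set (Rd d → Rd d)} (hB : IsBoundedInC 1 Ω B) :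
    ∃ ε : S → ℝ, Tendsto ε (stepToZero S) (𝓝 0) ∧ ∀ b ∈ B, ∀ σ, ∀ P : (𝒯 σ).ι → ℝ,
      ((𝒯 σ).model θ).AStar P (((𝒯 σ).operators hΩ θ).RYAdjoint (fun x => b x)) ≤
        ((actionStar ((𝒯 σ).RA P) (fun x => b x) + ε σ * tvNorm ((𝒯 σ).RA P) : ℝ) : EReal) := by
  obtain ⟨C, hC, h⟩ := hB.exists_bound hconv hint
  exact ⟨_, tendsto_abs_add_const_mul he (C ^ 2 / 2)
    (C ^ 2 * (Mesh.nbrsConst d c / 2 + 1) * c⁻¹), fun b hb σ P =>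
      Mesh.AStar_le_actionStar hθ (hR σ) (hI σ) hΩ P hC (h b hb).1 (h b hb).2.1 (h b hb).2.2⟩

theorem exists_action_sampling_le (hΩ : IsCompact Ω) (hconv : Convex ℝ Ω)
    (hint : (interior Ω).Nonempty) (hθ : IsAdmissibleMean θ) (hR : ∀ σ, (𝒯 σ).IsRegular c σ)
    {e : S → ℝ} (he : Tendsto e (stepToZero S) (𝓝 0)) (hI : ∀ σ, (𝒯 σ).IsIsotropic (e σ))
    {B : Set (Rd d → ℝ)} {B' : Set (Rd d → Rd d)} (hB : IsBoundedInC 1 Ω B)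
    (hδ : ∃ δ : ℝ, 0 < δ ∧ ∀ ρ ∈ B, ∀ x ∈ Ω, δ ≤ ρ x) (hB' : IsBoundedInC 1 Ω B') :
    ∃ ε : S → ℝ, Tendsto ε (stepToZero S) (𝓝 0) ∧
      ∀ ρ ∈ B, ∀ m ∈ B', ∀ (hm : ContinuousOn m Ω) (σ : S),
        (((𝒯 σ).discreteAction θ ((𝒯 σ).SX (ofDensity Ω ρ)) ((𝒯 σ).SY hΩ (restrictC m hm)) :
          ENNReal) : EReal) ≤ action (ofDensity Ω ρ) (ofDensity Ω m) + ((ε σ : ℝ) : EReal) := by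
  obtain ⟨C, hC, h⟩ := hB.exists_bound hconv hint
  obtain ⟨C', hC', h'⟩ := hB'.exists_bound hconv hint
  obtain ⟨δ, hδ, hρ⟩ := hδ
  set D := max C C'
  have hD : 0 ≤ D := hC.trans (le_max_left _ _)
  have hlim := (tendsto_abs_add_const_mul he (D ^ 2 / δ / 2)
    ((2 * D ^ 2 / δ + 3 * D ^ 3 / δ ^ 2) * (Mesh.nbrsConst d c + 1) * c⁻¹)).const_mul
      (volume.real Ω)
  rw [mul_zero] at hlim
  refine ⟨_, hlim, fun ρ hρB m hmB hm σ => ?_⟩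
  exact Mesh.action_SX_SY_le hθ (hR σ) (hI σ) hΩ hD hδ (hρ ρ hρB) (h ρ hρB).1
    (fun x hx y hy => ((h ρ hρB).2.2 x hx y hy).trans
      (mul_le_mul_of_nonneg_right (le_max_left _ _) (norm_nonneg _))) hm
    (fun x hx => ((h' m hmB).2.1 x hx).trans (le_max_right _ _))
    (fun x hx y hy => ((h' m hmB).2.2 x hx y hy).trans
      (mul_le_mul_of_nonneg_right (le_max_right _ _) (norm_nonneg _)))

/-- One path of cells serves both points: the uniform density on it is the common `P`, and the
second momentum comes from the reversed path, which has the same support and length. The cost is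
quadratic in `|x - y| + 2σ` up to a constant, and `(t + 2σ)² ≤ 2 t² + 8 σ²` splits it into `w` and
`ε`. -/
theorem exists_controllability (hd : 1 ≤ d) (hΩ : IsCompact Ω) (hconv : Convex ℝ Ω)
    (hθ : IsAdmissibleMean θ) (hc : 0 < c) (hR : ∀ σ, (𝒯 σ).IsRegular c σ) :
    ∃ (ε : S → ℝ) (w : ℝ → ℝ), Tendsto ε (stepToZero S) (𝓝 0) ∧
      Continuous w ∧ w 0 = 0 ∧ ∀ (x y : Ω) (σ : S), ∃ P : (𝒯 σ).ι → ℝ, (∀ K, 0 ≤ P K) ∧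
        ∃ M₁ M₂ : (𝒯 σ).momenta,
          (𝒯 σ).discreteDiv M₁ = P - (𝒯 σ).SX (VectorMeasure.dirac x 1) ∧
          (𝒯 σ).discreteDiv M₂ = P - (𝒯 σ).SX (VectorMeasure.dirac y 1) ∧
          (((𝒯 σ).discreteAction θ P M₁ : ENNReal) : EReal) ≤
            ((w (dist x y) + ε σ : ℝ) : EReal) ∧
          (((𝒯 σ).discreteAction θ P M₂ : ENNReal) : EReal) ≤
            ((w (dist x y) + ε σ : ℝ) : EReal) := by
  set E := Mesh.pathConst d c
  have hE : 0 ≤ E := Mesh.pathConst_nonneg d hc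
  set D := ((c⁻¹ + 2 + c) / c) ^ d
  have hlim := (tendsto_const_mul_stepToZero S (8 * E * D ^ 2)).mul (tendsto_stepToZero S)
  rw [mul_zero] at hlim
  refine ⟨_, fun t => 2 * E * D ^ 2 * t ^ 2, hlim, by fun_prop, by simp, fun x y σ => ?_⟩
  have hσ := (hR σ).step_pos
  obtain ⟨u, hu⟩ : ∃ u, x.1 ∈ (𝒯 σ).cell u :=
    mem_iUnion.1 ((𝒯 σ).iUnion_cell.superset x.2)
  obtain ⟨v, hv⟩ : ∃ v, y.1 ∈ (𝒯 σ).cell v :=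
    mem_iUnion.1 ((𝒯 σ).iUnion_cell.superset y.2)
  obtain ⟨U, p, hp, hlen⟩ := (hR σ).exists_path hΩ hconv hu hv
  obtain ⟨M₁, hM₁, hA₁⟩ := (hR σ).exists_momentum_of_isPath hd hΩ hθ hu p hp
  obtain ⟨M₂, hM₂, hA₂⟩ := (hR σ).exists_momentum_of_isPath hd hΩ hθ hv p.reverse hp.reverse
  simp only [SimpleGraph.Walk.support_reverse, List.mem_reverse, List.length_reverse] at hM₂ hA₂
  have hcost : E * (p.support.length * σ) ^ 2 ≤
      2 * E * D ^ 2 * dist x y ^ 2 + 8 * E * D ^ 2 * σ * σ := by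
    have h1 : ((p.support.length : ℝ) * σ) ^ 2 ≤ (D * (dist x y + 2 * σ)) ^ 2 :=
      pow_le_pow_left₀ (by positivity) hlen 2
    have h2 : (dist x y + 2 * (σ : ℝ)) ^ 2 ≤ 2 * dist x y ^ 2 + 8 * (σ * σ) := by
      nlinarith [sq_nonneg (dist x y - 2 * (σ : ℝ))]
    calc E * (p.support.length * σ) ^ 2 ≤ E * (D * (dist x y + 2 * σ)) ^ 2 := by gcongr
      _ = E * D ^ 2 * (dist x y + 2 * σ) ^ 2 := by ring
      _ ≤ E * D ^ 2 * (2 * dist x y ^ 2 + 8 * (σ * σ)) := by gcongr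
      _ = _ := by ring
  have hbound : ∀ a : ENNReal, a ≤ ENNReal.ofReal (E * (p.support.length * σ) ^ 2) →
      (a : EReal) ≤ ((2 * E * D ^ 2 * dist x y ^ 2 + 8 * E * D ^ 2 * σ * σ : ℝ) : EReal) := by
    intro a ha
    have h1 := EReal.coe_ennreal_le_coe_ennreal_iff.2 ha
    rw [EReal.coe_ennreal_ofReal, max_eq_left (by positivity)] at h1
    exact h1.trans (EReal.coe_le_coe_iff.2 hcost)
  exact ⟨_, Mesh.uniformOn_nonneg _ _, M₁, M₂, hM₁, hM₂, hbound _ hA₁, hbound _ hA₂⟩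

end Families

end OptimalTransport

/-! ### The finite volume discretization is lawful and adapted -/

theorem proposition4p2 {d : ℕ} (hd : 1 ≤ d) (Ω : Set (OptimalTransport.Rd d))
    (hΩ : IsCompact Ω) (hconv : Convex ℝ Ω) (hint : (interior Ω).Nonempty)
    (hsmooth : OptimalTransport.HasSmoothBoundary Ω)
    (S : Set ℝ) (hS : S ⊆ Set.Ioi 0) (hS0 : AccPt 0 (𝓟 S))
    (𝒯 : S → OptimalTransport.Mesh Ω)
    (hreg : OptimalTransport.UniformlyRegular 𝒯) (hiso : OptimalTransport.Isotropic 𝒯)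
    (θ : ℝ → ℝ → ℝ) (hθ : OptimalTransport.IsAdmissibleMean θ) :
    (∀ σ, ((𝒯 σ).model θ).Lawful) ∧
      OptimalTransport.IsAdaptedWith Ω (fun σ => (𝒯 σ).model θ)
        (fun σ => (𝒯 σ).operators hΩ θ) := by
  obtain ⟨c, hc, hR⟩ := hreg.exists_isRegular hS
  obtain ⟨e, he, hI⟩ := hiso
  exact ⟨fun σ => (𝒯 σ).model_lawful hθ,
    { RCE_nonneg := fun σ _ hP => (𝒯 σ).RCE_nonneg hΩ hP
      RA_nonneg := fun σ _ hP => (𝒯 σ).RA_nonneg hΩ hP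
      SX_nonneg := fun σ _ hρ => (𝒯 σ).SX_nonneg hρ
      reconstruction_sampling := fun _ hρ φ =>
        OptimalTransport.tendsto_pair_RCE_SX hΩ hR hρ φ
      reconstructions_equivalent := fun _ hB =>
        OptimalTransport.exists_reconstructions_equivalent hΩ hconv hint hR hB
      reconstruction_derivation := fun _ hB =>
        OptimalTransport.exists_reconstruction_derivation hΩ hconv hint hR hB
      sampling_derivation := fun _ hm hflux σ =>
        (𝒯 σ).SX_divergenceWithin hΩ hconv hint hm hflux
      actionStar_le := fun _ hB =>
        OptimalTransport.exists_actionStar_le hΩ hconv hint hθ hR he hI hB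
      actionStar_le_sup := ⟨_, le_max_left _ _, fun b σ P =>
        OptimalTransport.Mesh.AStar_le_sup hθ (hR σ) hΩ P b⟩
      action_sampling_le := fun _ _ hB hδ hB' =>
        OptimalTransport.exists_action_sampling_le hΩ hconv hint hθ hR he hI hB hδ hB'
      controllability := OptimalTransport.exists_controllability hd hΩ hconv hθ hc hR }⟩
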